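/- Let $x$ be a complex random variable taking finitely many values, with $\mathrm{E}[x]=0$ and $\mathrm{E}|x|^2=1$. A standard complex Gaussian variable has independent real and imaginary parts, each distributed as $\mathcal N(0,1/2)$. For $\gamma\ge 0$ let $I_x(\gamma)=I(x;\sqrt{\gamma}\,x+n)$ be the mutual information in nats, where $n$ is standard complex Gaussian and independent of $x$. For $\zeta\ge0$ let $I_x^{\log}(\zeta)=I_x(e^{\zeta}-1)$, and let $\hat I_x^{\log}$ be its concave envelope on $[0,\infty)$, i.e. the smallest concave function bounding it from above. Let $\Delta_x=\sup_{\zeta\ge0}\,[\hat I_x^{\log}(\zeta)-I_x^{\log}(\zeta)]$. An ISI channel is given by finitely many complex taps $h_0,\dots,h_{L-1}$, with transfer function $H(\theta)=\sum_{k=0}^{L-1}h_ke^{-jk\theta}$. Put $$\mathsf{SNR}_{\mathrm{DFE}}=\exp\Big\{\tfrac1{2\pi}\int_{-\pi}^{\pi}\log(1+|H(\theta)|^2)\,d\theta\Big\}-1,\qquad I_{\mathrm{SL}}=I_x(\mathsf{SNR}_{\mathrm{DFE}}).$$ For block length $N$ and cyclic prefix length $N_{CP}$, the OFDM rate is $\mathcal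 I^{(N)}_{\mathrm{OFDM}}=\frac{1}{N+N_{CP}}I(\tilde{\mathbf x};\tilde{\mathbf y})$. Here $\tilde{\mathbf x}\in\mathbb C^N$ has i.i.d. entries distributed as $x$; $\tilde{\mathbf y}=\mathbf W(\mathbf H\mathbf W^{-1}\tilde{\mathbf x}+\mathbf n)$; $\mathbf W$ is the unitary DFT matrix of order $N$; $\mathbf H$ is the circulant matrix given by $(\mathbf H\mathbf v)_m=\sum_{l=0}^{L-1} h_l v_{(m-l)\bmod N}$; and $\mathbf n$ is a vector of i.i.d. standard complex Gaussian entries independent of $\tilde{\mathbf x}$. Put $$\mathcal I_{\mathrm{OFDM}}=\frac1{2\pi}\int_{-\pi}^{\pi}I_x(|H(\theta)|^2)\,d\theta .$$ Theorem. (a) The supremum defining $\Delta_x$ is finite and attained, $\Delta_x\ge0$, and $$\Delta_x=\sup_{\substack{0\le\gamma_1\le\gamma\le\gamma_2\\ \gamma_1<\gamma_2}}\frac{\log\left(\frac{1+\gamma}{1+\gamma_1}\right)[I_x(\gamma_2)-I_x(\gamma)]-\log\left(\frac{1+\gamma_2}{1+\gamma}\right)[I_x(\gamma)-I_x(\gamma_1)]}{\log\left(\frac{1+\gamma_2}{1+\gamma_1}\right)}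 .$$ (b) For every ISI channel, $\mathcal I_{\mathrm{OFDM}}=\lim_{N\to\infty}\mathcal I^{(N)}_{\mathrm{OFDM}}$ whenever $N_{CP}=N_{CP}(N)\to\infty$ with $N_{CP}=o(N)$, and $$\mathcal I_{\mathrm{OFDM}}\le I_{\mathrm{SL}}+\Delta_x .$$ (c) If $\Delta_x>0$, there are thresholds $0<\underline\gamma_1\le\underline\gamma_0\le\bar\gamma_0\le\bar\gamma_2<\infty$, depending only on the distribution of $x$, such that $\mathcal I_{\mathrm{OFDM}}\le I_{\mathrm{SL}}$ holds for every ISI channel satisfying at least one of: (1) $\mathsf{SNR}_{\mathrm{DFE}}\in[0,\underline\gamma_1]\cup[\bar\gamma_2,\infty)$; (2) $|H(\theta)|^2\le\underline\gamma_0$ for every $\theta\in(-\pi,\pi)$; (3) $|H(\theta)|^2\ge\bar\gamma_0$ for every $\theta\in(-\pi,\pi)$. Explicitly, $\underline\gamma_0$ is the largest and $\bar\gamma_0$ the smallest $\gamma\ge0$ for which $I_x^{\log}$ is concave on $[0,\log(1+\gamma)]$, respectively on $[\log(1+\gamma),\infty)$; and $\underline\gamma_1$ is the largest and $\bar\gamma_2$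 the smallest $\gamma\ge0$ for which $\hat I_x^{\log}=I_x^{\log}$ on $[0,\log(1+\gamma)]$, respectively on $[\log(1+\gamma),\infty)$. -/

import Mathlib

open MeasureTheory ProbabilityTheory Filter Topology Set
open scoped Matrix

noncomputable section

namespace ISIChannel

/-- The standard complex Gaussian law: independent real and imaginary parts, each `N(0, 1/2)`. -/
def complexGaussian : Measure ℂ :=
  ((gaussianReal 0 (1 / 2)).prod (gaussianReal 0 (1 / 2))).map
    (fun p : ℝ × ℝ => (⟨p.1, p.2⟩ : ℂ))

/-- Mutual information `I(A; B)` in nats, where `ρ` is the joint law of `(A, B)`: the relative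
entropy of the joint law with respect to the product of its marginals. -/
def mutualInfo {α β : Type*} [MeasurableSpace α] [MeasurableSpace β]
    (ρ : Measure (α × β)) : ℝ :=
  (InformationTheory.klDiv ρ (ρ.fst.prod ρ.snd)).toReal

/-- `I_x(γ) = I(x ; √γ x + n)` for an input `x` with law `P` and an independent standard complex
Gaussian noise `n`. -/
def scalarInfo (P : Measure ℂ) (γ : ℝ) : ℝ :=
  mutualInfo ((P.prod complexGaussian).map
    (fun p : ℂ × ℂ => (p.1, (Real.sqrt γ : ℂ) * p.1 + p.2)))

/-- Mutual information as a function of the log-SNR `ζ = log (1 + γ)`. -/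
def logInfo (P : Measure ℂ) (ζ : ℝ) : ℝ :=
  scalarInfo P (Real.exp ζ - 1)

/-- The concave envelope on `[0, ∞)`: the pointwise infimum of the concave functions on `[0, ∞)`
that bound `f` from above there. -/
def concaveEnvelope (f : ℝ → ℝ) (ζ : ℝ) : ℝ :=
  sInf {v : ℝ | ∃ g : ℝ → ℝ,
    ConcaveOn ℝ (Ici 0) g ∧ (∀ s ∈ Ici (0 : ℝ), f s ≤ g s) ∧ v = g ζ}

/-- The differences, over `ζ ≥ 0`, between the concave envelope of `logInfo P` and `logInfo P`. -/
def gapSet (P : Measure ℂ) : Set ℝ :=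
  {d : ℝ | ∃ ζ : ℝ, 0 ≤ ζ ∧ d = concaveEnvelope (logInfo P) ζ - logInfo P ζ}

/-- `Δ_x`. -/
def gap (P : Measure ℂ) : ℝ := sSup (gapSet P)

/-- The values of the objective of the three-variable optimization over
`0 ≤ γ₁ ≤ γ ≤ γ₂`, `γ₁ < γ₂`. -/
def gapFormulaSet (P : Measure ℂ) : Set ℝ :=
  {d : ℝ | ∃ γ₁ γ₂ γ : ℝ, 0 ≤ γ₁ ∧ γ₁ ≤ γ ∧ γ ≤ γ₂ ∧ γ₁ < γ₂ ∧
    d = (Real.log ((1 + γ) / (1 + γ₁)) * (scalarInfo P γ₂ - scalarInfo P γ)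
          - Real.log ((1 + γ₂) / (1 + γ)) * (scalarInfo P γ - scalarInfo P γ₁))
        / Real.log ((1 + γ₂) / (1 + γ₁))}

/-- The transfer function `H(θ) = ∑ h_k e^{-jkθ}` of the channel with taps `h`. -/
def transfer {L : ℕ} (h : Fin L → ℂ) (θ : ℝ) : ℂ :=
  ∑ k : Fin L, h k * Complex.exp (-(Complex.I * ((k : ℕ) : ℂ) * (θ : ℂ)))

/-- The output SNR of the unbiased MMSE decision-feedback equalizer. -/
def snrDFE {L : ℕ} (h : Fin L → ℂ) : ℝ :=
  Real.exp (1 / (2 * Real.pi) *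
    ∫ θ in (-Real.pi)..Real.pi, Real.log (1 + ‖transfer h θ‖ ^ 2)) - 1

/-- The Shamai-Laroia approximation `I_SL`. -/
def infoSL (P : Measure ℂ) {L : ℕ} (h : Fin L → ℂ) : ℝ :=
  scalarInfo P (snrDFE h)

/-- The circulant matrix of the cyclic-prefixed channel on blocks of length `N`:
`(H x)_m = ∑ₗ hₗ x_{(m - l) mod N}`. -/
def circulantMatrix {L : ℕ} (h : Fin L → ℂ) (N : ℕ) : Matrix (Fin N) (Fin N) ℂ :=
  Matrix.of fun m k => ∑ l : Fin L, if ((k : ℕ) + (l : ℕ)) % N = (m : ℕ) then h l else 0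

/-- The unitary DFT matrix of order `N`. -/
def dftMatrix (N : ℕ) : Matrix (Fin N) (Fin N) ℂ :=
  Matrix.of fun m k => (1 / (Real.sqrt N : ℂ)) *
    Complex.exp (-(2 * (Real.pi : ℂ) * Complex.I * ((m : ℕ) : ℂ) * ((k : ℕ) : ℂ) / (N : ℂ)))

/-- Joint law of the OFDM symbols `x̃` (i.i.d. with law `P`) and `ỹ = W y`, where
`y = H x + n`, `x = W⁻¹ x̃`, and `n` is a standard complex Gaussian vector independent of `x̃`. -/
def ofdmLaw (P : Measure ℂ) {L : ℕ} (h : Fin L → ℂ) (N : ℕ) :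
    Measure ((Fin N → ℂ) × (Fin N → ℂ)) :=
  ((Measure.pi fun _ : Fin N => P).prod (Measure.pi fun _ : Fin N => complexGaussian)).map
    (fun p => (p.1,
      dftMatrix N *ᵥ (circulantMatrix h N *ᵥ ((dftMatrix N)⁻¹ *ᵥ p.1) + p.2)))

/-- The OFDM rate per channel input with block length `N` and cyclic prefix length `Ncp`. -/
def ofdmRate (P : Measure ℂ) {L : ℕ} (h : Fin L → ℂ) (N Ncp : ℕ) : ℝ :=
  1 / ((N : ℝ) + (Ncp : ℝ)) * mutualInfo (ofdmLaw P h N)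

/-- The large-block OFDM rate `I_OFDM` (the theorem asserts that it is the limit of `ofdmRate`). -/
def infoOFDM (P : Measure ℂ) {L : ℕ} (h : Fin L → ℂ) : ℝ :=
  1 / (2 * Real.pi) * ∫ θ in (-Real.pi)..Real.pi, scalarInfo P (‖transfer h θ‖ ^ 2)

end ISIChannel

end

namespace ISIChannel

/-! ### The standard complex Gaussian law -/

/-! Everything is read off the curve `f = logInfo P`, the information as a function of ζ = log(1 +
γ). The DFT diagonalises the circulant channel and preserves the law of the noise, so an OFDM block
is `N` parallel scalar channels with gains H(2πk/N) (`mutualInfo_ofdmLaw`), and the rate is a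
Riemann sum. With φ = log(1 + |H|²), I_OFDM is the mean of f(φ), while I_SL is f at the mean of φ.
Jensen's inequality for the concave envelope F of f gives mean f(φ) ≤ mean F(φ) ≤ F(mean φ) ≤ f(mean
φ) + Δ. Nothing is lost when F touches f at mean φ, or when f itself is concave on an interval
containing the values of φ.

The gap F - f is continuous and vanishes at 0. The curve increases and is bounded by the entropy of
x, and F is bounded by the supremum of f, so the gap vanishes at infinity and has a maximum. On the
line, F at a point is the supremum of the chords over it, which yields the three-variable formula.

The analytic work is to prove f concave near 0 and near infinity, so that the thresholds are
positive and finite. By the I-MMSE relation f'(ζ) = (1 + γ) mmse(γ), and mmse' = -`covEnergy`, which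
is minus twice the mean squared Frobenius norm of the posterior covariance. Both derivatives come
from the heat flow identity `hasDerivAt_gaussAvg`, because the likelihood solves the backward heat
equation. Concavity of f therefore means mmse ≤ (1 + γ) `covEnergy`.

At high SNR, mmse = O(exp(-γd²/4)) with d the minimum distance, while `covEnergy` is at least a
constant times exp(-γd²/4)/√γ, because the noise may carry a symbol to the midpoint of a closest
pair; the factor 1 + γ then wins (`exists_high_snr`).

At low SNR the two sides may agree to leading order. Both defects are measured against the
linear-Gaussian model: 1/(1 + γ) - mmse is the mean squared distance of the conditional mean from
the linear estimate, and a Poincaré inequality for the channel output, with a constant that vanishes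
with γ, bounds it by the distance of the posterior covariance from its Gaussian value
(`mmse_le_mul_covEnergy_of_le`).

Strictness also matters: 0 < f' < 1 for ζ > 0, and f' tends to 1 at 0. Then tangents to f at points
near 0, and at points near infinity, lie above the whole curve, so F = f there (`exists_touch_low`,
`exists_touch_high`). -/

lemma complexGaussian_eq_map_equiv :
    complexGaussian = ((gaussianReal 0 (1 / 2)).prod (gaussianReal 0 (1 / 2))).map
      Complex.equivRealProdCLM.symm := by
  unfold complexGaussian
  congr 1

instance isGaussian_complexGaussian : IsGaussian complexGaussian := by
  rw [complexGaussian_eq_map_equiv]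
  infer_instance

lemma lintegral_complexGaussian (F : ℂ → ENNReal) :
    ∫⁻ z, F z ∂complexGaussian =
      ∫⁻ q, F ⟨q.1, q.2⟩ ∂((gaussianReal 0 (1 / 2)).prod (gaussianReal 0 (1 / 2))) := by
  have := lintegral_map_equiv (μ := (gaussianReal 0 (1 / 2)).prod (gaussianReal 0 (1 / 2)))
    F Complex.measurableEquivRealProd.symm
  exact this

lemma integral_complexGaussian {E : Type*} [NormedAddCommGroup E] [NormedSpace ℝ E] (F : ℂ → E) :
    ∫ z, F z ∂complexGaussian =
      ∫ q, F ⟨q.1, q.2⟩ ∂((gaussianReal 0 (1 / 2)).prod (gaussianReal 0 (1 / 2))) := by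
  have := integral_map_equiv (μ := (gaussianReal 0 (1 / 2)).prod (gaussianReal 0 (1 / 2)))
    Complex.measurableEquivRealProd.symm F
  exact this

lemma integrable_complexGaussian_iff {E : Type*} [NormedAddCommGroup E] (F : ℂ → E) :
    Integrable F complexGaussian ↔ Integrable (fun q : ℝ × ℝ => F ⟨q.1, q.2⟩)
      ((gaussianReal 0 (1 / 2)).prod (gaussianReal 0 (1 / 2))) := by
  have := integrable_map_equiv (μ := (gaussianReal 0 (1 / 2)).prod (gaussianReal 0 (1 / 2)))
    Complex.measurableEquivRealProd.symm F
  exact this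

lemma integral_id_complexGaussian : ∫ z, z ∂complexGaussian = 0 := by
  have hint : Integrable (fun z : ℂ => z) complexGaussian :=
    IsGaussian.integrable_id (μ := complexGaussian)
  apply Complex.ext
  · have h := integral_re hint (𝕜 := ℂ)
    simp only [RCLike.re_to_complex] at h
    rw [← h, integral_complexGaussian]
    have := integral_prod_mul (μ := gaussianReal 0 (1 / 2)) (ν := gaussianReal 0 (1 / 2))
      (fun x : ℝ => x) (fun _ : ℝ => (1 : ℝ))
    simpa [integral_id_gaussianReal] using this
  · have h := integral_im hint (𝕜 := ℂ)
    simp only [RCLike.im_to_complex] at h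
    rw [← h, integral_complexGaussian]
    have := integral_prod_mul (μ := gaussianReal 0 (1 / 2)) (ν := gaussianReal 0 (1 / 2))
      (fun _ : ℝ => (1 : ℝ)) (fun x : ℝ => x)
    simpa [integral_id_gaussianReal] using this

lemma charFun_complexGaussian (t : ℂ) :
    charFun complexGaussian t = Complex.exp (-(‖t‖ ^ 2 : ℝ) / 4) := by
  rw [charFun_apply, integral_complexGaussian]
  have h1 : ∀ q : ℝ × ℝ, Complex.exp ((inner ℝ (⟨q.1, q.2⟩ : ℂ) t : ℝ) * Complex.I) =
      Complex.exp ((t.re * q.1 : ℂ) * Complex.I) * Complex.exp ((t.im * q.2 : ℂ) * Complex.I) := by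
    intro q
    rw [← Complex.exp_add]
    congr 1
    simp [Complex.inner]
    ring
  simp_rw [h1]
  rw [integral_prod_mul (f := fun x : ℝ => Complex.exp ((t.re * x : ℂ) * Complex.I))
    (g := fun x : ℝ => Complex.exp ((t.im * x : ℂ) * Complex.I))]
  have h2 := charFun_gaussianReal (μ := 0) (v := 1 / 2) t.re
  have h3 := charFun_gaussianReal (μ := 0) (v := 1 / 2) t.im
  rw [charFun_apply_real] at h2 h3
  rw [h2, h3, ← Complex.exp_add]
  congr 1
  rw [← Complex.normSq_eq_norm_sq, Complex.normSq_apply]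
  push_cast
  ring

/-- The characteristic function depends on ‖t‖ only. This is what makes the phase of a channel gain
irrelevant. -/
lemma complexGaussian_map_mul_of_norm_eq_one {u : ℂ} (hu : ‖u‖ = 1) :
    complexGaussian.map (fun z => u * z) = complexGaussian := by
  have : IsFiniteMeasure (complexGaussian.map (fun z => u * z)) := by infer_instance
  refine Measure.ext_of_charFun (funext fun t => ?_)
  rw [charFun_apply, integral_map (by fun_prop) (by fun_prop)]
  have h1 : ∀ z : ℂ, (inner ℝ (u * z) t : ℝ) = inner ℝ z ((starRingEnd ℂ) u * t) := by
    intro z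
    simp [Complex.inner]
    ring
  simp_rw [h1]
  rw [← charFun_apply, charFun_complexGaussian, charFun_complexGaussian]
  simp [hu]

/-- Completing the square; the factor 2 in the exponent is the inverse of twice the variance, times
the cross term. -/
lemma gaussianReal_map_const_add_eq_withDensity (v : ℝ) :
    (gaussianReal 0 (1 / 2)).map (fun x => v + x) =
      (gaussianReal 0 (1 / 2)).withDensity
        (fun x => ENNReal.ofReal (Real.exp (2 * (x * v) - v ^ 2))) := by
  rw [gaussianReal_map_const_add, gaussianReal_of_var_ne_zero _ (by norm_num),
    gaussianReal_of_var_ne_zero _ (by norm_num),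
    ← withDensity_mul _ (by fun_prop) (by fun_prop)]
  congr 1
  ext x
  simp only [gaussianPDF, Pi.mul_apply]
  rw [← ENNReal.ofReal_mul (gaussianPDFReal_nonneg _ _ _)]
  congr 1
  simp only [gaussianPDFReal]
  rw [mul_assoc, mul_assoc, ← Real.exp_add]
  congr 2
  push_cast
  ring

/-- Cameron–Martin: the law of `v + n`, relative to the law of `n`. -/
lemma complexGaussian_map_const_add (v : ℂ) :
    complexGaussian.map (fun z => v + z) = complexGaussian.withDensity (fun z =>
      ENNReal.ofReal (Real.exp (2 * (z.re * v.re + z.im * v.im) - (v.re ^ 2 + v.im ^ 2)))) := by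
  refine Measure.ext_of_lintegral _ fun F hF => ?_
  rw [lintegral_map hF (by fun_prop), lintegral_withDensity_eq_lintegral_mul _ (by fun_prop) hF,
    lintegral_complexGaussian, lintegral_complexGaussian]
  have hprod : ((gaussianReal 0 (1 / 2)).prod (gaussianReal 0 (1 / 2))).map
      (Prod.map (fun x => v.re + x) (fun x => v.im + x)) = _ :=
    (Measure.map_prod_map (gaussianReal 0 (1 / 2)) (gaussianReal 0 (1 / 2))
      (f := fun x => v.re + x) (g := fun x => v.im + x) (by fun_prop) (by fun_prop)).symm
  rw [gaussianReal_map_const_add_eq_withDensity, gaussianReal_map_const_add_eq_withDensity,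
    prod_withDensity (by fun_prop) (by fun_prop)] at hprod
  have hmk : Measurable fun q : ℝ × ℝ => (⟨q.1, q.2⟩ : ℂ) :=
    Complex.measurableEquivRealProd.symm.measurable
  have hF' : Measurable fun q : ℝ × ℝ => F ⟨q.1, q.2⟩ := hF.comp hmk
  have h := congrArg (fun μ : Measure (ℝ × ℝ) => ∫⁻ q, F ⟨q.1, q.2⟩ ∂μ) hprod
  rw [lintegral_map hF' (by fun_prop),
    lintegral_withDensity_eq_lintegral_mul _ (by fun_prop) hF'] at h
  refine Eq.trans rfl (h.trans (lintegral_congr fun q => ?_))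
  change ENNReal.ofReal _ * ENNReal.ofReal _ * _ = ENNReal.ofReal _ * _
  rw [← ENNReal.ofReal_mul (by positivity), ← Real.exp_add]
  congr 3
  ring

lemma integral_complexGaussian_const_add (F : ℂ → ℝ) (v : ℂ) :
    ∫ z, F (v + z) ∂complexGaussian = ∫ z,
      Real.exp (2 * (z.re * v.re + z.im * v.im) - (v.re ^ 2 + v.im ^ 2)) * F z
        ∂complexGaussian := by
  have h1 := (MeasurableEquiv.addLeft v).measurableEmbedding.integral_map
    (μ := complexGaussian) F
  have hc : ⇑(MeasurableEquiv.addLeft v) = fun z => v + z := rfl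
  rw [hc] at h1
  rw [← h1, complexGaussian_map_const_add, integral_withDensity_eq_integral_toReal_smul
    (by fun_prop) (by simp)]
  refine integral_congr_ae (Eventually.of_forall fun z => ?_)
  simp [ENNReal.toReal_ofReal (Real.exp_pos _).le]

lemma integrable_exp_abs_complexGaussian (k : ℝ) :
    Integrable (fun z : ℂ => Real.exp (k * (|z.re| + |z.im|))) complexGaussian := by
  rw [integrable_complexGaussian_iff]
  have h1 : Integrable (fun x : ℝ => Real.exp (k * |x|)) (gaussianReal 0 (1 / 2)) := by
    refine Integrable.mono' ((integrable_exp_mul_gaussianReal k).add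
      (integrable_exp_mul_gaussianReal (-k))) (by fun_prop) (Eventually.of_forall fun x => ?_)
    rw [Real.norm_of_nonneg (by positivity)]
    rcases abs_cases x with ⟨h, _⟩ | ⟨h, _⟩ <;> rw [h]
    · simp only [Pi.add_apply]; linarith [Real.exp_pos (-k * x)]
    · simp only [Pi.add_apply]
      have : k * -x = -k * x := by ring
      rw [this]
      linarith [Real.exp_pos (k * x)]
  have := h1.mul_prod h1
  refine this.congr (Eventually.of_forall fun q => ?_)
  simp only [← Real.exp_add]
  congr 1
  ring

/-- The law of a vector of independent standard complex Gaussians is invariant under unitary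
matrices. -/
lemma pi_complexGaussian_map_unitary {ι : Type*} [Fintype ι] [DecidableEq ι] (W : Matrix ι ι ℂ)
    (hW : W * Wᴴ = 1) :
    (Measure.pi fun _ : ι => complexGaussian).map (fun z => W *ᵥ z) =
      Measure.pi fun _ : ι => complexGaussian := by
  set μ := Measure.pi fun _ : ι => complexGaussian
  have hmeas : Measurable fun z : ι → ℂ => W *ᵥ z :=
    (Continuous.matrix_mulVec continuous_const continuous_id).measurable
  have hμ : ∀ t : EuclideanSpace ℂ ι, charFun (μ.map (WithLp.toLp 2)) t =
      Complex.exp (-((∑ i, ‖t i‖ ^ 2 : ℝ) : ℂ) / 4) := by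
    intro t
    rw [charFun_pi]
    simp_rw [charFun_complexGaussian]
    rw [← Complex.exp_sum]
    congr 1
    push_cast
    rw [← Finset.sum_div, Finset.sum_neg_distrib]
  have hinj : Function.Injective
      (fun ν : Measure (ι → ℂ) => ν.map (MeasurableEquiv.toLp 2 (ι → ℂ))) :=
    (MeasurableEquiv.toLp 2 (ι → ℂ)).map_measurableEquiv_injective
  refine hinj ?_
  simp only [MeasurableEquiv.coe_toLp]
  have : IsFiniteMeasure (μ.map fun z => W *ᵥ z) := by infer_instance
  refine Measure.ext_of_charFun (funext fun t => ?_)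
  rw [hμ, charFun_apply, integral_map (by fun_prop) (by fun_prop),
    integral_map hmeas.aemeasurable (by fun_prop)]
  -- The matrix moves to the other side of the inner product as `Wᴴ`, which preserves the norm of
  -- `t`, the only quantity in the characteristic function.
  have hin : ∀ z : ι → ℂ, (inner ℝ (WithLp.toLp 2 (W *ᵥ z) : EuclideanSpace ℂ ι) t : ℝ) =
      inner ℝ (WithLp.toLp 2 z : EuclideanSpace ℂ ι)
        (WithLp.toLp 2 (Wᴴ *ᵥ t.ofLp) : EuclideanSpace ℂ ι) := by
    intro z
    simp only [PiLp.inner_apply, Complex.inner]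
    rw [← Complex.re_sum, ← Complex.re_sum]
    congr 1
    have h1 : ∑ i, t.ofLp i * (starRingEnd ℂ) ((W *ᵥ z) i) = star (W *ᵥ z) ⬝ᵥ t.ofLp :=
      Finset.sum_congr rfl fun i _ => mul_comm _ _
    have h2 : ∑ i, (Wᴴ *ᵥ t.ofLp) i * (starRingEnd ℂ) (z i) = star z ⬝ᵥ (Wᴴ *ᵥ t.ofLp) :=
      Finset.sum_congr rfl fun i _ => mul_comm _ _
    rw [h1, h2, Matrix.star_mulVec, ← Matrix.dotProduct_mulVec]
  simp_rw [hin]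
  have h3 := hμ (WithLp.toLp 2 (Wᴴ *ᵥ t.ofLp))
  rw [charFun_apply, integral_map (by fun_prop) (by fun_prop)] at h3
  rw [h3]
  congr 3
  have h4 : ∀ s : ι → ℂ, ((∑ i, ‖s i‖ ^ 2 : ℝ) : ℂ) = star s ⬝ᵥ s := by
    intro s
    simp only [dotProduct, Pi.star_apply]
    push_cast
    refine Finset.sum_congr rfl fun i _ => ?_
    rw [← Complex.conj_mul']
    rfl
  rw [h4, h4, Matrix.star_mulVec, Matrix.conjTranspose_conjTranspose, ← Matrix.dotProduct_mulVec,
    Matrix.mulVec_mulVec, hW, Matrix.one_mulVec]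

/-! ### Mutual information of a channel given by a density -/

/-- Here `k (x, ·)` is the output density given the input `x`, and `m` is its average over the
inputs. The marginals are therefore `π` and `m ν`, and the joint law has density `k / m` with
respect to their product. -/
lemma mutualInfo_withDensity {α β : Type*} [MeasurableSpace α] [MeasurableSpace β]
    (π : Measure α) [IsProbabilityMeasure π] (ν : Measure β) [IsProbabilityMeasure ν]
    (k : α × β → ℝ) (hk : Measurable k) (hpos : ∀ z, 0 < k z)
    (hone : ∀ x, ∫⁻ y, ENNReal.ofReal (k (x, y)) ∂ν = 1)
    (m : β → ℝ) (hm : Measurable m) (hmpos : ∀ y, 0 < m y)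
    (hmk : ∀ y, ∫⁻ x, ENNReal.ofReal (k (x, y)) ∂π = ENNReal.ofReal (m y)) :
    mutualInfo ((π.prod ν).withDensity fun z => ENNReal.ofReal (k z)) =
      ∫ z, Real.log (k z / m z.2) ∂((π.prod ν).withDensity fun z => ENNReal.ofReal (k z)) := by
  set ρ := (π.prod ν).withDensity fun z => ENNReal.ofReal (k z) with hρ
  have hke : Measurable fun z => ENNReal.ofReal (k z) := by fun_prop
  have hfst : ρ.fst = π := by
    refine Measure.ext_of_lintegral _ fun F hF => ?_
    rw [Measure.fst, lintegral_map hF measurable_fst,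
      hρ,
      lintegral_withDensity_eq_lintegral_mul _ hke (g := fun z => F z.1) (by fun_prop),
      lintegral_prod _ (by fun_prop)]
    refine lintegral_congr fun x => ?_
    simp only [Pi.mul_apply]
    rw [lintegral_mul_const _ (by fun_prop), hone, one_mul]
  have hsnd : ρ.snd = ν.withDensity fun y => ENNReal.ofReal (m y) := by
    refine Measure.ext_of_lintegral _ fun F hF => ?_
    rw [Measure.snd, lintegral_map hF measurable_snd,
      hρ,
      lintegral_withDensity_eq_lintegral_mul _ hke (g := fun z => F z.2) (by fun_prop),
      lintegral_prod_symm' _ (by fun_prop),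
      lintegral_withDensity_eq_lintegral_mul _ (by fun_prop) hF]
    refine lintegral_congr fun y => ?_
    simp only [Pi.mul_apply]
    rw [lintegral_mul_const _ (by fun_prop), hmk]
  have hprob : IsProbabilityMeasure ρ := by
    refine ⟨?_⟩
    have : ρ.fst univ = 1 := by rw [hfst]; simp
    rwa [Measure.fst_univ] at this
  have hρ' : ρ = (ρ.fst.prod ρ.snd).withDensity
      (fun z => ENNReal.ofReal (k z / m z.2)) := by
    rw [hfst, hsnd, prod_withDensity_right (by fun_prop),
      ← withDensity_mul _ (by fun_prop) (by fun_prop), hρ]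
    congr 1
    ext z
    simp only [Pi.mul_apply]
    rw [← ENNReal.ofReal_mul (hmpos _).le, mul_div_cancel₀ _ (hmpos _).ne']
  have hac : ρ ≪ ρ.fst.prod ρ.snd := by
    conv_lhs => rw [hρ']
    exact withDensity_absolutelyContinuous _ _
  unfold mutualInfo
  -- Both measures have mass one, so the divergence is the plain integral of the log-likelihood
  -- ratio, without a mass correction.
  rw [InformationTheory.toReal_klDiv_of_measure_eq hac (by simp)]
  refine integral_congr_ae ?_
  have hrn : ρ.rnDeriv (ρ.fst.prod ρ.snd) =ᵐ[ρ.fst.prod ρ.snd]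
      fun z => ENNReal.ofReal (k z / m z.2) := by
    conv_lhs => rw [hρ']
    have : SigmaFinite (ρ.fst.prod ρ.snd) := inferInstance
    have h := Measure.rnDeriv_withDensity (ρ.fst.prod ρ.snd)
      (f := fun z => ENNReal.ofReal (k z / m z.2)) (by fun_prop)
    rwa [← hρ'] at h ⊢
  filter_upwards [hac.ae_le hrn] with z hz
  rw [llr, hz, ENNReal.toReal_ofReal (div_pos (hpos _) (hmpos _)).le]

/-! ### Additive Gaussian channels with finitely supported inputs -/

/-- The density of `v + n` with respect to the law of the noise `n`. -/
noncomputable def shiftDensity (v y : ℂ) : ℝ :=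
  Real.exp (2 * (y.re * v.re + y.im * v.im) - (v.re ^ 2 + v.im ^ 2))

lemma shiftDensity_pos (v y : ℂ) : 0 < shiftDensity v y := Real.exp_pos _

@[fun_prop]
lemma measurable_shiftDensity {α : Type*} [MeasurableSpace α] {f g : α → ℂ} (hf : Measurable f)
    (hg : Measurable g) : Measurable fun a => shiftDensity (f a) (g a) := by
  unfold shiftDensity; fun_prop

lemma map_add_eq_withDensity_shiftDensity (v : ℂ) :
    complexGaussian.map (fun z => v + z) =
      complexGaussian.withDensity (fun z => ENNReal.ofReal (shiftDensity v z)) :=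
  complexGaussian_map_const_add v

lemma lintegral_shiftDensity (v : ℂ) :
    ∫⁻ y, ENNReal.ofReal (shiftDensity v y) ∂complexGaussian = 1 := by
  have h := congrArg (fun μ : Measure ℂ => μ univ) (map_add_eq_withDensity_shiftDensity v)
  simp only [withDensity_apply _ MeasurableSet.univ, Measure.restrict_univ] at h
  rw [← h, Measure.map_apply (by fun_prop) MeasurableSet.univ]
  simp

/-- The density of the channel output with respect to the law of the noise. -/
noncomputable def mixDensity (P : Measure ℂ) (S : Finset ℂ) (c y : ℂ) : ℝ :=
  ∑ x ∈ S, P.real {x} * shiftDensity (c * x) y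

@[fun_prop]
lemma measurable_mixDensity (P : Measure ℂ) (S : Finset ℂ) (c : ℂ) {α : Type*} [MeasurableSpace α]
    {g : α → ℂ} (hg : Measurable g) : Measurable fun a => mixDensity P S c (g a) := by
  unfold mixDensity; fun_prop

/-- The information density of the channel with gain `c`. -/
noncomputable def infoDensity (P : Measure ℂ) (S : Finset ℂ) (c : ℂ) (z : ℂ × ℂ) : ℝ :=
  Real.log (shiftDensity (c * z.1) z.2 / mixDensity P S c z.2)

@[fun_prop]
lemma measurable_infoDensity (P : Measure ℂ) (S : Finset ℂ) (c : ℂ) :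
    Measurable (infoDensity P S c) := by
  unfold infoDensity; fun_prop

/-- The mutual information across the channel `x ↦ c x + n`. -/
noncomputable def gainInfo (P : Measure ℂ) (S : Finset ℂ) (c : ℂ) : ℝ :=
  ∫ z, infoDensity P S c (z.1, c * z.1 + z.2) ∂(P.prod complexGaussian)


lemma restrict_eq_self_of_compl_null {P : Measure ℂ} {S : Finset ℂ}
    (hS : P ((S : Set ℂ)ᶜ) = 0) : P.restrict (S : Set ℂ) = P :=
  Measure.restrict_eq_self_of_ae_mem (by
    rw [ae_iff]; exact hS)

lemma lintegral_eq_sum_of_compl_null {P : Measure ℂ} {S : Finset ℂ}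
    (hS : P ((S : Set ℂ)ᶜ) = 0) (F : ℂ → ENNReal) :
    ∫⁻ x, F x ∂P = ∑ x ∈ S, F x * P {x} := by
  conv_lhs => rw [← restrict_eq_self_of_compl_null hS]
  exact lintegral_finset S F

lemma integral_eq_sum_of_compl_null {P : Measure ℂ} [IsProbabilityMeasure P] {S : Finset ℂ}
    (hS : P ((S : Set ℂ)ᶜ) = 0) (F : ℂ → ℝ) :
    ∫ x, F x ∂P = ∑ x ∈ S, P.real {x} * F x := by
  conv_lhs => rw [← restrict_eq_self_of_compl_null hS]
  rw [setIntegral_finset S IntegrableOn.finset]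
  rfl

lemma sum_real_singleton_eq_one {P : Measure ℂ} [IsProbabilityMeasure P] {S : Finset ℂ}
    (hS : P ((S : Set ℂ)ᶜ) = 0) : ∑ x ∈ S, P.real {x} = 1 := by
  have := integral_eq_sum_of_compl_null hS (fun _ => 1)
  simpa using this.symm

lemma mixDensity_pos {P : Measure ℂ} [IsProbabilityMeasure P] {S : Finset ℂ}
    (hS : P ((S : Set ℂ)ᶜ) = 0) (c y : ℂ) : 0 < mixDensity P S c y := by
  unfold mixDensity
  obtain ⟨x, hx, hpx⟩ : ∃ x ∈ S, 0 < P.real {x} := by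
    by_contra! hcon
    have := Finset.sum_nonpos hcon
    rw [sum_real_singleton_eq_one hS] at this
    linarith
  exact Finset.sum_pos' (fun i _ => mul_nonneg measureReal_nonneg (shiftDensity_pos _ _).le)
    ⟨x, hx, mul_pos hpx (shiftDensity_pos _ _)⟩

lemma lintegral_shiftDensity_mul {P : Measure ℂ} [IsProbabilityMeasure P] {S : Finset ℂ}
    (hS : P ((S : Set ℂ)ᶜ) = 0) (c y : ℂ) :
    ∫⁻ x, ENNReal.ofReal (shiftDensity (c * x) y) ∂P = ENNReal.ofReal (mixDensity P S c y) := by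
  rw [lintegral_eq_sum_of_compl_null hS, mixDensity, ENNReal.ofReal_sum_of_nonneg
    (fun i _ => mul_nonneg measureReal_nonneg (shiftDensity_pos _ _).le)]
  refine Finset.sum_congr rfl fun x _ => ?_
  rw [ENNReal.ofReal_mul measureReal_nonneg, ofReal_measureReal, mul_comm]

/-- The conditional density lies in [exp(-r), exp(r)] with r affine in |y.re| + |y.im|, and so does
the mixture, as a convex combination. The log-ratio thus grows at most linearly, which gives
integrability. -/
lemma abs_infoDensity_le {P : Measure ℂ} [IsProbabilityMeasure P] {S : Finset ℂ}
    (hS : P ((S : Set ℂ)ᶜ) = 0) {c x : ℂ} (hx : x ∈ S) {R : ℝ} (hR : ∀ x ∈ S, ‖c * x‖ ≤ R) (y : ℂ) :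
    |infoDensity P S c (x, y)| ≤ 2 * (2 * R * (|y.re| + |y.im|) + 2 * R ^ 2) := by
  set r := 2 * R * (|y.re| + |y.im|) + 2 * R ^ 2
  have hexp : ∀ x ∈ S,
      |2 * (y.re * (c * x).re + y.im * (c * x).im) - ((c * x).re ^ 2 + (c * x).im ^ 2)| ≤ r := by
    intro x hx
    have h1 : |(c * x).re| ≤ R := (Complex.abs_re_le_norm _).trans (hR x hx)
    have h2 : |(c * x).im| ≤ R := (Complex.abs_im_le_norm _).trans (hR x hx)
    have h3 : |y.re * (c * x).re| ≤ |y.re| * R := by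
      rw [abs_mul]; exact mul_le_mul_of_nonneg_left h1 (abs_nonneg _)
    have h4 : |y.im * (c * x).im| ≤ |y.im| * R := by
      rw [abs_mul]; exact mul_le_mul_of_nonneg_left h2 (abs_nonneg _)
    have h5 := sq_le_sq' (abs_le.1 h1).1 (abs_le.1 h1).2
    have h6 := sq_le_sq' (abs_le.1 h2).1 (abs_le.1 h2).2
    rw [abs_le] at h3 h4 ⊢
    simp only [r]
    constructor <;> nlinarith [sq_nonneg (c * x).re, sq_nonneg (c * x).im]
  have hlow : ∀ x ∈ S, Real.exp (-r) ≤ shiftDensity (c * x) y := fun x hx =>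
    Real.exp_le_exp.2 (abs_le.1 (hexp x hx)).1
  have hup : ∀ x ∈ S, shiftDensity (c * x) y ≤ Real.exp r := fun x hx =>
    Real.exp_le_exp.2 (abs_le.1 (hexp x hx)).2
  have hmlow : Real.exp (-r) ≤ mixDensity P S c y := by
    calc Real.exp (-r) = ∑ x ∈ S, P.real {x} * Real.exp (-r) := by
          rw [← Finset.sum_mul, sum_real_singleton_eq_one hS, one_mul]
      _ ≤ _ := Finset.sum_le_sum fun x hx =>
          mul_le_mul_of_nonneg_left (hlow x hx) measureReal_nonneg
  have hmup : mixDensity P S c y ≤ Real.exp r := by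
    calc mixDensity P S c y ≤ ∑ x ∈ S, P.real {x} * Real.exp r := Finset.sum_le_sum fun x hx =>
          mul_le_mul_of_nonneg_left (hup x hx) measureReal_nonneg
      _ = _ := by rw [← Finset.sum_mul, sum_real_singleton_eq_one hS, one_mul]
  have hm := mixDensity_pos hS c y
  simp only [infoDensity]
  rw [Real.log_div (shiftDensity_pos _ _).ne' hm.ne']
  have e1 := Real.log_le_log (Real.exp_pos _) (hlow x hx)
  have e2 := Real.log_le_log (shiftDensity_pos _ _) (hup x hx)
  have e3 := Real.log_le_log (Real.exp_pos _) hmlow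
  have e4 := Real.log_le_log hm hmup
  rw [Real.log_exp] at e1 e2 e3 e4
  rw [abs_le]
  constructor <;> linarith

lemma integrable_infoDensity {P : Measure ℂ} [IsProbabilityMeasure P] {S : Finset ℂ}
    (hS : P ((S : Set ℂ)ᶜ) = 0) (c : ℂ) :
    Integrable (fun z : ℂ × ℂ => infoDensity P S c (z.1, c * z.1 + z.2))
      (P.prod complexGaussian) := by
  obtain ⟨R, hR⟩ : ∃ R, ∀ x ∈ S, ‖c * x‖ ≤ R := by
    obtain ⟨R, hR⟩ := (S.image fun x => ‖c * x‖).bddAbove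
    exact ⟨R, fun x hx => hR (Finset.mem_coe.2 (Finset.mem_image_of_mem _ hx))⟩
  have hint : Integrable (fun z : ℂ × ℂ =>
      2 * (2 * R * (2 * R + Real.exp (1 * (|z.2.re| + |z.2.im|))) + 2 * R ^ 2))
      (P.prod complexGaussian) := by
    have h1 := (integrable_exp_abs_complexGaussian 1).comp_snd P
    exact ((((integrable_const (2 * R)).add h1).const_mul (2 * R)).add
      (integrable_const (2 * R ^ 2))).const_mul 2
  have hmeas : Measurable (fun z : ℂ × ℂ => infoDensity P S c (z.1, c * z.1 + z.2)) :=
    (measurable_infoDensity P S c).comp (by fun_prop)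
  refine hint.mono' hmeas.aestronglyMeasurable ?_
  have hae : ∀ᵐ z ∂(P.prod complexGaussian), z.1 ∈ S := by
    refine Measure.quasiMeasurePreserving_fst.ae (p := fun x => x ∈ S) ?_
    rw [ae_iff]; exact hS
  filter_upwards [hae] with z hz
  have hR0 : 0 ≤ R := (norm_nonneg _).trans (hR _ hz)
  refine (abs_infoDensity_le hS hz hR _).trans ?_
  have h1 : |(c * z.1 + z.2).re| ≤ R + |z.2.re| := by
    rw [Complex.add_re]
    exact (abs_add_le _ _).trans
      (add_le_add_left ((Complex.abs_re_le_norm _).trans (hR _ hz)) _)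
  have h2 : |(c * z.1 + z.2).im| ≤ R + |z.2.im| := by
    rw [Complex.add_im]
    exact (abs_add_le _ _).trans
      (add_le_add_left ((Complex.abs_im_le_norm _).trans (hR _ hz)) _)
  have h3 := Real.add_one_le_exp (1 * (|z.2.re| + |z.2.im|))
  have h4 : |(c * z.1 + z.2).re| + |(c * z.1 + z.2).im| ≤
      2 * R + Real.exp (1 * (|z.2.re| + |z.2.im|)) := by linarith
  have := mul_le_mul_of_nonneg_left h4 (by positivity : 0 ≤ 2 * R)
  linarith

/-! ### Laws of additive-noise channels, and parallel channels. -/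

lemma map_shear_eq_withDensity {α β : Type*} [MeasurableSpace α] [MeasurableSpace β] [Add β]
    [MeasurableAdd₂ β] (π : Measure α) [IsProbabilityMeasure π] (ν : Measure β)
    [IsProbabilityMeasure ν] (T : α → β) (hT : Measurable T) (k : α × β → ENNReal)
    (hk : Measurable k) (h : ∀ x, ν.map (fun y => T x + y) = ν.withDensity fun y => k (x, y)) :
    (π.prod ν).map (fun p => (p.1, T p.1 + p.2)) = (π.prod ν).withDensity k := by
  refine Measure.ext_of_lintegral _ fun F hF => ?_
  rw [lintegral_map hF (by fun_prop), lintegral_withDensity_eq_lintegral_mul _ hk hF,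
    lintegral_prod _ (by fun_prop), lintegral_prod _ (by fun_prop)]
  refine lintegral_congr fun x => ?_
  have h1 := congrArg (fun μ : Measure β => ∫⁻ y, F (x, y) ∂μ) (h x)
  rw [lintegral_map (by fun_prop) (by fun_prop),
    lintegral_withDensity_eq_lintegral_mul _ (by fun_prop) (by fun_prop)] at h1
  exact h1

lemma lintegral_pi_prod {ι : Type*} [Fintype ι] {α : ι → Type*} [∀ i, MeasurableSpace (α i)]
    (μ : ∀ i, Measure (α i)) [∀ i, IsProbabilityMeasure (μ i)] (f : ∀ i, α i → ENNReal)
    (hf : ∀ i, Measurable (f i)) :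
    ∫⁻ z, ∏ i, f i (z i) ∂(Measure.pi μ) = ∏ i, ∫⁻ x, f i x ∂(μ i) := by
  rw [lintegral_prod_eq_prod_lintegral_of_indepFun Finset.univ (fun i (z : ∀ i, α i) => f i (z i))
    (iIndepFun_pi fun i => (hf i).aemeasurable) (fun i => (hf i).comp (measurable_pi_apply i))]
  refine Finset.prod_congr rfl fun i _ => ?_
  exact (measurePreserving_eval μ i).lintegral_comp (hf i)

lemma pi_withDensity {ι : Type*} [Fintype ι] {α : ι → Type*} [∀ i, MeasurableSpace (α i)]
    (μ : ∀ i, Measure (α i)) [∀ i, IsProbabilityMeasure (μ i)] (f : ∀ i, α i → ENNReal)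
    (hf : ∀ i, Measurable (f i)) [∀ i, SigmaFinite ((μ i).withDensity (f i))] :
    Measure.pi (fun i => (μ i).withDensity (f i)) =
      (Measure.pi μ).withDensity (fun z => ∏ i, f i (z i)) := by
  refine Measure.pi_eq fun s hs => ?_
  rw [withDensity_apply _ (MeasurableSet.univ_pi hs),
    ← lintegral_indicator (MeasurableSet.univ_pi hs)]
  have h1 : ∀ z : ∀ i, α i, (Set.pi univ s).indicator (fun z => ∏ i, f i (z i)) z =
      ∏ i, (s i).indicator (f i) (z i) := by
    intro z
    by_cases hz : z ∈ Set.pi univ s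
    · rw [indicator_of_mem hz]
      exact Finset.prod_congr rfl fun i _ => (indicator_of_mem (hz i (mem_univ i)) _).symm
    · rw [indicator_of_notMem hz]
      simp only [mem_univ_pi, not_forall] at hz
      obtain ⟨i, hi⟩ := hz
      exact (Finset.prod_eq_zero (Finset.mem_univ i) (indicator_of_notMem hi _)).symm
  simp_rw [h1]
  rw [lintegral_pi_prod _ _ fun i => (hf i).indicator (hs i)]
  refine Finset.prod_congr rfl fun i _ => ?_
  rw [lintegral_indicator (hs i), withDensity_apply _ (hs i)]

lemma pi_complexGaussian_map_const_add {ι : Type*} [Fintype ι] (v : ι → ℂ) :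
    (Measure.pi fun _ : ι => complexGaussian).map (fun z => v + z) =
      (Measure.pi fun _ : ι => complexGaussian).withDensity
        (fun z => ENNReal.ofReal (∏ i, shiftDensity (v i) (z i))) := by
  have hp : ∀ i, IsProbabilityMeasure (complexGaussian.map (fun z => v i + z)) := fun i =>
    Measure.isProbabilityMeasure_map (by fun_prop)
  have h := Measure.pi_map_pi (μ := fun _ : ι => complexGaussian) (f := fun i z => v i + z)
    (fun i => by fun_prop)
  have h2 : (Measure.pi fun i => complexGaussian.map (fun z => v i + z)) =
      Measure.pi fun i => complexGaussian.withDensity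
        (fun z => ENNReal.ofReal (shiftDensity (v i) z)) := by
    simp_rw [map_add_eq_withDensity_shiftDensity]
  have hp' : ∀ i, IsProbabilityMeasure (complexGaussian.withDensity
      (fun z => ENNReal.ofReal (shiftDensity (v i) z))) := fun i => by
    rw [← map_add_eq_withDensity_shiftDensity]; exact hp i
  rw [h2, pi_withDensity _ _ (fun i => by fun_prop)] at h
  refine Eq.trans h ?_
  congr 1
  ext z
  rw [ENNReal.ofReal_prod_of_nonneg fun i _ => (shiftDensity_pos _ _).le]

/-- Independent parallel channels. -/
lemma mutualInfo_parallel {P : Measure ℂ} [IsProbabilityMeasure P] {S : Finset ℂ}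
    (hS : P ((S : Set ℂ)ᶜ) = 0) {ι : Type*} [Fintype ι] (c : ι → ℂ) :
    mutualInfo (((Measure.pi fun _ : ι => P).prod (Measure.pi fun _ : ι => complexGaussian)).map
      (fun p => (p.1, (fun i => c i * p.1 i) + p.2))) = ∑ i, gainInfo P S (c i) := by
  have hk : Measurable fun z : (ι → ℂ) × (ι → ℂ) => ∏ i, shiftDensity (c i * z.1 i) (z.2 i) := by
    fun_prop
  have hlaw := map_shear_eq_withDensity (Measure.pi fun _ : ι => P)
    (Measure.pi fun _ : ι => complexGaussian) (fun x i => c i * x i) (by fun_prop)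
    (fun z => ENNReal.ofReal (∏ i, shiftDensity (c i * z.1 i) (z.2 i))) (by fun_prop)
    (fun x => pi_complexGaussian_map_const_add _)
  have hpos : ∀ z : (ι → ℂ) × (ι → ℂ), 0 < ∏ i, shiftDensity (c i * z.1 i) (z.2 i) :=
    fun z => Finset.prod_pos fun i _ => shiftDensity_pos _ _
  rw [hlaw, mutualInfo_withDensity _ _
    (fun z : (ι → ℂ) × (ι → ℂ) => ∏ i, shiftDensity (c i * z.1 i) (z.2 i)) hk hpos
    ?_ (fun y => ∏ i, mixDensity P S (c i) (y i)) (by fun_prop)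
    (fun y => Finset.prod_pos fun i _ => mixDensity_pos hS _ _) ?_, ← hlaw,
    integral_map (by fun_prop)]
  · have hlog : ∀ p : (ι → ℂ) × (ι → ℂ),
        Real.log ((∏ i, shiftDensity (c i * p.1 i) (((fun i => c i * p.1 i) + p.2) i)) /
          ∏ i, mixDensity P S (c i) (((fun i => c i * p.1 i) + p.2) i)) =
        ∑ i, infoDensity P S (c i) (p.1 i, c i * p.1 i + p.2 i) := by
      intro p
      rw [← Finset.prod_div_distrib, Real.log_prod fun i _ =>
        (div_pos (shiftDensity_pos _ _) (mixDensity_pos hS _ _)).ne']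
      rfl
    simp_rw [hlog]
    have hmp : ∀ i, MeasurePreserving (fun p : (ι → ℂ) × (ι → ℂ) => (p.1 i, p.2 i))
        ((Measure.pi fun _ : ι => P).prod (Measure.pi fun _ : ι => complexGaussian))
        (P.prod complexGaussian) := fun i =>
      (measurePreserving_eval (fun _ : ι => P) i).prod
        (measurePreserving_eval (fun _ : ι => complexGaussian) i)
    rw [integral_finsetSum]
    · refine Finset.sum_congr rfl fun i _ => ?_
      have hm : Measurable (fun z : ℂ × ℂ => infoDensity P S (c i) (z.1, c i * z.1 + z.2)) :=
        (measurable_infoDensity P S (c i)).comp (by fun_prop)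
      rw [gainInfo, ← (hmp i).map_eq, integral_map (hmp i).aemeasurable hm.aestronglyMeasurable]
    · intro i _
      exact (hmp i).integrable_comp_of_integrable (integrable_infoDensity hS (c i))
  · refine Measurable.aestronglyMeasurable ?_
    fun_prop
  · intro x
    simp only
    simp_rw [ENNReal.ofReal_prod_of_nonneg fun i (_ : i ∈ Finset.univ) => (shiftDensity_pos _ _).le]
    rw [lintegral_pi_prod (fun _ : ι => complexGaussian)
      (fun i y => ENNReal.ofReal (shiftDensity (c i * x i) y)) (fun i => by fun_prop)]
    simp [lintegral_shiftDensity]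
  · intro y
    simp only
    simp_rw [ENNReal.ofReal_prod_of_nonneg fun i (_ : i ∈ Finset.univ) => (shiftDensity_pos _ _).le]
    rw [lintegral_pi_prod (fun _ : ι => P)
      (fun i x => ENNReal.ofReal (shiftDensity (c i * x) (y i))) (fun i => by fun_prop),
      ENNReal.ofReal_prod_of_nonneg fun i _ => (mixDensity_pos hS _ _).le]
    exact Finset.prod_congr rfl fun i _ => lintegral_shiftDensity_mul hS _ _

lemma scalarInfo_eq_gainInfo {P : Measure ℂ} [IsProbabilityMeasure P] {S : Finset ℂ}
    (hS : P ((S : Set ℂ)ᶜ) = 0) (γ : ℝ) : scalarInfo P γ = gainInfo P S (Real.sqrt γ : ℂ) := by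
  unfold scalarInfo
  generalize (Real.sqrt γ : ℂ) = c
  have hlaw : (P.prod complexGaussian).map (fun p : ℂ × ℂ => (p.1, c * p.1 + p.2)) =
      (P.prod complexGaussian).withDensity
        (fun z => ENNReal.ofReal (shiftDensity (c * z.1) z.2)) := by
    refine map_shear_eq_withDensity P complexGaussian (fun x => c * x) (by fun_prop) _
      (by fun_prop) (fun x => ?_)
    exact map_add_eq_withDensity_shiftDensity (c * x)
  have hk : Measurable fun z : ℂ × ℂ => shiftDensity (c * z.1) z.2 := by fun_prop
  have hm : Measurable (mixDensity P S c) := measurable_mixDensity P S c measurable_id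
  have hone : ∀ x : ℂ, ∫⁻ y, ENNReal.ofReal (shiftDensity (c * x) y) ∂complexGaussian = 1 :=
    fun x => lintegral_shiftDensity (c * x)
  have hI := mutualInfo_withDensity P complexGaussian _ hk (fun z => shiftDensity_pos _ _) hone
    _ hm (mixDensity_pos hS c) (lintegral_shiftDensity_mul hS c)
  rw [hlaw, hI, ← hlaw, integral_map (by fun_prop)]
  · rfl
  · exact (measurable_infoDensity P S c).aestronglyMeasurable

lemma shiftDensity_mul_mul {u : ℂ} (hu : ‖u‖ = 1) (v y : ℂ) :
    shiftDensity (u * v) (u * y) = shiftDensity v y := by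
  have h : u.re ^ 2 + u.im ^ 2 = 1 := by
    have := Complex.normSq_eq_norm_sq u
    rw [hu, Complex.normSq_apply] at this
    linarith
  unfold shiftDensity
  congr 1
  simp only [Complex.mul_re, Complex.mul_im]
  linear_combination (2 * (y.re * v.re + y.im * v.im) - (v.re ^ 2 + v.im ^ 2)) * h

lemma gainInfo_mul_of_norm_eq_one {P : Measure ℂ} [IsProbabilityMeasure P] (S : Finset ℂ) {u : ℂ}
    (hu : ‖u‖ = 1) (c : ℂ) : gainInfo P S (u * c) = gainInfo P S c := by
  have hmp : MeasurePreserving (fun z => u * z) complexGaussian complexGaussian :=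
    ⟨by fun_prop, complexGaussian_map_mul_of_norm_eq_one hu⟩
  have hmp2 : MeasurePreserving (Prod.map id fun z => u * z) (P.prod complexGaussian)
      (P.prod complexGaussian) := (MeasurePreserving.id P).prod hmp
  have hm : Measurable (fun z : ℂ × ℂ => infoDensity P S (u * c) (z.1, u * c * z.1 + z.2)) :=
    (measurable_infoDensity P S (u * c)).comp (by fun_prop)
  unfold gainInfo
  conv_lhs => rw [← hmp2.map_eq]
  rw [integral_map hmp2.aemeasurable hm.aestronglyMeasurable]
  congr 1
  ext z
  have hd : ∀ x, shiftDensity (u * c * x) (u * (c * z.1 + z.2)) =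
      shiftDensity (c * x) (c * z.1 + z.2) := fun x => by
    rw [mul_assoc, shiftDensity_mul_mul hu]
  have hz : u * c * z.1 + u * z.2 = u * (c * z.1 + z.2) := by ring
  simp only [infoDensity, Prod.map, id, hz, hd, mixDensity]

/-- A unit phase can be absorbed into the circularly symmetric noise, so only |c| matters. This
turns the complex gain H(2πk/N) into the SNR |H(2πk/N)|². -/
lemma gainInfo_eq_scalarInfo {P : Measure ℂ} [IsProbabilityMeasure P] {S : Finset ℂ}
    (hS : P ((S : Set ℂ)ᶜ) = 0) (c : ℂ) : gainInfo P S c = scalarInfo P (‖c‖ ^ 2) := by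
  rw [scalarInfo_eq_gainInfo hS, Real.sqrt_sq (norm_nonneg _)]
  by_cases hc : c = 0
  · simp [hc]
  · have hn : (‖c‖ : ℂ) ≠ 0 := by simpa using hc
    rw [← gainInfo_mul_of_norm_eq_one S (u := c / ‖c‖) (by simp [hc]) (‖c‖ : ℂ),
      div_mul_cancel₀ _ hn]

/-! ### The OFDM rate -/

lemma sum_exp_two_pi_mul_div {N : ℕ} (m m' : Fin N) :
    ∑ k : Fin N, Complex.exp (2 * Real.pi * Complex.I * ((m' : ℕ) - (m : ℕ) : ℂ) * (k : ℕ) / N) =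
      if m = m' then (N : ℂ) else 0 := by
  have hN : (N : ℂ) ≠ 0 := by
    have : 0 < N := m.pos
    exact_mod_cast this.ne'
  split_ifs with h
  · subst h; simp
  · set r : ℂ := Complex.exp (2 * Real.pi * Complex.I * ((m' : ℕ) - (m : ℕ) : ℂ) / N)
    have hterm : ∀ k : Fin N, Complex.exp (2 * Real.pi * Complex.I * ((m' : ℕ) - (m : ℕ) : ℂ) *
        (k : ℕ) / N) = r ^ (k : ℕ) := by
      intro k
      rw [← Complex.exp_nat_mul]
      congr 1
      ring
    simp_rw [hterm]
    rw [Fin.sum_univ_eq_sum_range (fun k => r ^ k) N]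
    have hrN : r ^ N = 1 := by
      rw [← Complex.exp_nat_mul, Complex.exp_eq_one_iff]
      refine ⟨(m' : ℤ) - (m : ℤ), ?_⟩
      push_cast
      field_simp
    -- If `r = 1` then `N` divides `m' - m`, whose absolute value is below `N`.
    have hr1 : r ≠ 1 := by
      intro hr
      obtain ⟨n, hn⟩ := Complex.exp_eq_one_iff.1 hr
      have hpi : (2 * Real.pi * Complex.I : ℂ) ≠ 0 := Complex.two_pi_I_ne_zero
      have h1 : ((m' : ℕ) - (m : ℕ) : ℂ) = n * N := by
        field_simp at hn
        have := mul_left_cancel₀ hpi (a := 2 * Real.pi * Complex.I)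
          (b := ((m' : ℕ) - (m : ℕ) : ℂ)) (c := n * N) (by linear_combination 2 * Real.pi *
            Complex.I * hn)
        exact this
      have h2 : ((m' : ℕ) : ℤ) - ((m : ℕ) : ℤ) = n * N := by exact_mod_cast h1
      have h3 := m.isLt
      have h4 := m'.isLt
      have h5 : n = 0 := by
        rcases lt_trichotomy n 0 with hlt | heq | hgt
        · nlinarith
        · exact heq
        · nlinarith
      rw [h5] at h2
      exact h (Fin.ext (by omega))
    have := geom_sum_mul r N
    rw [hrN, sub_self] at this
    exact (mul_eq_zero.1 this).resolve_right (sub_ne_zero.2 hr1)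

lemma dftMatrix_mul_conjTranspose (N : ℕ) : dftMatrix N * (dftMatrix N)ᴴ = 1 := by
  ext m m'
  have hN : 0 < N := m.pos
  have hNC : (N : ℂ) ≠ 0 := by exact_mod_cast hN.ne'
  rw [Matrix.mul_apply]
  have hsq : (Real.sqrt N : ℂ) * (Real.sqrt N : ℂ) = N := by
    rw [← Complex.ofReal_mul, Real.mul_self_sqrt (Nat.cast_nonneg _)]
    simp
  have hs0 : (Real.sqrt N : ℂ) ≠ 0 := by
    intro h
    rw [h, mul_zero] at hsq
    exact hNC hsq.symm
  have hterm : ∀ k : Fin N, dftMatrix N m k * (dftMatrix N)ᴴ k m' =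
      1 / N * Complex.exp (2 * Real.pi * Complex.I * ((m' : ℕ) - (m : ℕ) : ℂ) * (k : ℕ) / N) := by
    intro k
    simp only [dftMatrix, Matrix.conjTranspose_apply, Matrix.of_apply, star_mul', RCLike.star_def,
      ← Complex.exp_conj, map_neg, map_div₀, map_mul, map_ofNat, Complex.conj_ofReal,
          Complex.conj_I,
      map_natCast, map_one]
    rw [mul_mul_mul_comm, ← Complex.exp_add]
    congr 1
    · rw [← hsq]; field_simp
    · congr 1
      field_simp
      ring
  simp_rw [hterm]
  rw [← Finset.mul_sum, sum_exp_two_pi_mul_div, Matrix.one_apply]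
  split_ifs <;> simp [hNC]

/-- The rows of the DFT matrix are characters of ℤ/N, hence left eigenvectors of every cyclic
convolution. There is no constraint between `L` and `N`: taps beyond the block length simply wrap
around. -/
lemma dftMatrix_mul_circulantMatrix {L : ℕ} (h : Fin L → ℂ) (N : ℕ) :
    dftMatrix N * circulantMatrix h N =
      Matrix.diagonal (fun m : Fin N => transfer h (2 * Real.pi * (m : ℕ) / N)) * dftMatrix N := by
  ext m k
  have hN : 0 < N := m.pos
  have hNC : (N : ℂ) ≠ 0 := by exact_mod_cast hN.ne'
  rw [Matrix.mul_apply, Matrix.diagonal_mul, transfer, Finset.sum_mul]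
  simp only [circulantMatrix, Matrix.of_apply, Finset.mul_sum]
  rw [Finset.sum_comm]
  refine Finset.sum_congr rfl fun l _ => ?_
  rw [Finset.sum_eq_single ⟨((k : ℕ) + l) % N, Nat.mod_lt _ hN⟩]
  · simp only [if_true, dftMatrix, Matrix.of_apply]
    have hdiv : (((k : ℕ) + l : ℕ) : ℂ) = N * ((((k : ℕ) + l) / N : ℕ) : ℂ) +
        ((((k : ℕ) + l) % N : ℕ) : ℂ) := by
      exact_mod_cast (Nat.div_add_mod ((k : ℕ) + l) N).symm
    push_cast at hdiv
    have hexp : Complex.exp (-(2 * Real.pi * Complex.I * (m : ℕ) * ((((k : ℕ) + l) % N : ℕ) : ℂ) /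
        N)) =
        Complex.exp (-(2 * Real.pi * Complex.I * (m : ℕ) * (k : ℕ) / N)) *
          Complex.exp (-(Complex.I * (l : ℕ) * ((2 * Real.pi * (m : ℕ) / N : ℝ) : ℂ))) := by
      rw [← Complex.exp_add]
      -- Reducing k + l modulo N removes N times the quotient, which changes the exponent by m times
      -- that quotient, in units of 2πi.
      refine Complex.exp_eq_exp_iff_exists_int.2 ⟨((m : ℕ) * (((k : ℕ) + l) / N : ℕ) : ℤ), ?_⟩
      have hmod : ((((k : ℕ) + l) % N : ℕ) : ℂ) =
          (k : ℕ) + (l : ℕ) - N * ((((k : ℕ) + l) / N : ℕ) : ℂ) := by linear_combination -hdiv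
      rw [hmod]
      generalize ((k : ℕ) + (l : ℕ)) / N = q
      push_cast
      field_simp
      ring
    rw [hexp]
    ring
  · intro j _ hj
    rw [if_neg, mul_zero]
    intro hcon
    exact hj (Fin.ext hcon.symm)
  · simp

/-- Conjugation by the DFT makes the channel diagonal, and unitary invariance keeps the noise
i.i.d.; what remains is a family of parallel scalar channels, whose informations add. -/
lemma mutualInfo_ofdmLaw {P : Measure ℂ} [IsProbabilityMeasure P] {S : Finset ℂ}
    (hS : P ((S : Set ℂ)ᶜ) = 0) {L : ℕ} (h : Fin L → ℂ) (N : ℕ) :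
    mutualInfo (ofdmLaw P h N) =
      ∑ k : Fin N, scalarInfo P (‖transfer h (2 * Real.pi * (k : ℕ) / N)‖ ^ 2) := by
  set c : Fin N → ℂ := fun k => transfer h (2 * Real.pi * (k : ℕ) / N)
  set W := dftMatrix N
  have hW : W * Wᴴ = 1 := dftMatrix_mul_conjTranspose N
  have hinv : W * W⁻¹ = 1 := Matrix.mul_nonsing_inv _ (Matrix.isUnit_det_of_right_inverse hW)
  have hmul : W * circulantMatrix h N * W⁻¹ = Matrix.diagonal c := by
    rw [dftMatrix_mul_circulantMatrix, Matrix.mul_assoc, hinv, Matrix.mul_one]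
  have hmp : MeasurePreserving (fun z => W *ᵥ z) (Measure.pi fun _ : Fin N => complexGaussian)
      (Measure.pi fun _ : Fin N => complexGaussian) :=
    ⟨(Continuous.matrix_mulVec continuous_const continuous_id).measurable,
      pi_complexGaussian_map_unitary W hW⟩
  have hmp2 := (MeasurePreserving.id (Measure.pi fun _ : Fin N => P)).prod hmp
  have hlaw : ofdmLaw P h N = ((Measure.pi fun _ : Fin N => P).prod
      (Measure.pi fun _ : Fin N => complexGaussian)).map
      (fun p => (p.1, (fun i => c i * p.1 i) + p.2)) := by
    rw [← hmp2.map_eq, Measure.map_map (by fun_prop) hmp2.measurable]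
    unfold ofdmLaw
    congr 1
    ext1 p
    simp only [Function.comp_apply, Prod.map, id]
    congr 1
    change W *ᵥ _ = _
    rw [Matrix.mulVec_add, Matrix.mulVec_mulVec, Matrix.mulVec_mulVec, hmul]
    congr 1
    ext i
    rw [Matrix.mulVec_diagonal]
  rw [hlaw, mutualInfo_parallel hS]
  exact Finset.sum_congr rfl fun k _ => gainInfo_eq_scalarInfo hS _

/-- Riemann sums over the left end points of `N` equal intervals. -/
lemma tendsto_riemannSum {F : ℝ → ℝ} (hF : Continuous F) (T : ℝ) :
    Tendsto (fun N : ℕ => 1 / (N : ℝ) * ∑ k : Fin N, F (T * (k : ℕ) / N)) atTop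
      (𝓝 (∫ t in (0 : ℝ)..1, F (T * t))) := by
  set G : ℝ → ℝ := fun t => F (T * t)
  have hG : Continuous G := by fun_prop
  have huc : UniformContinuousOn G (Icc 0 1) :=
    isCompact_Icc.uniformContinuousOn_of_continuous hG.continuousOn
  rw [Metric.tendsto_atTop]
  intro ε hε
  rw [Metric.uniformContinuousOn_iff_le] at huc
  obtain ⟨δ, hδ, huc⟩ := huc (ε / 2) (by positivity)
  obtain ⟨N₀, hN₀⟩ := exists_nat_gt (1 / δ)
  refine ⟨max N₀ 1, fun N hN => ?_⟩
  have hN1 : 0 < (N : ℝ) := by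
    have : 0 < N := lt_of_lt_of_le (by simp) hN
    exact_mod_cast this
  have hNδ : 1 / (N : ℝ) ≤ δ := by
    have h1 : (N₀ : ℝ) ≤ N := by exact_mod_cast (le_max_left _ _).trans hN
    rw [div_le_iff₀ hN1]
    rw [div_lt_iff₀ hδ] at hN₀
    nlinarith
  have hsplit : ∫ t in (0 : ℝ)..1, G t =
      ∑ k ∈ Finset.range N, ∫ t in ((k : ℕ) / N : ℝ)..((k + 1 : ℕ) / N : ℝ), G t := by
    rw [intervalIntegral.sum_integral_adjacent_intervals
      (a := fun k : ℕ => (k : ℝ) / N) (fun k _ => hG.intervalIntegrable _ _)]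
    simp [hN1.ne']
  have hlen : ∀ k : ℕ, ((k + 1 : ℕ) / N : ℝ) - (k / N : ℝ) = 1 / N := by
    intro k; push_cast; ring
  have hsum : 1 / (N : ℝ) * ∑ k : Fin N, F (T * (k : ℕ) / N) =
      ∑ k ∈ Finset.range N, ∫ t in ((k : ℕ) / N : ℝ)..((k + 1 : ℕ) / N : ℝ), G (k / N) := by
    rw [Fin.sum_univ_eq_sum_range (fun k : ℕ => F (T * (k : ℝ) / N)) N, Finset.mul_sum]
    refine Finset.sum_congr rfl fun k _ => ?_
    rw [intervalIntegral.integral_const, hlen, smul_eq_mul]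
    simp only [G, mul_div_assoc]
  rw [Real.dist_eq, hsum, hsplit, ← Finset.sum_sub_distrib]
  refine (Finset.abs_sum_le_sum_abs _ _).trans_lt ?_
  have hb : ∀ k ∈ Finset.range N,
      |(∫ t in ((k : ℕ) / N : ℝ)..((k + 1 : ℕ) / N : ℝ), G (k / N)) -
        ∫ t in ((k : ℕ) / N : ℝ)..((k + 1 : ℕ) / N : ℝ), G t| ≤ ε / 2 * (1 / N) := by
    intro k hk
    rw [← intervalIntegral.integral_sub (by simp) (hG.intervalIntegrable _ _)]
    have hkN : ((k + 1 : ℕ) : ℝ) ≤ N := by exact_mod_cast Finset.mem_range.1 hk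
    have hle : (k / N : ℝ) ≤ ((k + 1 : ℕ) / N : ℝ) := by
      rw [← sub_nonneg, hlen]; positivity
    have h1 := intervalIntegral.norm_integral_le_of_norm_le_const (C := ε / 2)
      (a := (k / N : ℝ)) (b := ((k + 1 : ℕ) / N : ℝ)) (f := fun t => G (k / N) - G t) ?_
    · rwa [hlen, abs_of_pos (by positivity : (0 : ℝ) < 1 / N)] at h1
    · intro t ht
      rw [uIoc_of_le hle] at ht
      have hk0 : (0 : ℝ) ≤ k / N := by positivity
      have hk1 : ((k + 1 : ℕ) / N : ℝ) ≤ 1 := (div_le_one hN1).2 hkN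
      have := hlen k
      refine huc (k / N) ⟨hk0, hle.trans hk1⟩ t ⟨hk0.trans ht.1.le, ht.2.trans hk1⟩ ?_
      rw [Real.dist_eq, abs_sub_comm, abs_of_pos (by linarith [ht.1])]
      linarith [ht.2]
  refine (Finset.sum_le_sum hb).trans_lt ?_
  rw [Finset.sum_const, Finset.card_range, nsmul_eq_mul]
  have : (N : ℝ) * (ε / 2 * (1 / N)) = ε / 2 := by field_simp
  rw [this]
  linarith

lemma continuous_transfer {L : ℕ} (h : Fin L → ℂ) : Continuous (transfer h) := by
  unfold transfer
  fun_prop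

lemma transfer_periodic {L : ℕ} (h : Fin L → ℂ) : Function.Periodic (transfer h) (2 * Real.pi) := by
  intro θ
  unfold transfer
  refine Finset.sum_congr rfl fun k _ => ?_
  congr 1
  refine Complex.exp_eq_exp_iff_exists_int.2 ⟨-(k : ℕ), ?_⟩
  push_cast
  ring

lemma continuous_scalarInfo_transfer {P : Measure ℂ} (hcont : ContinuousOn (scalarInfo P) (Ici 0))
    {L : ℕ} (h : Fin L → ℂ) : Continuous fun θ => scalarInfo P (‖transfer h θ‖ ^ 2) :=
  hcont.comp_continuous ((continuous_transfer h).norm.pow 2) fun θ => by simp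

lemma tendsto_ofdmRate {P : Measure ℂ} [IsProbabilityMeasure P] {S : Finset ℂ}
    (hS : P ((S : Set ℂ)ᶜ) = 0) (hcont : ContinuousOn (scalarInfo P) (Ici 0)) {L : ℕ}
    (h : Fin L → ℂ) (Ncp : ℕ → ℕ)
    (hNcp : (fun N : ℕ => (Ncp N : ℝ)) =o[atTop] (fun N : ℕ => (N : ℝ))) :
    Tendsto (fun N : ℕ => ofdmRate P h N (Ncp N)) atTop (𝓝 (infoOFDM P h)) := by
  set F : ℝ → ℝ := fun θ => scalarInfo P (‖transfer h θ‖ ^ 2)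
  have hF : Continuous F := continuous_scalarInfo_transfer hcont h
  have hper : Function.Periodic F (2 * Real.pi) := fun θ => by
    simp only [F, transfer_periodic h θ]
  have hlim := tendsto_riemannSum hF (2 * Real.pi)
  have hint : ∫ t in (0 : ℝ)..1, F (2 * Real.pi * t) = infoOFDM P h := by
    rw [intervalIntegral.integral_comp_mul_left F Real.two_pi_pos.ne']
    -- The DFT frequencies sample [0, 2π], while `infoOFDM` integrates over [-π, π]; periodicity
    -- identifies the two.
    have := hper.intervalIntegral_add_eq 0 (-Real.pi)
    rw [mul_zero, mul_one, smul_eq_mul, ← zero_add (2 * Real.pi), this, infoOFDM, zero_add, one_div]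
    congr 3
    ring
  rw [hint] at hlim
  -- The prefix costs the factor N / (N + N_CP), which disappears in the limit.
  have hratio : Tendsto (fun N : ℕ => (N : ℝ) / (N + Ncp N)) atTop (𝓝 1) := by
    have h1 : Tendsto (fun N : ℕ => (1 + (Ncp N : ℝ) / N)⁻¹) atTop (𝓝 ((1 + 0)⁻¹)) :=
      (tendsto_const_nhds.add hNcp.tendsto_div_nhds_zero).inv₀ (by norm_num)
    rw [add_zero, inv_one] at h1
    refine h1.congr' ?_
    filter_upwards [eventually_gt_atTop 0] with N hN
    have : (N : ℝ) ≠ 0 := by exact_mod_cast hN.ne'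
    field_simp
  have hprod := hratio.mul hlim
  rw [one_mul] at hprod
  refine hprod.congr' ?_
  filter_upwards [eventually_gt_atTop 0] with N hN
  have : (N : ℝ) ≠ 0 := by exact_mod_cast hN.ne'
  rw [ofdmRate, mutualInfo_ofdmLaw hS, ← mul_assoc]
  congr 1
  field_simp

/-! ### Gaussian integration by parts -/

lemma integrable_of_abs_le_exp {F : ℂ → ℝ} (hF : Continuous F) {C k : ℝ}
    (hb : ∀ z : ℂ, |F z| ≤ C * Real.exp (k * (|z.re| + |z.im|))) :
    Integrable F complexGaussian :=
  ((integrable_exp_abs_complexGaussian k).const_mul C).mono' hF.aestronglyMeasurable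
    (Eventually.of_forall hb)

lemma integrable_gaussianReal_of_abs_le_exp {f : ℝ → ℝ} (hf : Continuous f) {C k : ℝ}
    (hb : ∀ x, |f x| ≤ C * Real.exp (k * |x|)) : Integrable f (gaussianReal 0 (1 / 2)) := by
  have h1 : Integrable (fun x : ℝ => Real.exp (k * |x|)) (gaussianReal 0 (1 / 2)) := by
    refine Integrable.mono' ((integrable_exp_mul_gaussianReal k).add
      (integrable_exp_mul_gaussianReal (-k))) (by fun_prop) (Eventually.of_forall fun x => ?_)
    rw [Real.norm_of_nonneg (by positivity)]
    rcases abs_cases x with ⟨h, _⟩ | ⟨h, _⟩ <;> rw [h]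
    · simp only [Pi.add_apply]; linarith [Real.exp_pos (-k * x)]
    · simp only [Pi.add_apply]
      have : k * -x = -k * x := by ring
      rw [this]
      linarith [Real.exp_pos (k * x)]
  exact (h1.const_mul C).mono' hf.aestronglyMeasurable (Eventually.of_forall hb)

lemma abs_le_exp_abs (x : ℝ) : |x| ≤ Real.exp |x| := by
  linarith [Real.add_one_le_exp |x|]

/-- Stein's identity for the Gaussian law with variance `1 / 2`. -/
lemma integral_id_mul_gaussianReal {f f' : ℝ → ℝ} (hf : ∀ x, HasDerivAt f (f' x) x)
    (hf' : Continuous f') {C k : ℝ} (hb : ∀ x, |f x| ≤ C * Real.exp (k * |x|))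
    (hb' : ∀ x, |f' x| ≤ C * Real.exp (k * |x|)) :
    ∫ x, x * f x ∂(gaussianReal 0 (1 / 2)) = 1 / 2 * ∫ x, f' x ∂(gaussianReal 0 (1 / 2)) := by
  have hv : (1 / 2 : NNReal) ≠ 0 := by norm_num
  have hfc : Continuous f := continuous_iff_continuousAt.2 fun x => (hf x).continuousAt
  have hi1 : Integrable f (gaussianReal 0 (1 / 2)) := integrable_gaussianReal_of_abs_le_exp hfc hb
  have hi2 : Integrable f' (gaussianReal 0 (1 / 2)) :=
    integrable_gaussianReal_of_abs_le_exp hf' hb'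
  have hi3 : Integrable (fun x => x * f x) (gaussianReal 0 (1 / 2)) := by
    refine integrable_gaussianReal_of_abs_le_exp (C := C) (k := k + 1) (by fun_prop) fun x => ?_
    rw [abs_mul, add_mul, Real.exp_add, one_mul]
    calc |x| * |f x| ≤ Real.exp |x| * (C * Real.exp (k * |x|)) :=
          mul_le_mul (abs_le_exp_abs x) (hb x) (abs_nonneg _) (Real.exp_pos _).le
      _ = _ := by ring
  have hi4 : Integrable (fun x => f' x - 2 * (x * f x)) (gaussianReal 0 (1 / 2)) :=
    hi2.sub (hi3.const_mul 2)
  have hvol : ∀ g : ℝ → ℝ, Integrable g (gaussianReal 0 (1 / 2)) →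
      Integrable fun x => gaussianPDFReal 0 (1 / 2) x * g x := by
    intro g hg
    rw [gaussianReal_of_var_ne_zero _ hv,
      integrable_withDensity_iff_integrable_smul' (measurable_gaussianPDF _ _)
      (Eventually.of_forall fun x => gaussianPDF_lt_top)] at hg
    simpa [toReal_gaussianPDF] using hg
  have hpdf : ∀ x : ℝ, HasDerivAt (gaussianPDFReal 0 (1 / 2))
      (-(2 * x) * gaussianPDFReal 0 (1 / 2) x) x := by
    intro x
    have h1 : HasDerivAt (fun x : ℝ => -x ^ 2) (-(2 * x)) x := by
      simpa using (hasDerivAt_pow 2 x).fun_neg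
    have h2 := (h1.exp).const_mul (√(2 * Real.pi * (1 / 2 : NNReal)))⁻¹
    have h3 : gaussianPDFReal 0 (1 / 2) =
        fun x => (√(2 * Real.pi * (1 / 2 : NNReal)))⁻¹ * Real.exp (-x ^ 2) := by
      ext y
      simp [gaussianPDFReal]
    rw [h3]
    refine h2.congr_deriv ?_
    ring
  -- With g the density of N(0, 1/2), g' = -2xg, so (g f)' = g (f' - 2x f), and an integrable
  -- derivative of an integrable function has integral zero.
  have h := integral_eq_zero_of_hasDerivAt_of_integrable
    (f := fun x => gaussianPDFReal 0 (1 / 2) x * f x)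
    (f' := fun x => gaussianPDFReal 0 (1 / 2) x * (f' x - 2 * (x * f x)))
    (fun x => ((hpdf x).fun_mul (hf x)).congr_deriv (by ring)) (hvol _ hi4) (hvol _ hi1)
  have h5 : ∫ x, (f' x - 2 * (x * f x)) ∂(gaussianReal 0 (1 / 2)) = 0 := by
    rw [integral_gaussianReal_eq_integral_smul hv]
    simpa using h
  rw [integral_sub hi2 (hi3.const_mul 2), integral_const_mul] at h5
  linarith

lemma integral_re_mul_complexGaussian {F Fa : ℝ → ℝ → ℝ}
    (hF : ∀ a b, HasDerivAt (fun a => F a b) (Fa a b) a)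
    (hFc : Continuous fun q : ℝ × ℝ => F q.1 q.2) (hFac : Continuous fun q : ℝ × ℝ => Fa q.1 q.2)
    {C k : ℝ} (hb : ∀ a b, |F a b| ≤ C * Real.exp (k * (|a| + |b|)))
    (hb' : ∀ a b, |Fa a b| ≤ C * Real.exp (k * (|a| + |b|))) :
    ∫ z, z.re * F z.re z.im ∂complexGaussian = 1 / 2 * ∫ z, Fa z.re z.im ∂complexGaussian := by
  have hcz : ∀ H : ℝ → ℝ → ℝ, (Continuous fun q : ℝ × ℝ => H q.1 q.2) →
      Continuous fun z : ℂ => H z.re z.im := fun H hH =>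
    hH.comp (Complex.continuous_re.prodMk Complex.continuous_im)
  have hi1 : Integrable (fun z : ℂ => z.re * F z.re z.im) complexGaussian := by
    refine integrable_of_abs_le_exp (C := C) (k := k + 1)
      (Complex.continuous_re.mul (hcz _ hFc)) fun z => ?_
    rw [abs_mul, add_mul, Real.exp_add, one_mul]
    have h1 : |z.re| ≤ Real.exp (|z.re| + |z.im|) :=
      (abs_le_exp_abs _).trans (Real.exp_le_exp.2 (by linarith [abs_nonneg z.im]))
    calc |z.re| * |F z.re z.im| ≤ Real.exp (|z.re| + |z.im|) *
          (C * Real.exp (k * (|z.re| + |z.im|))) :=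
          mul_le_mul h1 (hb _ _) (abs_nonneg _) (Real.exp_pos _).le
      _ = _ := by ring
  have hi2 : Integrable (fun z : ℂ => Fa z.re z.im) complexGaussian :=
    integrable_of_abs_le_exp (hcz _ hFac) fun z => hb' _ _
  rw [integrable_complexGaussian_iff] at hi1 hi2
  rw [integral_complexGaussian, integral_complexGaussian, integral_prod_symm _ hi1,
    integral_prod_symm _ hi2, ← integral_const_mul]
  refine integral_congr_ae (Eventually.of_forall fun b => ?_)
  have hsplit : ∀ a, C * Real.exp (k * (|a| + |b|)) =
      C * Real.exp (k * |b|) * Real.exp (k * |a|) := fun a => by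
    rw [mul_add, Real.exp_add]; ring
  exact integral_id_mul_gaussianReal (f := fun a => F a b) (f' := fun a => Fa a b)
    (fun a => hF a b) (hFac.comp (by fun_prop : Continuous fun a : ℝ => (a, b)))
    (fun a => (hb a b).trans_eq (hsplit a)) (fun a => (hb' a b).trans_eq (hsplit a))

lemma integral_im_mul_complexGaussian {F Fb : ℝ → ℝ → ℝ}
    (hF : ∀ a b, HasDerivAt (fun b => F a b) (Fb a b) b)
    (hFc : Continuous fun q : ℝ × ℝ => F q.1 q.2) (hFbc : Continuous fun q : ℝ × ℝ => Fb q.1 q.2)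
    {C k : ℝ} (hb : ∀ a b, |F a b| ≤ C * Real.exp (k * (|a| + |b|)))
    (hb' : ∀ a b, |Fb a b| ≤ C * Real.exp (k * (|a| + |b|))) :
    ∫ z, z.im * F z.re z.im ∂complexGaussian = 1 / 2 * ∫ z, Fb z.re z.im ∂complexGaussian := by
  have h := integral_re_mul_complexGaussian (F := fun a b => F b a) (Fa := fun a b => Fb b a)
    (fun a b => hF b a) (hFc.comp continuous_swap) (hFbc.comp continuous_swap)
    (fun a b => by rw [add_comm]; exact hb b a) (fun a b => by rw [add_comm]; exact hb' b a)
  have hswap : ∀ H : ℝ → ℝ → ℝ, ∫ z : ℂ, H z.re z.im ∂complexGaussian =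
      ∫ z : ℂ, H z.im z.re ∂complexGaussian := by
    intro H
    rw [integral_complexGaussian, integral_complexGaussian]
    exact (integral_prod_swap (μ := gaussianReal 0 (1 / 2)) (ν := gaussianReal 0 (1 / 2))
      (fun q : ℝ × ℝ => H q.1 q.2)).symm
  rw [hswap fun a b => b * F a b, hswap fun a b => Fb a b]
  exact h

/-! ### Differentiating Gaussian averages along the heat flow -/

/-- Continuous functions of `(a, b, γ)` of at most exponential growth in `(a, b)`, locally uniformly
in `γ ≥ 0`. -/
structure Tame (G : ℝ → ℝ → ℝ → ℝ) : Prop where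
  cont : Continuous fun q : ℝ × ℝ × ℝ => G q.1 q.2.1 q.2.2
  growth : ∀ Γ, ∃ C k, 0 ≤ C ∧ 0 ≤ k ∧ ∀ a b, ∀ γ ∈ Icc 0 Γ,
    |G a b γ| ≤ C * Real.exp (k * (|a| + |b|))

namespace Tame

variable {G H : ℝ → ℝ → ℝ → ℝ}

lemma add (hG : Tame G) (hH : Tame H) : Tame fun a b γ => G a b γ + H a b γ := by
  refine ⟨hG.cont.add hH.cont, fun Γ => ?_⟩
  obtain ⟨C₁, k₁, hC₁, hk₁, h₁⟩ := hG.growth Γ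
  obtain ⟨C₂, k₂, hC₂, hk₂, h₂⟩ := hH.growth Γ
  refine ⟨C₁ + C₂, k₁ + k₂, by positivity, by positivity, fun a b γ hγ => ?_⟩
  have hs : 0 ≤ |a| + |b| := by positivity
  have e1 : Real.exp (k₁ * (|a| + |b|)) ≤ Real.exp ((k₁ + k₂) * (|a| + |b|)) :=
    Real.exp_le_exp.2 (by nlinarith)
  have e2 : Real.exp (k₂ * (|a| + |b|)) ≤ Real.exp ((k₁ + k₂) * (|a| + |b|)) :=
    Real.exp_le_exp.2 (by nlinarith)
  calc |G a b γ + H a b γ| ≤ |G a b γ| + |H a b γ| := abs_add_le _ _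
    _ ≤ C₁ * Real.exp (k₁ * (|a| + |b|)) + C₂ * Real.exp (k₂ * (|a| + |b|)) :=
        add_le_add (h₁ a b γ hγ) (h₂ a b γ hγ)
    _ ≤ C₁ * Real.exp ((k₁ + k₂) * (|a| + |b|)) + C₂ * Real.exp ((k₁ + k₂) * (|a| + |b|)) := by
        gcongr
    _ = _ := by ring

lemma mul (hG : Tame G) (hH : Tame H) : Tame fun a b γ => G a b γ * H a b γ := by
  refine ⟨hG.cont.mul hH.cont, fun Γ => ?_⟩
  obtain ⟨C₁, k₁, hC₁, hk₁, h₁⟩ := hG.growth Γ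
  obtain ⟨C₂, k₂, hC₂, hk₂, h₂⟩ := hH.growth Γ
  refine ⟨C₁ * C₂, k₁ + k₂, by positivity, by positivity, fun a b γ hγ => ?_⟩
  rw [abs_mul, add_mul, Real.exp_add]
  calc |G a b γ| * |H a b γ| ≤ (C₁ * Real.exp (k₁ * (|a| + |b|))) *
        (C₂ * Real.exp (k₂ * (|a| + |b|))) :=
        mul_le_mul (h₁ a b γ hγ) (h₂ a b γ hγ) (abs_nonneg _) (by positivity)
    _ = _ := by ring

lemma of_bounded (hc : Continuous fun q : ℝ × ℝ × ℝ => G q.1 q.2.1 q.2.2) {K : ℝ}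
    (hK : ∀ a b γ, |G a b γ| ≤ K) : Tame G :=
  ⟨hc, fun Γ => ⟨K, 0, (abs_nonneg _).trans (hK 0 0 0), le_rfl, fun a b γ _ => by
    simpa using hK a b γ⟩⟩

lemma const (c : ℝ) : Tame fun _ _ _ => c := of_bounded continuous_const fun _ _ _ => le_rfl

lemma sub (hG : Tame G) (hH : Tame H) : Tame fun a b γ => G a b γ - H a b γ := by
  have h : (fun a b γ => G a b γ - H a b γ) = fun a b γ => G a b γ + -1 * H a b γ := by
    funext a b γ; ring
  rw [h]
  exact hG.add ((const (-1)).mul hH)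

lemma pow (hG : Tame G) (n : ℕ) : Tame fun a b γ => G a b γ ^ n := by
  induction n with
  | zero => simpa using const 1
  | succ n ih => simpa only [pow_succ] using ih.mul hG

end Tame

/-- The Gaussian average of `G` along the path `z = √γ n`. -/
noncomputable def gaussAvg (G : ℝ → ℝ → ℝ → ℝ) (γ : ℝ) : ℝ :=
  ∫ z : ℂ, G (Real.sqrt γ * z.re) (Real.sqrt γ * z.im) γ ∂complexGaussian

namespace Tame

variable {G : ℝ → ℝ → ℝ → ℝ}

lemma continuous_comp (hG : Tame G) (s γ : ℝ) :
    Continuous fun z : ℂ => G (s * z.re) (s * z.im) γ :=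
  hG.cont.comp (by fun_prop : Continuous fun z : ℂ => (s * z.re, s * z.im, γ))

lemma exists_bound (hG : Tame G) (Γ : ℝ) : ∃ C k, 0 ≤ C ∧ 0 ≤ k ∧ ∀ γ ∈ Icc 0 Γ, ∀ a b : ℝ,
    |G (Real.sqrt γ * a) (Real.sqrt γ * b) γ| ≤ C * Real.exp (k * (|a| + |b|)) := by
  obtain ⟨C, k, hC, hk, h⟩ := hG.growth Γ
  refine ⟨C, k * Real.sqrt Γ, hC, by positivity, fun γ hγ a b => ?_⟩
  refine (h _ _ γ hγ).trans (mul_le_mul_of_nonneg_left (Real.exp_le_exp.2 ?_) hC)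
  rw [abs_mul, abs_mul, abs_of_nonneg (Real.sqrt_nonneg γ), ← mul_add, mul_assoc]
  gcongr
  exact hγ.2

lemma integrable (hG : Tame G) {γ : ℝ} (hγ : 0 ≤ γ) :
    Integrable (fun z : ℂ => G (Real.sqrt γ * z.re) (Real.sqrt γ * z.im) γ) complexGaussian := by
  obtain ⟨C, k, -, -, h⟩ := hG.exists_bound γ
  exact integrable_of_abs_le_exp (hG.continuous_comp _ _) fun z => h γ ⟨hγ, le_rfl⟩ _ _

lemma continuousOn_gaussAvg (hG : Tame G) : ContinuousOn (gaussAvg G) (Ici 0) := by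
  intro γ₀ hγ₀
  obtain ⟨C, k, -, -, h⟩ := hG.exists_bound (γ₀ + 1)
  refine continuousWithinAt_of_dominated (bound := fun z : ℂ =>
    C * Real.exp (k * (|z.re| + |z.im|))) ?_ ?_
    ((integrable_exp_abs_complexGaussian k).const_mul C) ?_
  · exact Eventually.of_forall fun γ => (hG.continuous_comp _ _).aestronglyMeasurable
  · have h1 : ∀ᶠ γ in 𝓝[Ici 0] γ₀, γ ∈ Icc 0 (γ₀ + 1) := by
      filter_upwards [self_mem_nhdsWithin,
        mem_nhdsWithin_of_mem_nhds (Iio_mem_nhds (lt_add_one γ₀))] with γ h2 h3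
      exact ⟨h2, le_of_lt h3⟩
    filter_upwards [h1] with γ hγ
    exact Eventually.of_forall fun z => h γ hγ _ _
  · refine Eventually.of_forall fun z => Continuous.continuousWithinAt ?_
    exact hG.cont.comp (by fun_prop :
      Continuous fun γ : ℝ => (Real.sqrt γ * z.re, Real.sqrt γ * z.im, γ))

end Tame

lemma gaussAvg_add {G H : ℝ → ℝ → ℝ → ℝ} (hG : Tame G) (hH : Tame H) {γ : ℝ} (hγ : 0 ≤ γ) :
    gaussAvg (fun a b γ => G a b γ + H a b γ) γ = gaussAvg G γ + gaussAvg H γ :=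
  integral_add (hG.integrable hγ) (hH.integrable hγ)

lemma gaussAvg_sub {G H : ℝ → ℝ → ℝ → ℝ} (hG : Tame G) (hH : Tame H) {γ : ℝ} (hγ : 0 ≤ γ) :
    gaussAvg (fun a b γ => G a b γ - H a b γ) γ = gaussAvg G γ - gaussAvg H γ :=
  integral_sub (hG.integrable hγ) (hH.integrable hγ)

lemma gaussAvg_const_mul {G : ℝ → ℝ → ℝ → ℝ} (c γ : ℝ) :
    gaussAvg (fun a b γ => c * G a b γ) γ = c * gaussAvg G γ :=
  integral_const_mul _ _

lemma gaussAvg_mono {G H : ℝ → ℝ → ℝ → ℝ} (hG : Tame G) (hH : Tame H) {γ : ℝ} (hγ : 0 ≤ γ)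
    (h : ∀ a b, G a b γ ≤ H a b γ) : gaussAvg G γ ≤ gaussAvg H γ :=
  integral_mono (hG.integrable hγ) (hH.integrable hγ) fun _ => h _ _

/-- The heat flow identity `d/dγ E[G(√γ n, γ)] = E[(∂_γ + Δ / 4) G (√γ n, γ)]`. -/
lemma hasDerivAt_gaussAvg {G Ga Gb Gg Gaa Gbb : ℝ → ℝ → ℝ → ℝ} (hG : Tame G) (hGa : Tame Ga)
    (hGb : Tame Gb) (hGg : Tame Gg) (hGaa : Tame Gaa) (hGbb : Tame Gbb)
    (hcurve : ∀ u v γ : ℝ, 0 < γ → HasDerivAt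
      (fun γ => G (Real.sqrt γ * u) (Real.sqrt γ * v) γ)
      (1 / (2 * Real.sqrt γ) * u * Ga (Real.sqrt γ * u) (Real.sqrt γ * v) γ +
        1 / (2 * Real.sqrt γ) * v * Gb (Real.sqrt γ * u) (Real.sqrt γ * v) γ +
        Gg (Real.sqrt γ * u) (Real.sqrt γ * v) γ) γ)
    (haa : ∀ a b γ, HasDerivAt (fun a => Ga a b γ) (Gaa a b γ) a)
    (hbb : ∀ a b γ, HasDerivAt (fun b => Gb a b γ) (Gbb a b γ) b) {γ : ℝ} (hγ : 0 < γ) :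
    HasDerivAt (gaussAvg G)
      (gaussAvg (fun a b γ => Gg a b γ + (Gaa a b γ + Gbb a b γ) / 4) γ) γ := by
  obtain ⟨C₁, k₁, hC₁, hk₁, h₁⟩ := hGa.exists_bound (2 * γ)
  obtain ⟨C₂, k₂, hC₂, hk₂, h₂⟩ := hGb.exists_bound (2 * γ)
  obtain ⟨C₃, k₃, hC₃, hk₃, h₃⟩ := hGg.exists_bound (2 * γ)
  -- The velocity 1/(2√γ') of the path is singular at 0; on the neighbourhood (γ/2, 2γ) it is at
  -- most `r`, which gives a dominating function.
  set r := 1 / (2 * Real.sqrt (γ / 2))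
  have hr : 0 < r := by positivity
  have hs : Ioo (γ / 2) (2 * γ) ∈ 𝓝 γ := Ioo_mem_nhds (by linarith) (by linarith)
  have hbound : ∀ {C k : ℝ} {K : ℝ → ℝ → ℝ → ℝ}, 0 ≤ C → (∀ γ' ∈ Icc 0 (2 * γ), ∀ a b : ℝ,
      |K (Real.sqrt γ' * a) (Real.sqrt γ' * b) γ'| ≤ C * Real.exp (k * (|a| + |b|))) →
      ∀ γ' ∈ Ioo (γ / 2) (2 * γ), ∀ u v w : ℝ, |w| ≤ |u| + |v| →
      |1 / (2 * Real.sqrt γ') * w * K (Real.sqrt γ' * u) (Real.sqrt γ' * v) γ'| ≤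
        r * C * Real.exp ((k + 1) * (|u| + |v|)) := by
    intro C k K hC hK γ' hγ' u v w hw
    have hγ'0 : 0 < γ' := by linarith [hγ'.1]
    have h1 : 1 / (2 * Real.sqrt γ') ≤ r := by
      apply one_div_le_one_div_of_le (by positivity)
      gcongr
      exact hγ'.1.le
    have h2 : |w| ≤ Real.exp (|u| + |v|) := by
      linarith [Real.add_one_le_exp (|u| + |v|)]
    rw [abs_mul, abs_mul, abs_of_pos (by positivity : 0 < 1 / (2 * Real.sqrt γ')), add_mul,
      Real.exp_add, one_mul]
    calc 1 / (2 * Real.sqrt γ') * |w| * |K (Real.sqrt γ' * u) (Real.sqrt γ' * v) γ'| ≤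
          r * Real.exp (|u| + |v|) * (C * Real.exp (k * (|u| + |v|))) := by
          gcongr
          exact hK γ' ⟨hγ'0.le, hγ'.2.le⟩ u v
      _ = _ := by ring
  have hderiv := hasDerivAt_integral_of_dominated_loc_of_deriv_le (μ := complexGaussian)
    (F := fun γ (z : ℂ) => G (Real.sqrt γ * z.re) (Real.sqrt γ * z.im) γ)
    (F' := fun γ (z : ℂ) => 1 / (2 * Real.sqrt γ) * z.re *
        Ga (Real.sqrt γ * z.re) (Real.sqrt γ * z.im) γ +
      1 / (2 * Real.sqrt γ) * z.im * Gb (Real.sqrt γ * z.re) (Real.sqrt γ * z.im) γ +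
      Gg (Real.sqrt γ * z.re) (Real.sqrt γ * z.im) γ)
    (bound := fun z : ℂ => r * C₁ * Real.exp ((k₁ + 1) * (|z.re| + |z.im|)) +
      r * C₂ * Real.exp ((k₂ + 1) * (|z.re| + |z.im|)) +
      C₃ * Real.exp (k₃ * (|z.re| + |z.im|))) (x₀ := γ) hs
    (Eventually.of_forall fun γ' => (hG.continuous_comp _ _).aestronglyMeasurable)
    (hG.integrable hγ.le)
    (((((continuous_const.mul Complex.continuous_re).mul (hGa.continuous_comp _ _)).add
      ((continuous_const.mul Complex.continuous_im).mul (hGb.continuous_comp _ _))).add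
      (hGg.continuous_comp _ _)).aestronglyMeasurable)
    (Eventually.of_forall fun z γ' hγ' => by
      have hγ'0 : 0 < γ' := by linarith [hγ'.1]
      refine (abs_add_le _ _).trans (add_le_add ((abs_add_le _ _).trans (add_le_add ?_ ?_)) ?_)
      · exact hbound hC₁ h₁ γ' hγ' _ _ _ (by linarith [abs_nonneg z.im])
      · exact hbound hC₂ h₂ γ' hγ' _ _ _ (by linarith [abs_nonneg z.re])
      · exact h₃ γ' ⟨hγ'0.le, hγ'.2.le⟩ _ _)
    ((((integrable_exp_abs_complexGaussian _).const_mul _).add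
      ((integrable_exp_abs_complexGaussian _).const_mul _)).add
      ((integrable_exp_abs_complexGaussian _).const_mul _))
    (Eventually.of_forall fun z γ' hγ' => hcurve _ _ _ (by linarith [hγ'.1]))
  refine hderiv.2.congr_deriv ?_
  set s := Real.sqrt γ
  have hs0 : 0 < s := Real.sqrt_pos.2 hγ
  have hscale : ∀ {K : ℝ → ℝ → ℝ → ℝ}, Tame K →
      Continuous fun q : ℝ × ℝ => K (s * q.1) (s * q.2) γ := fun {K} hK =>
    hK.cont.comp (by fun_prop : Continuous fun q : ℝ × ℝ => (s * q.1, s * q.2, γ))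
  have hmulint : ∀ {K : ℝ → ℝ → ℝ → ℝ} (w : ℂ → ℝ), Tame K → Continuous w →
      (∀ z : ℂ, |w z| ≤ |z.re| + |z.im|) →
      Integrable (fun z : ℂ => w z * K (s * z.re) (s * z.im) γ) complexGaussian := by
    intro K w hK hw hwb
    obtain ⟨C, k, hC, hk, h⟩ := hK.exists_bound γ
    refine integrable_of_abs_le_exp (C := C) (k := k + 1) (hw.mul (hK.continuous_comp _ _))
      fun z => ?_
    rw [abs_mul, add_mul, Real.exp_add, one_mul]
    calc |w z| * |K (s * z.re) (s * z.im) γ| ≤ Real.exp (|z.re| + |z.im|) *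
          (C * Real.exp (k * (|z.re| + |z.im|))) :=
          mul_le_mul ((hwb z).trans (by linarith [Real.add_one_le_exp (|z.re| + |z.im|)]))
            (h γ ⟨hγ.le, le_rfl⟩ _ _) (abs_nonneg _) (Real.exp_pos _).le
      _ = _ := by ring
  -- Stein's identity trades the factor `z.re` for a derivative. The chain rule produces a factor
  -- `s` that cancels the one in 1/(2s), leaving 1/2 · 1/2 = 1/4 in front of the Laplacian.
  have hst1 : ∫ z : ℂ, z.re * Ga (s * z.re) (s * z.im) γ ∂complexGaussian =
      1 / 2 * ∫ z : ℂ, s * Gaa (s * z.re) (s * z.im) γ ∂complexGaussian := by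
    obtain ⟨C, k, hC, hk, h⟩ := hGa.exists_bound γ
    obtain ⟨C', k', hC', hk', h'⟩ := (((Tame.const s).mul hGaa)).exists_bound γ
    refine integral_re_mul_complexGaussian (F := fun a b => Ga (s * a) (s * b) γ)
      (Fa := fun a b => s * Gaa (s * a) (s * b) γ) (C := C + C') (k := k + k') ?_ (hscale hGa)
      (continuous_const.mul (hscale hGaa)) ?_ ?_
    · intro a b
      have := (haa (s * a) (s * b) γ).comp a ((hasDerivAt_id a).const_mul s)
      simpa [mul_comm, Function.comp_def] using this
    · intro a b
      refine (h γ ⟨hγ.le, le_rfl⟩ a b).trans ?_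
      have : 0 ≤ |a| + |b| := by positivity
      gcongr <;> linarith
    · intro a b
      refine (h' γ ⟨hγ.le, le_rfl⟩ a b).trans ?_
      have : 0 ≤ |a| + |b| := by positivity
      gcongr <;> linarith
  have hst2 : ∫ z : ℂ, z.im * Gb (s * z.re) (s * z.im) γ ∂complexGaussian =
      1 / 2 * ∫ z : ℂ, s * Gbb (s * z.re) (s * z.im) γ ∂complexGaussian := by
    obtain ⟨C, k, hC, hk, h⟩ := hGb.exists_bound γ
    obtain ⟨C', k', hC', hk', h'⟩ := (((Tame.const s).mul hGbb)).exists_bound γ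
    refine integral_im_mul_complexGaussian (F := fun a b => Gb (s * a) (s * b) γ)
      (Fb := fun a b => s * Gbb (s * a) (s * b) γ) (C := C + C') (k := k + k') ?_ (hscale hGb)
      (continuous_const.mul (hscale hGbb)) ?_ ?_
    · intro a b
      have := (hbb (s * a) (s * b) γ).comp b ((hasDerivAt_id b).const_mul s)
      simpa [mul_comm, Function.comp_def] using this
    · intro a b
      refine (h γ ⟨hγ.le, le_rfl⟩ a b).trans ?_
      have : 0 ≤ |a| + |b| := by positivity
      gcongr <;> linarith
    · intro a b
      refine (h' γ ⟨hγ.le, le_rfl⟩ a b).trans ?_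
      have : 0 ≤ |a| + |b| := by positivity
      gcongr <;> linarith
  have hi1 := (hmulint (fun z => z.re) hGa Complex.continuous_re
    (fun z => by linarith [abs_nonneg z.im])).const_mul (1 / (2 * s))
  have hi2 := (hmulint (fun z => z.im) hGb Complex.continuous_im
    (fun z => by linarith [abs_nonneg z.re])).const_mul (1 / (2 * s))
  have hassoc : ∀ z : ℂ, 1 / (2 * s) * z.re * Ga (s * z.re) (s * z.im) γ +
      1 / (2 * s) * z.im * Gb (s * z.re) (s * z.im) γ + Gg (s * z.re) (s * z.im) γ =
      1 / (2 * s) * (z.re * Ga (s * z.re) (s * z.im) γ) +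
      1 / (2 * s) * (z.im * Gb (s * z.re) (s * z.im) γ) + Gg (s * z.re) (s * z.im) γ :=
    fun z => by ring
  simp_rw [hassoc]
  have hi12 : Integrable (fun z : ℂ => 1 / (2 * s) * (z.re * Ga (s * z.re) (s * z.im) γ) +
      1 / (2 * s) * (z.im * Gb (s * z.re) (s * z.im) γ)) complexGaussian := hi1.add hi2
  have hg : Integrable (fun z : ℂ => Gg (s * z.re) (s * z.im) γ) complexGaussian :=
    hGg.integrable hγ.le
  have haabb : Integrable (fun z : ℂ => (Gaa (s * z.re) (s * z.im) γ +
      Gbb (s * z.re) (s * z.im) γ) / 4) complexGaussian :=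
    ((hGaa.integrable hγ.le).add (hGbb.integrable hγ.le)).div_const 4
  rw [integral_add hi12 hg, integral_add hi1 hi2,
    integral_const_mul, integral_const_mul, hst1, hst2, integral_const_mul, integral_const_mul]
  unfold gaussAvg
  rw [integral_add hg haabb, integral_div, integral_add (hGaa.integrable hγ.le) (hGbb.integrable
      hγ.le)]
  field_simp
  ring

/-! ### Likelihoods and posterior means -/

/-- The likelihood ratio `∑ p_x exp (2 ⟨z, x⟩ - γ |x|²)` at `z = (a, b)`. -/
noncomputable def lik (S : Finset ℂ) (p : ℂ → ℝ) (a b γ : ℝ) : ℝ :=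
  ∑ x ∈ S, p x * Real.exp (2 * (a * x.re + b * x.im) - γ * (x.re ^ 2 + x.im ^ 2))

/-- The posterior mean of `c`. -/
noncomputable def post (S : Finset ℂ) (p c : ℂ → ℝ) (a b γ : ℝ) : ℝ :=
  lik S (fun x => c x * p x) a b γ / lik S p a b γ

/-- A probability mass function with full support, zero mean and unit power. -/
structure UnitInput (S : Finset ℂ) (p : ℂ → ℝ) : Prop where
  pos : ∀ x ∈ S, 0 < p x
  sum_eq_one : ∑ x ∈ S, p x = 1
  mean_re : ∑ x ∈ S, x.re * p x = 0
  mean_im : ∑ x ∈ S, x.im * p x = 0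
  power : ∑ x ∈ S, (x.re ^ 2 + x.im ^ 2) * p x = 1

@[fun_prop]
lemma continuous_lik (S : Finset ℂ) (p : ℂ → ℝ) {α : Type*} [TopologicalSpace α] {f g h : α → ℝ}
    (hf : Continuous f) (hg : Continuous g) (hh : Continuous h) :
    Continuous fun x => lik S p (f x) (g x) (h x) := by
  unfold lik; fun_prop

/-- Differentiating along an arbitrary curve covers the partial derivatives and the path γ ↦ (√γ u,
√γ v, γ) at once. -/
lemma hasDerivAt_lik (S : Finset ℂ) (p : ℂ → ℝ) {a b g : ℝ → ℝ} {a' b' g' t : ℝ}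
    (ha : HasDerivAt a a' t) (hb : HasDerivAt b b' t) (hg : HasDerivAt g g' t) :
    HasDerivAt (fun t => lik S p (a t) (b t) (g t))
      (2 * a' * lik S (fun x => x.re * p x) (a t) (b t) (g t) +
        2 * b' * lik S (fun x => x.im * p x) (a t) (b t) (g t) -
        g' * lik S (fun x => (x.re ^ 2 + x.im ^ 2) * p x) (a t) (b t) (g t)) t := by
  unfold lik
  have h : ∀ x ∈ S, HasDerivAt (fun t => p x * Real.exp (2 * (a t * x.re + b t * x.im) -
      g t * (x.re ^ 2 + x.im ^ 2))) (p x * (Real.exp (2 * (a t * x.re + b t * x.im) -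
      g t * (x.re ^ 2 + x.im ^ 2)) * (2 * (a' * x.re + b' * x.im) -
      g' * (x.re ^ 2 + x.im ^ 2)))) t := fun x _ =>
    ((((ha.mul_const x.re).fun_add (hb.mul_const x.im)).const_mul 2).fun_sub
      (hg.mul_const (x.re ^ 2 + x.im ^ 2))).exp.const_mul (p x)
  refine (HasDerivAt.fun_sum h).congr_deriv ?_
  simp only [Finset.mul_sum]
  rw [← Finset.sum_add_distrib, ← Finset.sum_sub_distrib]
  exact Finset.sum_congr rfl fun x _ => by ring

lemma tame_lik (S : Finset ℂ) (p : ℂ → ℝ) : Tame (lik S p) := by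
  refine ⟨by fun_prop, fun Γ => ⟨∑ x ∈ S, |p x|, 2 * ∑ x ∈ S, ‖x‖, by positivity, by positivity,
    fun a b γ hγ => ?_⟩⟩
  rw [Finset.sum_mul]
  refine (Finset.abs_sum_le_sum_abs _ _).trans (Finset.sum_le_sum fun x hx => ?_)
  rw [abs_mul, Real.abs_exp]
  refine mul_le_mul_of_nonneg_left (Real.exp_le_exp.2 ?_) (abs_nonneg _)
  have hx' : ‖x‖ ≤ ∑ x ∈ S, ‖x‖ := 
    Finset.single_le_sum (f := fun x => ‖x‖) (fun _ _ => norm_nonneg _) hx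
  have h1 : a * x.re ≤ |a| * ∑ x ∈ S, ‖x‖ := by
    refine (le_abs_self _).trans ?_
    rw [abs_mul]
    exact mul_le_mul_of_nonneg_left ((Complex.abs_re_le_norm x).trans hx') (abs_nonneg _)
  have h2 : b * x.im ≤ |b| * ∑ x ∈ S, ‖x‖ := by
    refine (le_abs_self _).trans ?_
    rw [abs_mul]
    exact mul_le_mul_of_nonneg_left ((Complex.abs_im_le_norm x).trans hx') (abs_nonneg _)
  have h3 : 0 ≤ γ * (x.re ^ 2 + x.im ^ 2) := mul_nonneg hγ.1 (by positivity)
  linarith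

namespace UnitInput

variable {S : Finset ℂ} {p : ℂ → ℝ}

lemma nonempty (hp : UnitInput S p) : S.Nonempty := by
  by_contra h
  rw [Finset.not_nonempty_iff_eq_empty] at h
  have := hp.sum_eq_one
  simp [h] at this

lemma lik_pos (hp : UnitInput S p) (a b γ : ℝ) : 0 < lik S p a b γ :=
  Finset.sum_pos (fun x hx => mul_pos (hp.pos x hx) (Real.exp_pos _)) hp.nonempty

lemma continuous_post (hp : UnitInput S p) (c : ℂ → ℝ) :
    Continuous fun q : ℝ × ℝ × ℝ => post S p c q.1 q.2.1 q.2.2 := by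
  unfold post
  exact Continuous.div (by fun_prop) (by fun_prop) fun q => (hp.lik_pos _ _ _).ne'

lemma lik_mul_eq (hp : UnitInput S p) (c : ℂ → ℝ) (a b γ : ℝ) :
    lik S (fun x => c x * p x) a b γ = lik S p a b γ * post S p c a b γ :=
  (mul_div_cancel₀ _ (hp.lik_pos a b γ).ne').symm

lemma abs_post_le (hp : UnitInput S p) {c : ℂ → ℝ} {K : ℝ} (hK : ∀ x ∈ S, |c x| ≤ K)
    (a b γ : ℝ) : |post S p c a b γ| ≤ K := by
  unfold post
  rw [abs_div, abs_of_pos (hp.lik_pos a b γ), div_le_iff₀ (hp.lik_pos a b γ), lik, lik,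
    Finset.mul_sum]
  refine (Finset.abs_sum_le_sum_abs _ _).trans (Finset.sum_le_sum fun x hx => ?_)
  have hpx := hp.pos x hx
  rw [abs_mul, abs_mul, abs_of_pos hpx, Real.abs_exp, mul_assoc]
  exact mul_le_mul_of_nonneg_right (hK x hx) (by positivity)

lemma tame_post (hp : UnitInput S p) (c : ℂ → ℝ) : Tame (post S p c) :=
  Tame.of_bounded (hp.continuous_post c) (K := ∑ x ∈ S, |c x|) fun a b γ =>
    hp.abs_post_le (fun _ hx => Finset.single_le_sum (f := fun x => |c x|)
      (fun _ _ => abs_nonneg _) hx) a b γ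

/-- A growth bound on `lik` alone does not control its logarithm near zero. The lower bound exp(-r),
with r affine in |a| + |b|, comes from the total weight being one. -/
lemma tame_log_lik (hp : UnitInput S p) : Tame fun a b γ => Real.log (lik S p a b γ) := by
  refine ⟨Continuous.log (by fun_prop) fun q => (hp.lik_pos _ _ _).ne', fun Γ => ?_⟩
  set R := ∑ x ∈ S, ‖x‖
  have hR : ∀ x ∈ S, ‖x‖ ≤ R := fun x hx =>
    Finset.single_le_sum (f := fun x => ‖x‖) (fun _ _ => norm_nonneg _) hx
  have hR0 : 0 ≤ R := Finset.sum_nonneg fun _ _ => norm_nonneg _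
  refine ⟨2 * R + 2 * |Γ| * R ^ 2, 1, by positivity, zero_le_one, fun a b γ hγ => ?_⟩
  set s := |a| + |b|
  have hexp : ∀ x ∈ S, |2 * (a * x.re + b * x.im) - γ * (x.re ^ 2 + x.im ^ 2)| ≤
      2 * R * s + 2 * |Γ| * R ^ 2 := by
    intro x hx
    have hre := (Complex.abs_re_le_norm x).trans (hR x hx)
    have him := (Complex.abs_im_le_norm x).trans (hR x hx)
    have h1 : |a * x.re| ≤ |a| * R := by
      rw [abs_mul]; exact mul_le_mul_of_nonneg_left hre (abs_nonneg _)
    have h2 : |b * x.im| ≤ |b| * R := by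
      rw [abs_mul]; exact mul_le_mul_of_nonneg_left him (abs_nonneg _)
    have h3 : γ * (x.re ^ 2 + x.im ^ 2) ≤ |Γ| * (R ^ 2 + R ^ 2) :=
      mul_le_mul (hγ.2.trans (le_abs_self Γ))
        (add_le_add (sq_le_sq' (abs_le.1 hre).1 (abs_le.1 hre).2)
          (sq_le_sq' (abs_le.1 him).1 (abs_le.1 him).2)) (by positivity) (abs_nonneg _)
    have h4 : 0 ≤ γ * (x.re ^ 2 + x.im ^ 2) := mul_nonneg hγ.1 (by positivity)
    have h5 : 0 ≤ |Γ| * R ^ 2 := by positivity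
    rw [abs_le] at h1 h2 ⊢
    simp only [s]
    constructor <;> nlinarith
  set r := 2 * R * s + 2 * |Γ| * R ^ 2
  have hlow : Real.exp (-r) ≤ lik S p a b γ := by
    calc Real.exp (-r) = ∑ x ∈ S, p x * Real.exp (-r) := by
          rw [← Finset.sum_mul, hp.sum_eq_one, one_mul]
      _ ≤ _ := Finset.sum_le_sum fun x hx => mul_le_mul_of_nonneg_left
          (Real.exp_le_exp.2 (abs_le.1 (hexp x hx)).1) (hp.pos x hx).le
  have hup : lik S p a b γ ≤ Real.exp r := by
    calc lik S p a b γ ≤ ∑ x ∈ S, p x * Real.exp r := Finset.sum_le_sum fun x hx =>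
          mul_le_mul_of_nonneg_left (Real.exp_le_exp.2 (abs_le.1 (hexp x hx)).2) (hp.pos x hx).le
      _ = _ := by rw [← Finset.sum_mul, hp.sum_eq_one, one_mul]
  have e1 := Real.log_le_log (Real.exp_pos _) hlow
  have e2 := Real.log_le_log (hp.lik_pos a b γ) hup
  rw [Real.log_exp] at e1 e2
  have hs0 : 0 ≤ s := by positivity
  have hse : s + 1 ≤ Real.exp (1 * s) := by rw [one_mul]; exact Real.add_one_le_exp s
  have hr : r ≤ (2 * R + 2 * |Γ| * R ^ 2) * Real.exp (1 * s) := by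
    have h1 : 0 ≤ |Γ| * R ^ 2 := by positivity
    simp only [r]
    nlinarith
  exact (abs_le.2 ⟨e1, e2⟩).trans hr

lemma hasDerivAt_lik' (hp : UnitInput S p) {a b g : ℝ → ℝ} {a' b' g' t : ℝ}
    (ha : HasDerivAt a a' t) (hb : HasDerivAt b b' t) (hg : HasDerivAt g g' t) :
    HasDerivAt (fun t => lik S p (a t) (b t) (g t))
      (lik S p (a t) (b t) (g t) * (2 * a' * post S p (fun x => x.re) (a t) (b t) (g t) +
        2 * b' * post S p (fun x => x.im) (a t) (b t) (g t) -
        g' * post S p (fun x => x.re ^ 2 + x.im ^ 2) (a t) (b t) (g t))) t := by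
  refine (hasDerivAt_lik S p ha hb hg).congr_deriv ?_
  rw [hp.lik_mul_eq (fun x => x.re), hp.lik_mul_eq (fun x => x.im),
    hp.lik_mul_eq (fun x => x.re ^ 2 + x.im ^ 2)]
  ring

/-- The derivative of a posterior mean is the posterior covariance with the derivative of the
log-likelihood, as for any exponential family. -/
lemma hasDerivAt_post (hp : UnitInput S p) (c : ℂ → ℝ) {a b g : ℝ → ℝ} {a' b' g' t : ℝ}
    (ha : HasDerivAt a a' t) (hb : HasDerivAt b b' t) (hg : HasDerivAt g g' t) :
    HasDerivAt (fun t => post S p c (a t) (b t) (g t))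
      (2 * a' * (post S p (fun x => x.re * c x) (a t) (b t) (g t) -
          post S p (fun x => x.re) (a t) (b t) (g t) * post S p c (a t) (b t) (g t)) +
        2 * b' * (post S p (fun x => x.im * c x) (a t) (b t) (g t) -
          post S p (fun x => x.im) (a t) (b t) (g t) * post S p c (a t) (b t) (g t)) -
        g' * (post S p (fun x => (x.re ^ 2 + x.im ^ 2) * c x) (a t) (b t) (g t) -
          post S p (fun x => x.re ^ 2 + x.im ^ 2) (a t) (b t) (g t) *
            post S p c (a t) (b t) (g t))) t := by
  have hL := (hp.lik_pos (a t) (b t) (g t)).ne'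
  have h := (hasDerivAt_lik S (fun x => c x * p x) ha hb hg).fun_div (hp.hasDerivAt_lik' ha hb hg)
      hL
  refine h.congr_deriv ?_
  simp only [← mul_assoc]
  rw [hp.lik_mul_eq (fun x => x.re * c x), hp.lik_mul_eq (fun x => x.im * c x),
    hp.lik_mul_eq (fun x => (x.re ^ 2 + x.im ^ 2) * c x), hp.lik_mul_eq c]
  field_simp
  ring

lemma post_add (c d : ℂ → ℝ) (a b γ : ℝ) :
    post S p (fun x => c x + d x) a b γ = post S p c a b γ + post S p d a b γ := by
  unfold post lik
  rw [← add_div, ← Finset.sum_add_distrib]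
  congr 1
  exact Finset.sum_congr rfl fun x _ => by ring

end UnitInput

/-! ### Averages against the likelihood -/

/-- Cameron–Martin with shift √γ x: weighting the noise by the likelihood of `x` turns it into the
channel output given `x`. -/
lemma integral_exp_mul (F : ℂ → ℝ) {γ : ℝ} (hγ : 0 ≤ γ) (x : ℂ) :
    ∫ z, Real.exp (2 * (Real.sqrt γ * z.re * x.re + Real.sqrt γ * z.im * x.im) -
      γ * (x.re ^ 2 + x.im ^ 2)) * F z ∂complexGaussian =
      ∫ z, F (Real.sqrt γ * x + z) ∂complexGaussian := by
  rw [integral_complexGaussian_const_add]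
  refine integral_congr_ae (Eventually.of_forall fun z => ?_)
  have hs := Real.sq_sqrt hγ
  simp only [Complex.mul_re, Complex.mul_im, Complex.ofReal_re, Complex.ofReal_im, zero_mul,
    sub_zero, add_zero]
  congr 2
  linear_combination (x.re ^ 2 + x.im ^ 2) * hs

lemma tame_exp (x : ℂ) : Tame fun a b γ =>
    Real.exp (2 * (a * x.re + b * x.im) - γ * (x.re ^ 2 + x.im ^ 2)) := by
  have h := tame_lik {x} fun _ => 1
  have he : lik {x} (fun _ => 1) = fun a b γ =>
      Real.exp (2 * (a * x.re + b * x.im) - γ * (x.re ^ 2 + x.im ^ 2)) := by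
    funext a b γ
    simp [lik]
  rwa [he] at h

/-- Averages weighted by the likelihood are averages over the signal and the noise. -/
lemma gaussAvg_lik_mul (S : Finset ℂ) (q : ℂ → ℝ) {H : ℝ → ℝ → ℝ → ℝ} (hH : Tame H) {γ : ℝ}
    (hγ : 0 ≤ γ) : gaussAvg (fun a b γ => lik S q a b γ * H a b γ) γ =
      ∑ x ∈ S, q x * ∫ z : ℂ, H (Real.sqrt γ * (Real.sqrt γ * x.re + z.re))
        (Real.sqrt γ * (Real.sqrt γ * x.im + z.im)) γ ∂complexGaussian := by
  unfold gaussAvg lik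
  simp only [Finset.sum_mul]
  rw [integral_finsetSum]
  · refine Finset.sum_congr rfl fun x _ => ?_
    simp only [mul_assoc]
    rw [integral_const_mul]
    congr 1
    have h := integral_exp_mul (fun z => H (Real.sqrt γ * z.re) (Real.sqrt γ * z.im) γ) hγ x
    simp only [Complex.add_re, Complex.add_im, Complex.mul_re, Complex.mul_im, Complex.ofReal_re,
      Complex.ofReal_im, zero_mul, sub_zero, add_zero, mul_assoc] at h
    exact h
  · intro x _
    exact (((Tame.const (q x)).mul (tame_exp x)).mul hH).integrable hγ

lemma integrable_re_complexGaussian : Integrable (fun z : ℂ => z.re) complexGaussian :=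
  integrable_of_abs_le_exp (C := 1) (k := 1) Complex.continuous_re fun z => by
    linarith [Real.add_one_le_exp (1 * (|z.re| + |z.im|)), abs_nonneg z.im]

lemma integrable_im_complexGaussian : Integrable (fun z : ℂ => z.im) complexGaussian :=
  integrable_of_abs_le_exp (C := 1) (k := 1) Complex.continuous_im fun z => by
    linarith [Real.add_one_le_exp (1 * (|z.re| + |z.im|)), abs_nonneg z.re]

lemma integral_re_complexGaussian : ∫ z, z.re ∂complexGaussian = 0 := by
  have h := integral_re (𝕜 := ℂ) (IsGaussian.integrable_id (μ := complexGaussian))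
  simp only [RCLike.re_to_complex, id] at h
  rw [h, integral_id_complexGaussian]
  rfl

lemma integral_im_complexGaussian : ∫ z, z.im ∂complexGaussian = 0 := by
  have h := integral_im (𝕜 := ℂ) (IsGaussian.integrable_id (μ := complexGaussian))
  simp only [RCLike.im_to_complex, id] at h
  rw [h, integral_id_complexGaussian]
  rfl

lemma abs_le_exp_add (a b : ℝ) : |a| ≤ 1 * Real.exp (1 * (|a| + |b|)) := by
  linarith [Real.add_one_le_exp (1 * (|a| + |b|)), abs_nonneg b]

lemma one_le_exp_add (a b : ℝ) : |(1 : ℝ)| ≤ 1 * Real.exp (1 * (|a| + |b|)) := by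
  rw [abs_one]
  linarith [Real.add_one_le_exp (1 * (|a| + |b|)), abs_nonneg b, abs_nonneg a]

lemma integral_re_sq_complexGaussian : ∫ z, z.re ^ 2 ∂complexGaussian = 1 / 2 := by
  have h := integral_re_mul_complexGaussian (F := fun a _ => a) (Fa := fun _ _ => 1)
    (fun a _ => hasDerivAt_id a) (by fun_prop) (by fun_prop) abs_le_exp_add one_le_exp_add
  simpa [sq] using h

lemma integral_im_sq_complexGaussian : ∫ z, z.im ^ 2 ∂complexGaussian = 1 / 2 := by
  have h := integral_im_mul_complexGaussian (F := fun _ b => b) (Fb := fun _ _ => 1)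
    (fun _ b => hasDerivAt_id b) (by fun_prop) (by fun_prop)
    (fun a b => by rw [add_comm]; exact abs_le_exp_add b a) one_le_exp_add
  simpa [sq] using h

/-- The integral of a non-integrable function is zero by convention, so a nonzero value certifies
integrability. -/
lemma integrable_re_sq_complexGaussian : Integrable (fun z : ℂ => z.re ^ 2) complexGaussian :=
  not_imp_comm.1 integral_undef (by rw [integral_re_sq_complexGaussian]; norm_num)

lemma integrable_im_sq_complexGaussian : Integrable (fun z : ℂ => z.im ^ 2) complexGaussian :=
  not_imp_comm.1 integral_undef (by rw [integral_im_sq_complexGaussian]; norm_num)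

lemma tame_fst : Tame fun a _ _ => a :=
  ⟨by fun_prop, fun _ => ⟨1, 1, zero_le_one, zero_le_one, fun a b _ _ => abs_le_exp_add a b⟩⟩

lemma tame_snd : Tame fun _ b _ => b :=
  ⟨by fun_prop, fun _ => ⟨1, 1, zero_le_one, zero_le_one, fun a b _ _ => by
    rw [add_comm]; exact abs_le_exp_add b a⟩⟩

lemma gaussAvg_lik (S : Finset ℂ) (q : ℂ → ℝ) {γ : ℝ} (hγ : 0 ≤ γ) :
    gaussAvg (lik S q) γ = ∑ x ∈ S, q x := by
  have h := gaussAvg_lik_mul S q (Tame.const 1) hγ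
  simpa using h

lemma gaussAvg_lik_mul_fst (S : Finset ℂ) (q : ℂ → ℝ) {γ : ℝ} (hγ : 0 ≤ γ) :
    gaussAvg (fun a b γ => lik S q a b γ * a) γ = γ * ∑ x ∈ S, x.re * q x := by
  have h := gaussAvg_lik_mul S q tame_fst hγ
  rw [h, Finset.mul_sum]
  refine Finset.sum_congr rfl fun x _ => ?_
  rw [integral_const_mul, integral_add (integrable_const _) integrable_re_complexGaussian,
    integral_re_complexGaussian]
  simp only [integral_const, probReal_univ, smul_eq_mul, one_mul, add_zero]
  linear_combination q x * x.re * Real.mul_self_sqrt hγ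

lemma gaussAvg_lik_mul_snd (S : Finset ℂ) (q : ℂ → ℝ) {γ : ℝ} (hγ : 0 ≤ γ) :
    gaussAvg (fun a b γ => lik S q a b γ * b) γ = γ * ∑ x ∈ S, x.im * q x := by
  have h := gaussAvg_lik_mul S q tame_snd hγ
  rw [h, Finset.mul_sum]
  refine Finset.sum_congr rfl fun x _ => ?_
  rw [integral_const_mul, integral_add (integrable_const _) integrable_im_complexGaussian,
    integral_im_complexGaussian]
  simp only [integral_const, probReal_univ, smul_eq_mul, one_mul, add_zero]
  linear_combination q x * x.im * Real.mul_self_sqrt hγ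

lemma gaussAvg_lik_mul_sq_add_sq (S : Finset ℂ) (q : ℂ → ℝ) {γ : ℝ} (hγ : 0 ≤ γ) :
    gaussAvg (fun a b γ => lik S q a b γ * (a ^ 2 + b ^ 2)) γ =
      γ * ∑ x ∈ S, (1 + γ * (x.re ^ 2 + x.im ^ 2)) * q x := by
  have h := gaussAvg_lik_mul S q ((tame_fst.pow 2).add (tame_snd.pow 2)) hγ
  rw [h, Finset.mul_sum]
  refine Finset.sum_congr rfl fun x _ => ?_
  have hs := Real.sq_sqrt hγ
  have he : ∀ z : ℂ, (Real.sqrt γ * (Real.sqrt γ * x.re + z.re)) ^ 2 +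
      (Real.sqrt γ * (Real.sqrt γ * x.im + z.im)) ^ 2 =
      γ * (γ * (x.re ^ 2 + x.im ^ 2)) + 2 * γ * Real.sqrt γ * x.re * z.re +
        2 * γ * Real.sqrt γ * x.im * z.im + γ * z.re ^ 2 + γ * z.im ^ 2 := by
    intro z
    linear_combination (((Real.sqrt γ * x.re + z.re) ^ 2 + (Real.sqrt γ * x.im + z.im) ^ 2) +
      γ * (x.re ^ 2 + x.im ^ 2)) * hs
  simp_rw [he]
  have i1 := integrable_re_complexGaussian.const_mul (2 * γ * Real.sqrt γ * x.re)
  have i2 := integrable_im_complexGaussian.const_mul (2 * γ * Real.sqrt γ * x.im)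
  have i3 := integrable_re_sq_complexGaussian.const_mul γ
  have i4 := integrable_im_sq_complexGaussian.const_mul γ
  have i0 : Integrable (fun _ : ℂ => γ * (γ * (x.re ^ 2 + x.im ^ 2))) complexGaussian :=
    integrable_const _
  rw [integral_add (f := fun z : ℂ => γ * (γ * (x.re ^ 2 + x.im ^ 2)) +
      2 * γ * Real.sqrt γ * x.re * z.re + 2 * γ * Real.sqrt γ * x.im * z.im + γ * z.re ^ 2)
      (((i0.add i1).add i2).add i3) i4,
    integral_add (f := fun z : ℂ => γ * (γ * (x.re ^ 2 + x.im ^ 2)) +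
      2 * γ * Real.sqrt γ * x.re * z.re + 2 * γ * Real.sqrt γ * x.im * z.im)
      ((i0.add i1).add i2) i3,
    integral_add (f := fun z : ℂ => γ * (γ * (x.re ^ 2 + x.im ^ 2)) +
      2 * γ * Real.sqrt γ * x.re * z.re) (i0.add i1) i2, integral_add i0 i1,
    integral_const_mul (2 * γ * Real.sqrt γ * x.re), integral_const_mul (2 * γ * Real.sqrt γ *
        x.im),
    integral_const_mul γ (fun z : ℂ => z.re ^ 2), integral_const_mul γ (fun z : ℂ => z.im ^ 2),
    integral_re_complexGaussian, integral_im_complexGaussian, integral_re_sq_complexGaussian,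
    integral_im_sq_complexGaussian]
  simp only [integral_const, probReal_univ, smul_eq_mul]
  ring

lemma tame_param : Tame fun _ _ γ => γ :=
  ⟨by fun_prop, fun Γ => ⟨|Γ|, 0, abs_nonneg _, le_rfl, fun a b γ hγ => by
    rw [abs_of_nonneg hγ.1]
    simpa using hγ.2.trans (le_abs_self Γ)⟩⟩

lemma gaussAvg_congr {G H : ℝ → ℝ → ℝ → ℝ} {γ : ℝ} (h : ∀ a b, G a b γ = H a b γ) :
    gaussAvg G γ = gaussAvg H γ :=
  integral_congr_ae (Eventually.of_forall fun _ => h _ _)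

lemma gaussAvg_finsetSum (S : Finset ℂ) {G : ℂ → ℝ → ℝ → ℝ → ℝ} (hG : ∀ x ∈ S, Tame (G x)) {γ : ℝ}
    (hγ : 0 ≤ γ) : gaussAvg (fun a b γ => ∑ x ∈ S, G x a b γ) γ = ∑ x ∈ S, gaussAvg (G x) γ :=
  integral_finsetSum _ fun x hx => (hG x hx).integrable hγ

/-! ### Mutual information, MMSE and its derivative -/

/-- The mutual information, written as a Gaussian average. -/
noncomputable def avgInfo (S : Finset ℂ) (p : ℂ → ℝ) (γ : ℝ) : ℝ :=
  γ - gaussAvg (fun a b γ => lik S p a b γ * Real.log (lik S p a b γ)) γ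

/-- The minimum mean square error. -/
noncomputable def mmse (S : Finset ℂ) (p : ℂ → ℝ) (γ : ℝ) : ℝ :=
  1 - (gaussAvg (fun a b γ => lik S p a b γ * post S p (fun x => x.re) a b γ ^ 2) γ +
    gaussAvg (fun a b γ => lik S p a b γ * post S p (fun x => x.im) a b γ ^ 2) γ)

/-- The posterior covariance of `c` and `d`. -/
noncomputable def postCov (S : Finset ℂ) (p c d : ℂ → ℝ) (a b γ : ℝ) : ℝ :=
  post S p (fun x => c x * d x) a b γ - post S p c a b γ * post S p d a b γ

/-- Twice the average squared Frobenius norm of the posterior covariance matrix. -/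
noncomputable def covEnergy (S : Finset ℂ) (p : ℂ → ℝ) (γ : ℝ) : ℝ :=
  gaussAvg (fun a b γ => 2 * (lik S p a b γ *
    (postCov S p (fun x => x.re) (fun x => x.re) a b γ ^ 2 +
      postCov S p (fun x => x.im) (fun x => x.re) a b γ ^ 2))) γ +
  gaussAvg (fun a b γ => 2 * (lik S p a b γ *
    (postCov S p (fun x => x.re) (fun x => x.im) a b γ ^ 2 +
      postCov S p (fun x => x.im) (fun x => x.im) a b γ ^ 2))) γ

/-- Continuous functions that agree almost everywhere then agree everywhere, which yields strict
inequalities between averages. -/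
instance isOpenPosMeasure_complexGaussian : complexGaussian.IsOpenPosMeasure := by
  have h1 : (gaussianReal 0 (1 / 2)).IsOpenPosMeasure :=
    (gaussianReal_absolutelyContinuous' 0 (by norm_num)).isOpenPosMeasure
  rw [complexGaussian_eq_map_equiv]
  exact Complex.equivRealProdCLM.symm.continuous.isOpenPosMeasure_map
    Complex.equivRealProdCLM.symm.surjective

/-- The average of the information density. -/
lemma gaussAvg_infoDensity {P : Measure ℂ} [IsProbabilityMeasure P] {S : Finset ℂ}
    (hS : P ((S : Set ℂ)ᶜ) = 0) (hp : UnitInput S fun x => P.real {x}) {γ : ℝ} (hγ : 0 ≤ γ) :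
    scalarInfo P γ = gaussAvg (fun a b γ => ∑ x ∈ S, P.real {x} *
      (Real.exp (2 * (a * x.re + b * x.im) - γ * (x.re ^ 2 + x.im ^ 2)) *
        (2 * (a * x.re + b * x.im) - γ * (x.re ^ 2 + x.im ^ 2) -
          Real.log (lik S (fun x => P.real {x}) a b γ)))) γ := by
  set p : ℂ → ℝ := fun x => P.real {x}
  have htame : ∀ x : ℂ, Tame fun a b γ => 2 * (a * x.re + b * x.im) -
      γ * (x.re ^ 2 + x.im ^ 2) - Real.log (lik S p a b γ) := fun x =>
    ((((Tame.const 2).mul ((tame_fst.mul (Tame.const x.re)).add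
      (tame_snd.mul (Tame.const x.im)))).sub (tame_param.mul (Tame.const _))).sub hp.tame_log_lik)
  rw [gaussAvg_finsetSum S (fun x _ => (Tame.const _).mul ((tame_exp x).mul (htame x))) hγ,
    scalarInfo_eq_gainInfo hS, gainInfo, integral_prod _ (integrable_infoDensity hS _),
    integral_eq_sum_of_compl_null hS]
  refine Finset.sum_congr rfl fun x hx => ?_
  rw [gaussAvg_const_mul]
  congr 1
  have h := integral_exp_mul (fun z => 2 * (Real.sqrt γ * z.re * x.re + Real.sqrt γ * z.im * x.im) -
    γ * (x.re ^ 2 + x.im ^ 2) - Real.log (lik S p (Real.sqrt γ * z.re) (Real.sqrt γ * z.im) γ)) hγ x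
  refine Eq.trans ?_ h.symm
  refine integral_congr_ae (Eventually.of_forall fun z => ?_)
  have hs := Real.sq_sqrt hγ
  have hd : ∀ (x z : ℂ), shiftDensity ((Real.sqrt γ : ℂ) * x) z =
      Real.exp (2 * (Real.sqrt γ * z.re * x.re + Real.sqrt γ * z.im * x.im) -
        γ * (x.re ^ 2 + x.im ^ 2)) := by
    intro x z
    unfold shiftDensity
    simp only [Complex.mul_re, Complex.mul_im, Complex.ofReal_re, Complex.ofReal_im, zero_mul,
      sub_zero, add_zero]
    congr 1
    linear_combination (-(x.re ^ 2) - x.im ^ 2) * hs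
  have hm : ∀ z : ℂ, mixDensity P S (Real.sqrt γ : ℂ) z =
      lik S p (Real.sqrt γ * z.re) (Real.sqrt γ * z.im) γ := by
    intro z
    simp only [mixDensity, lik, hd]
    rfl
  simp only [infoDensity]
  rw [Real.log_div (shiftDensity_pos _ _).ne' (mixDensity_pos hS _ _).ne', hm, hd, Real.log_exp]

section

variable {S : Finset ℂ} {p : ℂ → ℝ}

lemma sum_exp_mul_sub_log_eq (a b γ : ℝ) :
    ∑ x ∈ S, p x * (Real.exp (2 * (a * x.re + b * x.im) - γ * (x.re ^ 2 + x.im ^ 2)) *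
        (2 * (a * x.re + b * x.im) - γ * (x.re ^ 2 + x.im ^ 2) - Real.log (lik S p a b γ))) =
      2 * (lik S (fun x => x.re * p x) a b γ * a) + 2 * (lik S (fun x => x.im * p x) a b γ * b) -
        γ * lik S (fun x => (x.re ^ 2 + x.im ^ 2) * p x) a b γ -
        lik S p a b γ * Real.log (lik S p a b γ) := by
  generalize Real.log (lik S p a b γ) = l
  simp only [lik, Finset.sum_mul, Finset.mul_sum]
  rw [← Finset.sum_add_distrib, ← Finset.sum_sub_distrib, ← Finset.sum_sub_distrib]
  exact Finset.sum_congr rfl fun x _ => by ring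

/-- The exponent 2⟨z, x⟩ - γ|x|² averages to 2γ - γ = γ because the power is one; the rest is the
average of L log L under the noise law. -/
lemma UnitInput.gaussAvg_infoDensity_eq (hp : UnitInput S p) {γ : ℝ} (hγ : 0 ≤ γ) :
    gaussAvg (fun a b γ => ∑ x ∈ S, p x *
      (Real.exp (2 * (a * x.re + b * x.im) - γ * (x.re ^ 2 + x.im ^ 2)) *
        (2 * (a * x.re + b * x.im) - γ * (x.re ^ 2 + x.im ^ 2) -
          Real.log (lik S p a b γ)))) γ = avgInfo S p γ := by
  rw [show gaussAvg _ γ = _ from gaussAvg_congr (H := fun a b γ =>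
    2 * (lik S (fun x => x.re * p x) a b γ * a) + 2 * (lik S (fun x => x.im * p x) a b γ * b) -
      γ * lik S (fun x => (x.re ^ 2 + x.im ^ 2) * p x) a b γ -
      lik S p a b γ * Real.log (lik S p a b γ)) fun a b => sum_exp_mul_sub_log_eq a b γ]
  have t1 := (Tame.const 2).mul ((tame_lik S fun x => x.re * p x).mul tame_fst)
  have t2 := (Tame.const 2).mul ((tame_lik S fun x => x.im * p x).mul tame_snd)
  have t3 := tame_param.mul (tame_lik S fun x => (x.re ^ 2 + x.im ^ 2) * p x)
  have t4 := (tame_lik S p).mul hp.tame_log_lik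
  rw [gaussAvg_sub ((t1.add t2).sub t3) t4 hγ, gaussAvg_sub (t1.add t2) t3 hγ,
    gaussAvg_add t1 t2 hγ, gaussAvg_const_mul, gaussAvg_const_mul, gaussAvg_lik_mul_fst _ _ hγ,
    gaussAvg_lik_mul_snd _ _ hγ]
  have h3 : gaussAvg (fun a b γ => γ * lik S (fun x => (x.re ^ 2 + x.im ^ 2) * p x) a b γ) γ =
      γ * gaussAvg (lik S (fun x => (x.re ^ 2 + x.im ^ 2) * p x)) γ := integral_const_mul _ _
  have hpow : ∑ x ∈ S, x.re * (x.re * p x) + ∑ x ∈ S, x.im * (x.im * p x) = 1 := by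
    rw [← hp.power, ← Finset.sum_add_distrib]
    exact Finset.sum_congr rfl fun x _ => by ring
  rw [h3, gaussAvg_lik _ _ hγ, hp.power, avgInfo]
  linear_combination 2 * γ * hpow

/-- The likelihood dominates its own `x` term, so the information density at `x` is at most log(1/p
x). The bound is the entropy of the input, independent of γ. -/
lemma UnitInput.avgInfo_le (hp : UnitInput S p) {γ : ℝ} (hγ : 0 ≤ γ) :
    avgInfo S p γ ≤ ∑ x ∈ S, p x * Real.log (1 / p x) := by
  have htame : Tame fun a b γ => ∑ x ∈ S, p x *
      (Real.exp (2 * (a * x.re + b * x.im) - γ * (x.re ^ 2 + x.im ^ 2)) *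
        (2 * (a * x.re + b * x.im) - γ * (x.re ^ 2 + x.im ^ 2) -
          Real.log (lik S p a b γ))) := by
    have t1 := (Tame.const 2).mul ((tame_lik S fun x => x.re * p x).mul tame_fst)
    have t2 := (Tame.const 2).mul ((tame_lik S fun x => x.im * p x).mul tame_snd)
    have t3 := tame_param.mul (tame_lik S fun x => (x.re ^ 2 + x.im ^ 2) * p x)
    have t4 := (tame_lik S p).mul hp.tame_log_lik
    simp_rw [sum_exp_mul_sub_log_eq]
    exact ((t1.add t2).sub t3).sub t4
  rw [← hp.gaussAvg_infoDensity_eq hγ,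
    ← gaussAvg_lik S (fun x => p x * Real.log (1 / p x)) hγ]
  refine gaussAvg_mono htame (tame_lik _ _) hγ fun a b => ?_
  refine Finset.sum_le_sum fun x hx => ?_
  have hpx := hp.pos x hx
  rw [mul_comm (Real.exp _), ← mul_assoc]
  refine mul_le_mul_of_nonneg_right (mul_le_mul_of_nonneg_left ?_ hpx.le) (Real.exp_pos _).le
  set e := 2 * (a * x.re + b * x.im) - γ * (x.re ^ 2 + x.im ^ 2)
  have hle : p x * Real.exp e ≤ lik S p a b γ :=
    Finset.single_le_sum (f := fun x => p x *
      Real.exp (2 * (a * x.re + b * x.im) - γ * (x.re ^ 2 + x.im ^ 2)))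
      (fun y hy => mul_nonneg (hp.pos y hy).le (Real.exp_pos _).le) hx
  have := Real.log_le_log (mul_pos hpx (Real.exp_pos e)) hle
  rw [Real.log_mul hpx.ne' (Real.exp_pos e).ne', Real.log_exp] at this
  rw [one_div, Real.log_inv]
  linarith

lemma UnitInput.lik_zero (hp : UnitInput S p) : lik S p 0 0 0 = 1 := by
  simp [lik, hp.sum_eq_one]

lemma UnitInput.avgInfo_zero (hp : UnitInput S p) : avgInfo S p 0 = 0 := by
  simp [avgInfo, gaussAvg, hp.lik_zero]

lemma UnitInput.mmse_zero (hp : UnitInput S p) : mmse S p 0 = 1 := by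
  have h1 : post S p (fun x => x.re) 0 0 0 = 0 := by
    simp [post, lik, hp.mean_re]
  have h2 : post S p (fun x => x.im) 0 0 0 = 0 := by
    simp [post, lik, hp.mean_im]
  simp [mmse, gaussAvg, h1, h2]

lemma UnitInput.tame_lik_mul_sq (hp : UnitInput S p) (c : ℂ → ℝ) :
    Tame fun a b γ => lik S p a b γ * post S p c a b γ ^ 2 :=
  (tame_lik S p).mul ((hp.tame_post c).pow 2)

lemma UnitInput.tame_postCov (hp : UnitInput S p) (c d : ℂ → ℝ) : Tame (postCov S p c d) :=
  (hp.tame_post _).sub ((hp.tame_post c).mul (hp.tame_post d))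

lemma UnitInput.continuousOn_avgInfo (hp : UnitInput S p) :
    ContinuousOn (avgInfo S p) (Ici 0) :=
  continuousOn_id.sub ((tame_lik S p).mul hp.tame_log_lik).continuousOn_gaussAvg

lemma UnitInput.continuousOn_mmse (hp : UnitInput S p) : ContinuousOn (mmse S p) (Ici 0) :=
  continuousOn_const.sub ((hp.tame_lik_mul_sq _).continuousOn_gaussAvg.add
    (hp.tame_lik_mul_sq _).continuousOn_gaussAvg)

lemma hasDerivAt_sqrt_mul {γ : ℝ} (hγ : 0 < γ) (u : ℝ) :
    HasDerivAt (fun γ => Real.sqrt γ * u) (1 / (2 * Real.sqrt γ) * u) γ :=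
  (Real.hasDerivAt_sqrt hγ.ne').mul_const u

lemma post_sq_split (c : ℂ → ℝ) (a b γ : ℝ) :
    post S p (fun x => (x.re ^ 2 + x.im ^ 2) * c x) a b γ =
      post S p (fun x => x.re * (x.re * c x)) a b γ +
        post S p (fun x => x.im * (x.im * c x)) a b γ := by
  rw [← UnitInput.post_add]
  congr 1
  funext x
  ring

/-- The derivative of the mutual information is the MMSE. -/
lemma UnitInput.hasDerivAt_avgInfo (hp : UnitInput S p) {γ : ℝ} (hγ : 0 < γ) :
    HasDerivAt (avgInfo S p) (mmse S p γ) γ := by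
  set L := lik S p with hL
  set E := post S p with hE
  have tL : Tame L := tame_lik S p
  have tlog : Tame fun a b γ => Real.log (L a b γ) + 1 := hp.tame_log_lik.add (Tame.const 1)
  have tE : ∀ c, Tame (E c) := hp.tame_post
  have hLpos : ∀ a b γ, L a b γ ≠ 0 := fun a b γ => (hp.lik_pos a b γ).ne'
  have hmain : ∀ {f g h : ℝ → ℝ} {f' g' h' t : ℝ}, HasDerivAt f f' t → HasDerivAt g g' t →
      HasDerivAt h h' t → HasDerivAt (fun t => L (f t) (g t) (h t) * Real.log (L (f t) (g t) (h t)))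
        (L (f t) (g t) (h t) * (2 * f' * E (fun x => x.re) (f t) (g t) (h t) +
          2 * g' * E (fun x => x.im) (f t) (g t) (h t) -
          h' * E (fun x => x.re ^ 2 + x.im ^ 2) (f t) (g t) (h t)) *
          (Real.log (L (f t) (g t) (h t)) + 1)) t := by
    intro f g h f' g' h' t hf hg hh
    have h1 := hp.hasDerivAt_lik' hf hg hh
    refine (h1.fun_mul (h1.log (hLpos _ _ _))).congr_deriv ?_
    have := hLpos (f t) (g t) (h t)
    simp only [← hL, ← hE]
    field_simp
  have hsec : ∀ (c : ℂ → ℝ) {f g h : ℝ → ℝ} {f' g' h' t : ℝ}, HasDerivAt f f' t →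
      HasDerivAt g g' t → HasDerivAt h h' t →
      HasDerivAt (fun t => L (f t) (g t) (h t) * (2 * E c (f t) (g t) (h t)) *
        (Real.log (L (f t) (g t) (h t)) + 1)) _ t := fun c f g h f' g' h' t hf hg hh =>
    ((hp.hasDerivAt_lik' hf hg hh).fun_mul ((hp.hasDerivAt_post c hf hg hh).const_mul 2)).fun_mul
      (((hp.hasDerivAt_lik' hf hg hh).log (hLpos _ _ _)).add_const 1)
  -- The likelihood L satisfies ∂_γ L + ΔL/4 = 0 and ∇L = 2L E[x]. Hence the heat operator sends L
  -- log L to |∇L|²/(4L) = L |E[x]|², whose average is 1 - mmse.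
  have h := hasDerivAt_gaussAvg
    (G := fun a b γ => L a b γ * Real.log (L a b γ))
    (Ga := fun a b γ => L a b γ * (2 * E (fun x => x.re) a b γ) * (Real.log (L a b γ) + 1))
    (Gb := fun a b γ => L a b γ * (2 * E (fun x => x.im) a b γ) * (Real.log (L a b γ) + 1))
    (Gg := fun a b γ => L a b γ * ((-1) * E (fun x => x.re ^ 2 + x.im ^ 2) a b γ) *
      (Real.log (L a b γ) + 1))
    (Gaa := fun a b γ => 4 * (L a b γ * (E (fun x => x.re * x.re) a b γ *
      (Real.log (L a b γ) + 1) + E (fun x => x.re) a b γ ^ 2)))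
    (Gbb := fun a b γ => 4 * (L a b γ * (E (fun x => x.im * x.im) a b γ *
      (Real.log (L a b γ) + 1) + E (fun x => x.im) a b γ ^ 2)))
    (tL.mul hp.tame_log_lik)
    ((tL.mul ((Tame.const 2).mul (tE _))).mul tlog)
    ((tL.mul ((Tame.const 2).mul (tE _))).mul tlog)
    ((tL.mul ((Tame.const (-1)).mul (tE _))).mul tlog)
    ((Tame.const 4).mul (tL.mul (((tE _).mul tlog).add ((tE _).pow 2))))
    ((Tame.const 4).mul (tL.mul (((tE _).mul tlog).add ((tE _).pow 2))))
    (fun u v γ hγ => by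
      refine (hmain (hasDerivAt_sqrt_mul hγ u) (hasDerivAt_sqrt_mul hγ v)
        (hasDerivAt_id γ)).congr_deriv ?_
      simp only [id]
      ring)
    (fun a b γ => by
      refine (hsec (fun x => x.re) (hasDerivAt_id a) (hasDerivAt_const a b)
        (hasDerivAt_const a γ)).congr_deriv ?_
      have := hLpos a b γ
      simp only [id, ← hL, ← hE]
      field_simp
      ring)
    (fun a b γ => by
      refine (hsec (fun x => x.im) (hasDerivAt_const b a) (hasDerivAt_id b)
        (hasDerivAt_const b γ)).congr_deriv ?_
      have := hLpos a b γ
      simp only [id, ← hL, ← hE]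
      field_simp
      ring) hγ
  refine ((hasDerivAt_id γ).fun_sub h).congr_deriv ?_
  rw [mmse, ← gaussAvg_add (hp.tame_lik_mul_sq _) (hp.tame_lik_mul_sq _) hγ.le]
  congr 1
  refine gaussAvg_congr fun a b => ?_
  have h2 : E (fun x => x.re ^ 2 + x.im ^ 2) a b γ = E (fun x => x.re * x.re) a b γ +
      E (fun x => x.im * x.im) a b γ := by
    rw [hE, ← UnitInput.post_add]
    congr 1
    funext x
    ring
  rw [h2]
  ring

/-- The function is N²/L, where N = L E[c] and L both solve the backward heat equation. The heat
operator then leaves only (L/2)|∇(N/L)|², and the gradient of a posterior mean is twice its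
posterior covariance with x. -/
lemma UnitInput.hasDerivAt_gaussAvg_sq (hp : UnitInput S p) (c : ℂ → ℝ) {γ : ℝ} (hγ : 0 < γ) :
    HasDerivAt (gaussAvg fun a b γ => lik S p a b γ * post S p c a b γ ^ 2)
      (gaussAvg (fun a b γ => 2 * (lik S p a b γ * (postCov S p (fun x => x.re) c a b γ ^ 2 +
        postCov S p (fun x => x.im) c a b γ ^ 2))) γ) γ := by
  set L := lik S p with hL
  set E := post S p with hE
  have tL : Tame L := tame_lik S p
  have tE : ∀ c, Tame (E c) := hp.tame_post
  have hmain : ∀ {f g h : ℝ → ℝ} {f' g' h' t : ℝ}, HasDerivAt f f' t → HasDerivAt g g' t →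
      HasDerivAt h h' t → HasDerivAt (fun t => L (f t) (g t) (h t) * E c (f t) (g t) (h t) ^ 2)
        _ t := fun hf hg hh =>
    (hp.hasDerivAt_lik' hf hg hh).fun_mul ((hp.hasDerivAt_post c hf hg hh).fun_pow 2)
  have hsec : ∀ (d : ℂ → ℝ) {f g h : ℝ → ℝ} {f' g' h' t : ℝ}, HasDerivAt f f' t →
      HasDerivAt g g' t → HasDerivAt h h' t →
      HasDerivAt (fun t => L (f t) (g t) (h t) * (4 * (E c (f t) (g t) (h t) *
        E (fun x => d x * c x) (f t) (g t) (h t)) -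
        2 * (E d (f t) (g t) (h t) * E c (f t) (g t) (h t) ^ 2))) _ t :=
    fun d f g h f' g' h' t hf hg hh =>
    (hp.hasDerivAt_lik' hf hg hh).fun_mul ((((hp.hasDerivAt_post c hf hg hh).fun_mul
      (hp.hasDerivAt_post (fun x => d x * c x) hf hg hh)).const_mul 4).fun_sub
      (((hp.hasDerivAt_post d hf hg hh).fun_mul
      ((hp.hasDerivAt_post c hf hg hh).fun_pow 2)).const_mul 2))
  have tfirst : ∀ d, Tame fun a b γ => L a b γ * (4 * (E c a b γ * E (fun x => d x * c x) a b γ) -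
      2 * (E d a b γ * E c a b γ ^ 2)) := fun d =>
    tL.mul (((Tame.const 4).mul ((tE _).mul (tE _))).sub
      ((Tame.const 2).mul ((tE _).mul ((tE _).pow 2))))
  set D : (ℂ → ℝ) → ℝ → ℝ → ℝ → ℝ := fun d a b γ =>
    4 * (L a b γ * (2 * (E (fun x => d x * c x) a b γ - E d a b γ * E c a b γ) ^ 2 +
      2 * (E c a b γ * E (fun x => d x * (d x * c x)) a b γ) -
      E (fun x => d x * d x) a b γ * E c a b γ ^ 2)) with hD
  have tD : ∀ d, Tame (D d) := fun d =>
    (Tame.const 4).mul (tL.mul ((((Tame.const 2).mul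
      (((tE _).sub ((tE _).mul (tE _))).pow 2)).add ((Tame.const 2).mul ((tE _).mul (tE _)))).sub
      ((tE _).mul ((tE _).pow 2))))
  have h := hasDerivAt_gaussAvg
    (G := fun a b γ => L a b γ * E c a b γ ^ 2)
    (Ga := fun a b γ => L a b γ * (4 * (E c a b γ * E (fun x => x.re * c x) a b γ) -
      2 * (E (fun x => x.re) a b γ * E c a b γ ^ 2)))
    (Gb := fun a b γ => L a b γ * (4 * (E c a b γ * E (fun x => x.im * c x) a b γ) -
      2 * (E (fun x => x.im) a b γ * E c a b γ ^ 2)))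
    (Gg := fun a b γ => L a b γ * (E (fun x => x.re ^ 2 + x.im ^ 2) a b γ * E c a b γ ^ 2 -
      2 * (E c a b γ * E (fun x => (x.re ^ 2 + x.im ^ 2) * c x) a b γ)))
    (Gaa := D fun x => x.re) (Gbb := D fun x => x.im)
    (hp.tame_lik_mul_sq c) (tfirst _) (tfirst _)
    (tL.mul (((tE _).mul ((tE _).pow 2)).sub ((Tame.const 2).mul ((tE _).mul (tE _)))))
    (tD _) (tD _)
    (fun u v γ hγ => by
      refine (hmain (hasDerivAt_sqrt_mul hγ u) (hasDerivAt_sqrt_mul hγ v)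
        (hasDerivAt_id γ)).congr_deriv ?_
      simp only [id, ← hL, ← hE]
      push_cast
      ring)
    (fun a b γ => by
      refine (hsec (fun x => x.re) (hasDerivAt_id a) (hasDerivAt_const a b)
        (hasDerivAt_const a γ)).congr_deriv ?_
      simp only [id, ← hL, ← hE, hD]
      push_cast
      ring)
    (fun a b γ => by
      refine (hsec (fun x => x.im) (hasDerivAt_const b a) (hasDerivAt_id b)
        (hasDerivAt_const b γ)).congr_deriv ?_
      simp only [id, ← hL, ← hE, hD]
      push_cast
      ring) hγ
  refine h.congr_deriv (gaussAvg_congr fun a b => ?_)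
  have h2 : E (fun x => x.re ^ 2 + x.im ^ 2) a b γ = E (fun x => x.re * x.re) a b γ +
      E (fun x => x.im * x.im) a b γ := by
    rw [hE, ← UnitInput.post_add]
    congr 1
    funext x
    ring
  have h3 := post_sq_split (S := S) (p := p) c a b γ
  simp only [hD, postCov, ← hE] at h3 ⊢
  rw [h2, h3]
  ring

lemma UnitInput.hasDerivAt_mmse (hp : UnitInput S p) {γ : ℝ} (hγ : 0 < γ) :
    HasDerivAt (mmse S p) (-covEnergy S p γ) γ := by
  have h := ((hp.hasDerivAt_gaussAvg_sq (fun x => x.re) hγ).fun_add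
    (hp.hasDerivAt_gaussAvg_sq (fun x => x.im) hγ)).const_sub 1
  exact h

end

/-! ### Posterior variance, bounds on the MMSE, and comparison with the linear-Gaussian model. -/

lemma sum_mul_sum_sq_sub_sq (S : Finset ℂ) (w c : ℂ → ℝ) :
    (∑ x ∈ S, w x) * (∑ x ∈ S, c x * c x * w x) - (∑ x ∈ S, c x * w x) ^ 2 =
      1 / 2 * ∑ x ∈ S, ∑ y ∈ S, w x * w y * (c x - c y) ^ 2 := by
  have h1 : ∀ f g : ℂ → ℝ, (∑ x ∈ S, f x) * (∑ y ∈ S, g y) = ∑ x ∈ S, ∑ y ∈ S, f x * g y :=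
    fun f g => Finset.sum_mul_sum _ _ _ _
  have h2 : ∑ x ∈ S, ∑ y ∈ S, w x * w y * (c x - c y) ^ 2 =
      ∑ x ∈ S, ∑ y ∈ S, w x * (c y * c y * w y) + ∑ x ∈ S, ∑ y ∈ S, (c x * c x * w x) * w y -
        2 * ∑ x ∈ S, ∑ y ∈ S, (c x * w x) * (c y * w y) := by
    rw [Finset.mul_sum, ← Finset.sum_add_distrib, ← Finset.sum_sub_distrib]
    refine Finset.sum_congr rfl fun x _ => ?_
    rw [Finset.mul_sum, ← Finset.sum_add_distrib, ← Finset.sum_sub_distrib]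
    exact Finset.sum_congr rfl fun y _ => by ring
  rw [h2, ← h1, ← h1, ← h1]
  ring

/-- The posterior variance. -/
noncomputable def postVar (S : Finset ℂ) (p : ℂ → ℝ) (a b γ : ℝ) : ℝ :=
  postCov S p (fun x => x.re) (fun x => x.re) a b γ +
    postCov S p (fun x => x.im) (fun x => x.im) a b γ

/-- The weight of the symbol `x` in the likelihood. -/
noncomputable def likTerm (p : ℂ → ℝ) (x : ℂ) (a b γ : ℝ) : ℝ :=
  p x * Real.exp (2 * (a * x.re + b * x.im) - γ * (x.re ^ 2 + x.im ^ 2))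

namespace UnitInput

variable {S : Finset ℂ} {p : ℂ → ℝ}

lemma lik_sq_mul_postCov (hp : UnitInput S p) (c : ℂ → ℝ) (a b γ : ℝ) :
    lik S p a b γ ^ 2 * postCov S p c c a b γ =
      1 / 2 * ∑ x ∈ S, ∑ y ∈ S, likTerm p x a b γ * likTerm p y a b γ * (c x - c y) ^ 2 := by
  have hL := (hp.lik_pos a b γ).ne'
  rw [← sum_mul_sum_sq_sub_sq]
  have h1 : ∑ x ∈ S, likTerm p x a b γ = lik S p a b γ := rfl
  have h2 : ∑ x ∈ S, c x * c x * likTerm p x a b γ = lik S (fun x => c x * c x * p x) a b γ :=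
    Finset.sum_congr rfl fun x _ => by simp only [likTerm]; ring
  have h3 : ∑ x ∈ S, c x * likTerm p x a b γ = lik S (fun x => c x * p x) a b γ :=
    Finset.sum_congr rfl fun x _ => by simp only [likTerm]; ring
  rw [h1, h2, h3, hp.lik_mul_eq (fun x => c x * c x), hp.lik_mul_eq c, postCov]
  ring

lemma lik_sq_mul_postVar (hp : UnitInput S p) (a b γ : ℝ) :
    lik S p a b γ ^ 2 * postVar S p a b γ =
      1 / 2 * ∑ x ∈ S, ∑ y ∈ S, likTerm p x a b γ * likTerm p y a b γ *
        ((x.re - y.re) ^ 2 + (x.im - y.im) ^ 2) := by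
  rw [postVar, mul_add, hp.lik_sq_mul_postCov (fun x => x.re), hp.lik_sq_mul_postCov (fun x =>
      x.im),
    ← mul_add, ← Finset.sum_add_distrib]
  congr 1
  refine Finset.sum_congr rfl fun x _ => ?_
  rw [← Finset.sum_add_distrib]
  exact Finset.sum_congr rfl fun y _ => by ring

lemma likTerm_pos (hp : UnitInput S p) {x : ℂ} (hx : x ∈ S) (a b γ : ℝ) :
    0 < likTerm p x a b γ := mul_pos (hp.pos x hx) (Real.exp_pos _)

/-- The posterior variance is half a double sum over pairs with nonnegative terms. Keeping only (x,
y) and (y, x) absorbs the factor 1/2. -/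
lemma mul_likTerm_le_lik_sq_mul_postVar (hp : UnitInput S p) {x y : ℂ} (hx : x ∈ S) (hy : y ∈ S)
    (hxy : x ≠ y) (a b γ : ℝ) :
    likTerm p x a b γ * likTerm p y a b γ * ((x.re - y.re) ^ 2 + (x.im - y.im) ^ 2) ≤
      lik S p a b γ ^ 2 * postVar S p a b γ := by
  rw [hp.lik_sq_mul_postVar]
  set F : ℂ → ℂ → ℝ := fun x y => likTerm p x a b γ * likTerm p y a b γ *
    ((x.re - y.re) ^ 2 + (x.im - y.im) ^ 2)
  have hF : ∀ u ∈ S, ∀ v ∈ S, 0 ≤ F u v := fun u hu v hv =>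
    mul_nonneg (mul_nonneg (hp.likTerm_pos hu _ _ _).le (hp.likTerm_pos hv _ _ _).le) (by
        positivity)
  have h1 : F x y + F y x ≤ ∑ u ∈ S, ∑ v ∈ S, F u v := by
    calc F x y + F y x ≤ ∑ v ∈ S, F x v + ∑ v ∈ S, F y v := add_le_add
          (Finset.single_le_sum (f := F x) (hF x hx) hy)
          (Finset.single_le_sum (f := F y) (hF y hy) hx)
      _ = ∑ u ∈ {x, y}, ∑ v ∈ S, F u v := 
          (Finset.sum_pair (f := fun u => ∑ v ∈ S, F u v) hxy).symm
      _ ≤ _ := Finset.sum_le_sum_of_subset_of_nonneg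
          (by intro u hu; simp only [Finset.mem_insert, Finset.mem_singleton] at hu
              rcases hu with rfl | rfl <;> assumption)
          (fun u hu _ => Finset.sum_nonneg (hF u hu))
  have h2 : F y x = F x y := by simp only [F]; ring
  linarith

/-- A single symbol with zero mean would be 0 and could not have unit power. -/
lemma exists_ne (hp : UnitInput S p) : ∃ x ∈ S, ∃ y ∈ S, x ≠ y := by
  by_contra! hcon
  obtain ⟨x₀, hx₀⟩ := hp.nonempty
  have hall : ∀ x ∈ S, x = x₀ := fun x hx => hcon x hx x₀ hx₀
  have hconst : ∀ f : ℂ → ℝ, ∑ x ∈ S, f x * p x = f x₀ := by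
    intro f
    rw [Finset.sum_congr rfl fun x hx => by rw [hall x hx, ← hall x hx], ← one_mul (f x₀),
      ← hp.sum_eq_one, Finset.sum_mul]
    exact Finset.sum_congr rfl fun x hx => by rw [hall x hx]; ring
  have h1 := hp.mean_re
  have h2 := hp.mean_im
  have h3 := hp.power
  rw [hconst] at h1 h2 h3
  rw [h1, h2] at h3
  norm_num at h3

lemma postVar_pos (hp : UnitInput S p) (a b γ : ℝ) : 0 < postVar S p a b γ := by
  obtain ⟨x, hx, y, hy, hxy⟩ := hp.exists_ne
  have h := hp.mul_likTerm_le_lik_sq_mul_postVar hx hy hxy a b γ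
  have hd : 0 < (x.re - y.re) ^ 2 + (x.im - y.im) ^ 2 := by
    by_contra! hcon
    have h1 : (x.re - y.re) ^ 2 = 0 := by nlinarith [sq_nonneg (x.re - y.re), sq_nonneg (x.im -
        y.im)]
    have h2 : (x.im - y.im) ^ 2 = 0 := by nlinarith [sq_nonneg (x.re - y.re), sq_nonneg (x.im -
        y.im)]
    exact hxy (Complex.ext (by nlinarith) (by nlinarith))
  have h2 := mul_pos (mul_pos (hp.likTerm_pos hx a b γ) (hp.likTerm_pos hy a b γ)) hd
  exact pos_of_mul_pos_right (h2.trans_le h) (sq_nonneg _)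

lemma tame_postVar (hp : UnitInput S p) : Tame (postVar S p) :=
  (hp.tame_postCov _ _).add (hp.tame_postCov _ _)

/-- Unit power equals the mean posterior second moment; subtracting the squared posterior mean
leaves the posterior variance. -/
lemma mmse_eq (hp : UnitInput S p) {γ : ℝ} (hγ : 0 ≤ γ) :
    mmse S p γ = gaussAvg (fun a b γ => lik S p a b γ * postVar S p a b γ) γ := by
  have h1 : gaussAvg (lik S fun x => (x.re ^ 2 + x.im ^ 2) * p x) γ = 1 := by
    rw [gaussAvg_lik _ _ hγ, hp.power]
  rw [mmse, ← h1, ← gaussAvg_add (hp.tame_lik_mul_sq _) (hp.tame_lik_mul_sq _) hγ,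
    ← gaussAvg_sub (tame_lik _ _) ((hp.tame_lik_mul_sq _).add (hp.tame_lik_mul_sq _)) hγ]
  refine gaussAvg_congr fun a b => ?_
  have h2 : post S p (fun x => x.re ^ 2 + x.im ^ 2) a b γ =
      post S p (fun x => x.re * x.re) a b γ + post S p (fun x => x.im * x.im) a b γ := by
    rw [← post_add]
    congr 1
    funext x
    ring
  rw [hp.lik_mul_eq (fun x => x.re ^ 2 + x.im ^ 2), h2, postVar, postCov, postCov]
  ring

/-- If the average of a nonnegative continuous function vanished, the function would vanish
everywhere, since the noise law charges every open set. -/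
lemma gaussAvg_pos {G : ℝ → ℝ → ℝ → ℝ} (hG : Tame G) {γ : ℝ} (hγ : 0 ≤ γ)
    (h : ∀ a b, 0 ≤ G a b γ) {u v : ℝ} (huv : 0 < G (Real.sqrt γ * u) (Real.sqrt γ * v) γ) :
    0 < gaussAvg G γ := by
  have h0 : 0 ≤ gaussAvg G γ := integral_nonneg fun z => h _ _
  refine lt_of_le_of_ne h0 fun heq => ?_
  have hae : (fun z : ℂ => G (Real.sqrt γ * z.re) (Real.sqrt γ * z.im) γ) =ᵐ[complexGaussian]
      fun _ => (0 : ℝ) := (integral_eq_zero_iff_of_nonneg (fun z => h _ _) (hG.integrable hγ)).1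
          heq.symm
  have hall := (Continuous.ae_eq_iff_eq complexGaussian (hG.continuous_comp (Real.sqrt γ) γ)
    continuous_const).1 hae
  have h1 : G (Real.sqrt γ * u) (Real.sqrt γ * v) γ = 0 := congrFun hall ⟨u, v⟩
  linarith

lemma mmse_pos (hp : UnitInput S p) {γ : ℝ} (hγ : 0 ≤ γ) : 0 < mmse S p γ := by
  rw [hp.mmse_eq hγ]
  exact gaussAvg_pos ((tame_lik S p).mul hp.tame_postVar) hγ
    (fun a b => (mul_pos (hp.lik_pos _ _ _) (hp.postVar_pos _ _ _)).le) (u := 0) (v := 0)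
    (mul_pos (hp.lik_pos _ _ _) (hp.postVar_pos _ _ _))

lemma tame_linear_error (hp : UnitInput S p) (κ : ℝ) : Tame fun a b γ => lik S p a b γ *
      ((post S p (fun x => x.re) a b γ - κ * a) ^ 2 +
        (post S p (fun x => x.im) a b γ - κ * b) ^ 2) :=
  (tame_lik S p).mul ((((hp.tame_post _).sub ((Tame.const κ).mul tame_fst)).pow 2).add
    (((hp.tame_post _).sub ((Tame.const κ).mul tame_snd)).pow 2))

/-- The distance of the conditional mean from the best linear estimate. -/
lemma gaussAvg_linear_error (hp : UnitInput S p) {γ : ℝ} (hγ : 0 ≤ γ) :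
    gaussAvg (fun a b γ' => lik S p a b γ' *
      ((post S p (fun x => x.re) a b γ' - (1 / (1 + γ)) * a) ^ 2 +
        (post S p (fun x => x.im) a b γ' - (1 / (1 + γ)) * b) ^ 2)) γ =
      1 / (1 + γ) - mmse S p γ := by
  -- In the coordinates (a, b) = √γ y, with y the channel output, the best linear estimate √γ y/(1 +
  -- γ) is κ (a, b).
  set κ := 1 / (1 + γ) with hκ
  have t1 := (hp.tame_lik_mul_sq fun x => x.re).add (hp.tame_lik_mul_sq fun x => x.im)
  have t2 := (Tame.const (2 * κ)).mul (((tame_lik S fun x => x.re * p x).mul tame_fst).add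
    ((tame_lik S fun x => x.im * p x).mul tame_snd))
  have t3 := (Tame.const (κ ^ 2)).mul ((tame_lik S p).mul ((tame_fst.pow 2).add (tame_snd.pow 2)))
  have h : gaussAvg (fun a b γ' => lik S p a b γ' *
      ((post S p (fun x => x.re) a b γ' - κ * a) ^ 2 +
        (post S p (fun x => x.im) a b γ' - κ * b) ^ 2)) γ = gaussAvg (fun a b γ =>
      (lik S p a b γ * post S p (fun x => x.re) a b γ ^ 2 +
        lik S p a b γ * post S p (fun x => x.im) a b γ ^ 2) -
      2 * κ * (lik S (fun x => x.re * p x) a b γ * a + lik S (fun x => x.im * p x) a b γ * b) +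
      κ ^ 2 * (lik S p a b γ * (a ^ 2 + b ^ 2))) γ := by
    refine gaussAvg_congr fun a b => ?_
    rw [hp.lik_mul_eq (fun x => x.re), hp.lik_mul_eq (fun x => x.im)]
    ring
  have hpow : ∑ x ∈ S, x.re * (x.re * p x) + ∑ x ∈ S, x.im * (x.im * p x) = 1 := by
    rw [← hp.power, ← Finset.sum_add_distrib]
    exact Finset.sum_congr rfl fun x _ => by ring
  have hpow2 : ∑ x ∈ S, (1 + γ * (x.re ^ 2 + x.im ^ 2)) * p x = 1 + γ := by
    calc _ = ∑ x ∈ S, p x + γ * ∑ x ∈ S, (x.re ^ 2 + x.im ^ 2) * p x := by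
          rw [Finset.mul_sum, ← Finset.sum_add_distrib]
          exact Finset.sum_congr rfl fun x _ => by ring
      _ = _ := by rw [hp.sum_eq_one, hp.power, mul_one]
  rw [h, gaussAvg_add (t1.sub t2) t3 hγ, gaussAvg_sub t1 t2 hγ,
    gaussAvg_add (hp.tame_lik_mul_sq _) (hp.tame_lik_mul_sq _) hγ, gaussAvg_const_mul,
    gaussAvg_const_mul, gaussAvg_add ((tame_lik _ _).mul tame_fst) ((tame_lik _ _).mul tame_snd) hγ,
    gaussAvg_lik_mul_fst _ _ hγ, gaussAvg_lik_mul_snd _ _ hγ, gaussAvg_lik_mul_sq_add_sq _ _ hγ,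
    hpow2, mmse]
  have hκγ : κ * (1 + γ) = 1 := by rw [hκ]; field_simp
  linear_combination (-2 * κ * γ) * hpow + (κ * γ - 1) * hκγ

/-- Equality would force the conditional mean to coincide with the linear estimate, but the former
is bounded, having finitely many symbols, and the latter is not. -/
lemma one_add_mul_mmse_lt_one (hp : UnitInput S p) {γ : ℝ} (hγ : 0 < γ) :
    (1 + γ) * mmse S p γ < 1 := by
  have hs : 0 < Real.sqrt γ := Real.sqrt_pos.2 hγ
  have hκ : 0 < 1 / (1 + γ) := by positivity
  set K := ∑ x ∈ S, |x.re|
  have hK : ∀ a b, post S p (fun x => x.re) a b γ ≤ K := fun a b =>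
    (le_abs_self _).trans (hp.abs_post_le (fun x hx => Finset.single_le_sum (f := fun x => |x.re|)
      (fun _ _ => abs_nonneg _) hx) a b γ)
  have h := gaussAvg_pos (hp.tame_linear_error (1 / (1 + γ))) hγ.le
    (fun a b => mul_nonneg (hp.lik_pos _ _ _).le (by positivity))
    -- At this point the linear estimate equals K + 1, beyond the bound K on the posterior mean.
    (u := (K + 1) * (1 + γ) / Real.sqrt γ) (v := 0) (by
      refine mul_pos (hp.lik_pos _ _ _) (add_pos_of_pos_of_nonneg (sq_pos_of_neg ?_) (sq_nonneg _))
      have h1 : 1 / (1 + γ) * (Real.sqrt γ * ((K + 1) * (1 + γ) / Real.sqrt γ)) = K + 1 := by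
        field_simp
      rw [h1]
      linarith [hK (Real.sqrt γ * ((K + 1) * (1 + γ) / Real.sqrt γ)) (Real.sqrt γ * 0)])
  rw [hp.gaussAvg_linear_error hγ.le] at h
  have h2 : mmse S p γ < 1 / (1 + γ) := by linarith
  rw [lt_div_iff₀ (by positivity)] at h2
  linarith

/-- The defect in the second-order condition, in terms of the distance of the posterior covariance
from its linear-Gaussian value. -/
lemma covEnergy_eq (hp : UnitInput S p) {γ : ℝ} (hγ : 0 ≤ γ) (κ : ℝ) :
    covEnergy S p γ = 2 * gaussAvg (fun a b γ => lik S p a b γ *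
      ((postCov S p (fun x => x.re) (fun x => x.re) a b γ - κ / 2) ^ 2 +
        2 * postCov S p (fun x => x.re) (fun x => x.im) a b γ ^ 2 +
        (postCov S p (fun x => x.im) (fun x => x.im) a b γ - κ / 2) ^ 2)) γ +
      2 * κ * mmse S p γ - κ ^ 2 := by
  have hsymm : ∀ a b γ, postCov S p (fun x => x.im) (fun x => x.re) a b γ =
      postCov S p (fun x => x.re) (fun x => x.im) a b γ := fun a b γ => by
    simp only [postCov, mul_comm]
  have t0 : Tame fun a b γ => lik S p a b γ *
      ((postCov S p (fun x => x.re) (fun x => x.re) a b γ - κ / 2) ^ 2 +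
        2 * postCov S p (fun x => x.re) (fun x => x.im) a b γ ^ 2 +
        (postCov S p (fun x => x.im) (fun x => x.im) a b γ - κ / 2) ^ 2) :=
    (tame_lik S p).mul (((((hp.tame_postCov _ _).sub (Tame.const _)).pow 2).add
      ((Tame.const 2).mul ((hp.tame_postCov _ _).pow 2))).add
      (((hp.tame_postCov _ _).sub (Tame.const _)).pow 2))
  have t1 : ∀ c d e f : ℂ → ℝ, Tame fun a b γ => 2 * (lik S p a b γ *
      (postCov S p c d a b γ ^ 2 + postCov S p e f a b γ ^ 2)) := fun c d e f =>
    (Tame.const 2).mul ((tame_lik S p).mul (((hp.tame_postCov _ _).pow 2).add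
      ((hp.tame_postCov _ _).pow 2)))
  have h1 : gaussAvg (lik S p) γ = 1 := by rw [gaussAvg_lik _ _ hγ, hp.sum_eq_one]
  rw [hp.mmse_eq hγ, covEnergy, ← gaussAvg_add (t1 _ _ _ _) (t1 _ _ _ _) hγ, ← gaussAvg_const_mul,
    ← gaussAvg_const_mul, ← mul_one (κ ^ 2), ← h1, ← gaussAvg_const_mul,
    ← gaussAvg_add ((Tame.const 2).mul t0)
      ((Tame.const (2 * κ)).mul ((tame_lik S p).mul hp.tame_postVar)) hγ,
    ← gaussAvg_sub (((Tame.const 2).mul t0).add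
      ((Tame.const (2 * κ)).mul ((tame_lik S p).mul hp.tame_postVar)))
      ((Tame.const (κ ^ 2)).mul (tame_lik S p)) hγ]
  refine gaussAvg_congr fun a b => ?_
  rw [hsymm, postVar]
  ring

end UnitInput

/-! ### A Poincaré inequality for the channel output, and concavity at low SNR -/

lemma sq_intervalIntegral_le {f : ℝ → ℝ} (hf : Continuous f) {T : ℝ} (hT : 0 < T) :
    (∫ t in (0 : ℝ)..T, f t) ^ 2 ≤ T * ∫ t in (0 : ℝ)..T, f t ^ 2 := by
  set D := ∫ t in (0 : ℝ)..T, f t with hD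
  have h0 : 0 ≤ ∫ t in (0 : ℝ)..T, (f t - D / T) ^ 2 :=
    intervalIntegral.integral_nonneg hT.le fun t _ => sq_nonneg _
  have h1 : ∫ t in (0 : ℝ)..T, (f t - D / T) ^ 2 =
      (∫ t in (0 : ℝ)..T, f t ^ 2) - 2 * (D / T) * D + T * (D / T) ^ 2 := by
    have he : ∀ t, (f t - D / T) ^ 2 = f t ^ 2 - 2 * (D / T) * f t + (D / T) ^ 2 :=
      fun t => by ring
    simp_rw [he]
    rw [intervalIntegral.integral_add
      (Continuous.intervalIntegrable (by fun_prop) _ _) (by simp),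
      intervalIntegral.integral_sub (Continuous.intervalIntegrable (by fun_prop) _ _)
        (Continuous.intervalIntegrable (by fun_prop) _ _), intervalIntegral.integral_const_mul,
      intervalIntegral.integral_const, ← hD]
    simp
  rw [h1] at h0
  have h2 : T * ((∫ t in (0 : ℝ)..T, f t ^ 2) - 2 * (D / T) * D + T * (D / T) ^ 2) =
      T * (∫ t in (0 : ℝ)..T, f t ^ 2) - D ^ 2 := by
    field_simp
    ring
  have := mul_nonneg hT.le h0
  linarith

lemma Tame.integrable_shift {G : ℝ → ℝ → ℝ → ℝ} (hG : Tame G) {γ : ℝ} (hγ : 0 ≤ γ) (x : ℂ) :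
    Integrable (fun z : ℂ => G (Real.sqrt γ * (Real.sqrt γ * x.re + z.re))
      (Real.sqrt γ * (Real.sqrt γ * x.im + z.im)) γ) complexGaussian := by
  obtain ⟨C, k, hC, hk, h⟩ := hG.exists_bound γ
  refine integrable_of_abs_le_exp
    (C := C * Real.exp (k * (|Real.sqrt γ * x.re| + |Real.sqrt γ * x.im|))) (k := k)
    (hG.cont.comp (by fun_prop : Continuous fun z : ℂ => (Real.sqrt γ * (Real.sqrt γ * x.re + z.re),
      Real.sqrt γ * (Real.sqrt γ * x.im + z.im), γ))) fun z => ?_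
  refine (h γ ⟨hγ, le_rfl⟩ _ _).trans ?_
  rw [mul_assoc, ← Real.exp_add, ← mul_add]
  refine mul_le_mul_of_nonneg_left (Real.exp_le_exp.2 (mul_le_mul_of_nonneg_left ?_ hk)) hC
  linarith [abs_add_le (Real.sqrt γ * x.re) z.re, abs_add_le (Real.sqrt γ * x.im) z.im]

lemma integral_norm_sq_add (w : ℂ) :
    ∫ v : ℂ, ((w.re + v.re) ^ 2 + (w.im + v.im) ^ 2) ∂complexGaussian =
      w.re ^ 2 + w.im ^ 2 + 1 := by
  have h := gaussAvg_lik_mul {w} (fun _ => 1) ((tame_fst.pow 2).add (tame_snd.pow 2))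
    (zero_le_one' ℝ)
  rw [gaussAvg_lik_mul_sq_add_sq _ _ zero_le_one] at h
  simp only [Finset.sum_singleton, Real.sqrt_one, one_mul, mul_one] at h
  rw [← h]
  ring

lemma integrable_norm_sq_add (w : ℂ) :
    Integrable (fun v : ℂ => (w.re + v.re) ^ 2 + (w.im + v.im) ^ 2) complexGaussian := by
  have h := ((tame_fst.pow 2).add (tame_snd.pow 2)).integrable_shift zero_le_one w
  simpa using h

lemma complexGaussian_prod_map_rotation (t : ℝ) :
    (complexGaussian.prod complexGaussian).map (ContinuousLinearMap.rotation t) =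
      complexGaussian.prod complexGaussian :=
  IsGaussian.map_rotation_eq_self (by simpa using integral_id_complexGaussian) t

section

variable {S : Finset ℂ} {p : ℂ → ℝ}

/-- For two independent channel outputs, the mean squared difference of `h` is twice its variance,
and `h` is centred. -/
lemma UnitInput.sum_sum_integral_sub_sq (hp : UnitInput S p) {γ : ℝ} (hγ : 0 ≤ γ)
    {h : ℝ → ℝ → ℝ} (th : Tame fun a b _ => h a b)
    (hmean : gaussAvg (fun a b γ => lik S p a b γ * h a b) γ = 0) :
    ∑ x ∈ S, p x * ∑ y ∈ S, p y * ∫ ω : ℂ × ℂ,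
      (h (Real.sqrt γ * (Real.sqrt γ * y.re + ω.2.re))
          (Real.sqrt γ * (Real.sqrt γ * y.im + ω.2.im)) -
        h (Real.sqrt γ * (Real.sqrt γ * x.re + ω.1.re))
          (Real.sqrt γ * (Real.sqrt γ * x.im + ω.1.im))) ^ 2
        ∂(complexGaussian.prod complexGaussian) =
      2 * gaussAvg (fun a b γ => lik S p a b γ * h a b ^ 2) γ := by
  set A : ℂ → ℂ → ℝ := fun x z => h (Real.sqrt γ * (Real.sqrt γ * x.re + z.re))
    (Real.sqrt γ * (Real.sqrt γ * x.im + z.im))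
  have i1 : ∀ x, Integrable (A x) complexGaussian := fun x => th.integrable_shift hγ x
  have i2 : ∀ x, Integrable (fun z => A x z ^ 2) complexGaussian :=
    fun x => (th.pow 2).integrable_shift hγ x
  have hm : ∑ x ∈ S, p x * ∫ z, A x z ∂complexGaussian = 0 := by
    rw [← hmean, gaussAvg_lik_mul S p th hγ]
  have hs : gaussAvg (fun a b γ => lik S p a b γ * h a b ^ 2) γ =
      ∑ x ∈ S, p x * ∫ z, A x z ^ 2 ∂complexGaussian :=
    gaussAvg_lik_mul S p (th.pow 2) hγ
  have hxy : ∀ x y, ∫ ω : ℂ × ℂ, (A y ω.2 - A x ω.1) ^ 2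
      ∂(complexGaussian.prod complexGaussian) =
      ∫ z, A y z ^ 2 ∂complexGaussian + ∫ z, A x z ^ 2 ∂complexGaussian -
        2 * ((∫ z, A x z ∂complexGaussian) * ∫ z, A y z ∂complexGaussian) := by
    intro x y
    have he : ∀ ω : ℂ × ℂ, (A y ω.2 - A x ω.1) ^ 2 =
        A y ω.2 ^ 2 + A x ω.1 ^ 2 - 2 * (A x ω.1 * A y ω.2) := fun ω => by ring
    simp_rw [he]
    have j1 : Integrable (fun ω : ℂ × ℂ => A y ω.2 ^ 2) (complexGaussian.prod complexGaussian) :=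
      (i2 y).comp_snd _
    have j2 : Integrable (fun ω : ℂ × ℂ => A x ω.1 ^ 2) (complexGaussian.prod complexGaussian) :=
      (i2 x).comp_fst _
    have j3 : Integrable (fun ω : ℂ × ℂ => 2 * (A x ω.1 * A y ω.2))
        (complexGaussian.prod complexGaussian) := ((i1 x).mul_prod (i1 y)).const_mul 2
    have j12 : Integrable (fun ω : ℂ × ℂ => A y ω.2 ^ 2 + A x ω.1 ^ 2)
        (complexGaussian.prod complexGaussian) := j1.add j2
    rw [integral_sub j12 j3, integral_add j1 j2, integral_const_mul, integral_prod_mul]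
    have e1 := integral_prod_mul (μ := complexGaussian) (ν := complexGaussian) (fun _ => (1 : ℝ))
      fun z => A y z ^ 2
    have e2 := integral_prod_mul (μ := complexGaussian) (ν := complexGaussian)
      (fun z => A x z ^ 2) fun _ => (1 : ℝ)
    simp only [one_mul, mul_one, integral_const, probReal_univ, smul_eq_mul] at e1 e2
    rw [e1, e2]
  change ∑ x ∈ S, p x * ∑ y ∈ S, p y * ∫ ω : ℂ × ℂ, (A y ω.2 - A x ω.1) ^ 2
      ∂(complexGaussian.prod complexGaussian) = _
  simp_rw [hxy]
  set s : ℂ → ℝ := fun x => ∫ z, A x z ^ 2 ∂complexGaussian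
  set m : ℂ → ℝ := fun x => ∫ z, A x z ∂complexGaussian
  have hinner : ∀ x, ∑ y ∈ S, p y * (s y + s x - 2 * (m x * m y)) = (∑ y ∈ S, p y * s y) + s x := by
    intro x
    calc _ = (∑ y ∈ S, p y * s y) + s x * ∑ y ∈ S, p y - 2 * m x * ∑ y ∈ S, p y * m y := by
          rw [Finset.mul_sum, Finset.mul_sum, ← Finset.sum_add_distrib, ← Finset.sum_sub_distrib]
          exact Finset.sum_congr rfl fun y _ => by ring
      _ = _ := by rw [hp.sum_eq_one, hm]; ring
  change ∑ x ∈ S, p x * ∑ y ∈ S, p y * (s y + s x - 2 * (m x * m y)) = _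
  simp_rw [hinner, mul_add]
  rw [Finset.sum_add_distrib, ← Finset.sum_mul, hp.sum_eq_one, hs]
  ring

/-- Gaussian averages centred on the segment `[x, y]`. -/
lemma integral_segment_le {g : ℝ → ℝ → ℝ} (tg : Tame fun a b _ => g a b) (hg : ∀ a b, 0 ≤ g a b)
    {γ R : ℝ} (hγ : 0 ≤ γ) {x y w : ℂ} (hx : x.re ^ 2 + x.im ^ 2 ≤ R)
    (hy : y.re ^ 2 + y.im ^ 2 ≤ R) {τ : ℝ} (hτ : τ ∈ Icc (0 : ℝ) 1)
    (hre : w.re = x.re + τ * (y.re - x.re)) (him : w.im = x.im + τ * (y.im - x.im)) :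
    ∫ z : ℂ, g (Real.sqrt γ * (Real.sqrt γ * w.re + z.re))
        (Real.sqrt γ * (Real.sqrt γ * w.im + z.im)) ∂complexGaussian ≤
      Real.exp (γ * R) *
        (∫ z : ℂ, g (Real.sqrt γ * (Real.sqrt γ * x.re + z.re))
          (Real.sqrt γ * (Real.sqrt γ * x.im + z.im)) ∂complexGaussian +
        ∫ z : ℂ, g (Real.sqrt γ * (Real.sqrt γ * y.re + z.re))
          (Real.sqrt γ * (Real.sqrt γ * y.im + z.im)) ∂complexGaussian) := by
  have hform : ∀ u : ℂ, ∫ z : ℂ, g (Real.sqrt γ * (Real.sqrt γ * u.re + z.re))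
        (Real.sqrt γ * (Real.sqrt γ * u.im + z.im)) ∂complexGaussian =
      gaussAvg (fun a b γ => Real.exp (2 * (a * u.re + b * u.im) -
        γ * (u.re ^ 2 + u.im ^ 2)) * g a b) γ := by
    intro u
    have h := gaussAvg_lik_mul {u} (fun _ => 1) tg hγ
    simp only [lik, Finset.sum_singleton, one_mul] at h
    exact h.symm
  have t : ∀ u : ℂ, Tame fun a b γ => Real.exp (2 * (a * u.re + b * u.im) -
        γ * (u.re ^ 2 + u.im ^ 2)) * g a b := fun u => (tame_exp u).mul tg
  rw [hform, hform, hform, ← gaussAvg_add (t x) (t y) hγ, ← gaussAvg_const_mul]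
  refine gaussAvg_mono (t w) ((Tame.const _).mul ((t x).add (t y))) hγ fun a b => ?_
  rw [← add_mul, ← mul_assoc]
  refine mul_le_mul_of_nonneg_right ?_ (hg a b)
  set ex := 2 * (a * x.re + b * x.im)
  set ey := 2 * (a * y.re + b * y.im)
  have hw : 2 * (a * w.re + b * w.im) = (1 - τ) * ex + τ * ey := by
    rw [hre, him]; simp only [ex, ey]; ring
  -- The linear exponent at `w` is a convex combination of those at the end points, hence at most
  -- their maximum. Restoring the quadratic term at an end point costs at most exp(γR).
  have h1 : 2 * (a * w.re + b * w.im) - γ * (w.re ^ 2 + w.im ^ 2) ≤ max ex ey := by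
    have hc : (1 - τ) * ex + τ * ey ≤ max ex ey := by
      calc (1 - τ) * ex + τ * ey ≤ (1 - τ) * max ex ey + τ * max ex ey :=
            add_le_add (mul_le_mul_of_nonneg_left (le_max_left _ _) (by linarith [hτ.2]))
              (mul_le_mul_of_nonneg_left (le_max_right _ _) hτ.1)
        _ = _ := by ring
    have : 0 ≤ γ * (w.re ^ 2 + w.im ^ 2) := by positivity
    linarith
  have h2 : ∀ u : ℂ, u.re ^ 2 + u.im ^ 2 ≤ R → Real.exp (2 * (a * u.re + b * u.im)) ≤
      Real.exp (γ * R) * Real.exp (2 * (a * u.re + b * u.im) - γ * (u.re ^ 2 + u.im ^ 2)) := by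
    intro u hu
    rw [← Real.exp_add]
    refine Real.exp_le_exp.2 ?_
    have := mul_le_mul_of_nonneg_left hu hγ
    linarith
  refine (Real.exp_le_exp.2 h1).trans ?_
  have h3 := h2 x hx
  have h4 := h2 y hy
  have h5 := Real.exp_pos (ex - γ * (x.re ^ 2 + x.im ^ 2))
  have h6 := Real.exp_pos (ey - γ * (y.re ^ 2 + y.im ^ 2))
  have h7 := Real.exp_pos (γ * R)
  rcases le_total ex ey with hle | hle
  · rw [max_eq_right hle]; nlinarith [mul_pos h7 h5]
  · rw [max_eq_left hle]; nlinarith [mul_pos h7 h6]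

/-- The squared speed bound of the rotation path from `√γ (√γ x + ω.1)` to `√γ (√γ y + ω.2)` at
angle `t`, in the rotated frame; `g` stands for the squared gradient and `s = √γ`. -/
noncomputable def pathEnergy (g : ℝ → ℝ → ℝ) (s : ℝ) (x y : ℂ) (t : ℝ) (ω : ℂ × ℂ) : ℝ :=
  s * s * (g (s * (s * (x.re + t / (Real.pi / 2) * (y.re - x.re)) + ω.1.re))
      (s * (s * (x.im + t / (Real.pi / 2) * (y.im - x.im)) + ω.1.im)) *
    ((s / (Real.pi / 2) * (y.re - x.re) + ω.2.re) ^ 2 +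
      (s / (Real.pi / 2) * (y.im - x.im) + ω.2.im) ^ 2))

lemma continuous_pathEnergy {g : ℝ → ℝ → ℝ} (hg : Continuous fun q : ℝ × ℝ => g q.1 q.2) (s : ℝ)
    (x y : ℂ) : Continuous fun r : ℝ × ℂ × ℂ => pathEnergy g s x y r.1 r.2 := by
  have h1 := hg.comp (by fun_prop : Continuous fun r : ℝ × ℂ × ℂ =>
    (s * (s * (x.re + r.1 / (Real.pi / 2) * (y.re - x.re)) + r.2.1.re),
      s * (s * (x.im + r.1 / (Real.pi / 2) * (y.im - x.im)) + r.2.1.im)))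
  exact continuous_const.mul (h1.mul (by fun_prop))

lemma continuous_pathEnergy_rotation {g : ℝ → ℝ → ℝ}
    (hg : Continuous fun q : ℝ × ℝ => g q.1 q.2) (s : ℝ) (x y : ℂ) :
    Continuous fun r : ℝ × ℂ × ℂ =>
      pathEnergy g s x y r.1 (ContinuousLinearMap.rotation r.1 r.2) := by
  have h1 : Continuous fun r : ℝ × ℂ × ℂ =>
      (r.1, ContinuousLinearMap.rotation r.1 r.2) := by
    simp only [ContinuousLinearMap.rotation_apply]
    fun_prop
  exact (continuous_pathEnergy hg s x y).comp h1

lemma pathEnergy_rotation (g : ℝ → ℝ → ℝ) (s : ℝ) (x y : ℂ) (t : ℝ) (ω : ℂ × ℂ) :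
    pathEnergy g s x y t (ContinuousLinearMap.rotation t ω) =
      s * s * (g (s * (s * (x.re + t / (Real.pi / 2) * (y.re - x.re)) +
          (Real.cos t * ω.1.re + Real.sin t * ω.2.re)))
        (s * (s * (x.im + t / (Real.pi / 2) * (y.im - x.im)) +
          (Real.cos t * ω.1.im + Real.sin t * ω.2.im))) *
      ((s / (Real.pi / 2) * (y.re - x.re) + (-Real.sin t * ω.1.re + Real.cos t * ω.2.re)) ^ 2 +
        (s / (Real.pi / 2) * (y.im - x.im) +
          (-Real.sin t * ω.1.im + Real.cos t * ω.2.im)) ^ 2)) := by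
  simp only [pathEnergy, ContinuousLinearMap.rotation_apply, Complex.add_re, Complex.add_im,
    Complex.smul_re, Complex.smul_im, smul_eq_mul]

lemma pathEnergy_nonneg {g : ℝ → ℝ → ℝ} (hg : ∀ a b, 0 ≤ g a b) (s : ℝ) (x y : ℂ) (t : ℝ)
    (ω : ℂ × ℂ) : 0 ≤ pathEnergy g s x y t ω :=
  mul_nonneg (mul_self_nonneg s) (mul_nonneg (hg _ _) (by positivity))

/-- The two points are joined by a path whose centre moves linearly from `x` to `y` while the noise
rotates from ω.1 to ω.2. Cauchy–Schwarz is used twice: in time, with factor π/2, and in the plane,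
between gradient and velocity. -/
lemma sub_sq_le_integral_pathEnergy {h ha hb : ℝ → ℝ → ℝ}
    (hcurve : ∀ {f g : ℝ → ℝ} {f' g' t : ℝ}, HasDerivAt f f' t → HasDerivAt g g' t →
      HasDerivAt (fun t => h (f t) (g t)) (ha (f t) (g t) * f' + hb (f t) (g t) * g') t)
    (hac : Continuous fun q : ℝ × ℝ => ha q.1 q.2) (hbc : Continuous fun q : ℝ × ℝ => hb q.1 q.2)
    (s : ℝ) (x y : ℂ) (ω : ℂ × ℂ) :
    (h (s * (s * y.re + ω.2.re)) (s * (s * y.im + ω.2.im)) -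
      h (s * (s * x.re + ω.1.re)) (s * (s * x.im + ω.1.im))) ^ 2 ≤
      Real.pi / 2 * ∫ t in (0 : ℝ)..Real.pi / 2,
        pathEnergy (fun a b => ha a b ^ 2 + hb a b ^ 2) s x y t
          (ContinuousLinearMap.rotation t ω) := by
  have hT : 0 < Real.pi / 2 := by positivity
  have hgc : Continuous fun q : ℝ × ℝ => ha q.1 q.2 ^ 2 + hb q.1 q.2 ^ 2 :=
    (hac.pow 2).add (hbc.pow 2)
  set f : ℝ → ℝ := fun t => s * (s * (x.re + t / (Real.pi / 2) * (y.re - x.re)) +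
    (Real.cos t * ω.1.re + Real.sin t * ω.2.re)) with hf
  set k : ℝ → ℝ := fun t => s * (s * (x.im + t / (Real.pi / 2) * (y.im - x.im)) +
    (Real.cos t * ω.1.im + Real.sin t * ω.2.im)) with hk
  have hpath : ∀ (u v : ℝ) (m n t : ℝ), HasDerivAt (fun t => s * (s * (u + t / (Real.pi / 2) * v) +
      (Real.cos t * m + Real.sin t * n)))
      (s * (s / (Real.pi / 2) * v + (-Real.sin t * m + Real.cos t * n))) t := by
    intro u v m n t
    have h1 := (((((hasDerivAt_id t).div_const (Real.pi / 2)).mul_const v).const_add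
      u).const_mul s).fun_add
      (((Real.hasDerivAt_cos t).mul_const m).fun_add ((Real.hasDerivAt_sin t).mul_const n))
    refine (h1.const_mul s).congr_deriv ?_
    ring
  set f' : ℝ → ℝ := fun t => s / (Real.pi / 2) * (y.re - x.re) +
    (-Real.sin t * ω.1.re + Real.cos t * ω.2.re) with hf'
  set k' : ℝ → ℝ := fun t => s / (Real.pi / 2) * (y.im - x.im) +
    (-Real.sin t * ω.1.im + Real.cos t * ω.2.im) with hk'
  have hφ : ∀ t, HasDerivAt (fun t => h (f t) (k t))
      (ha (f t) (k t) * (s * f' t) + hb (f t) (k t) * (s * k' t)) t := fun t =>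
    hcurve (hpath _ _ _ _ t) (hpath _ _ _ _ t)
  have hfc : Continuous f := by simp only [hf]; fun_prop
  have hkc : Continuous k := by simp only [hk]; fun_prop
  have hfc' : Continuous f' := by simp only [hf']; fun_prop
  have hkc' : Continuous k' := by simp only [hk']; fun_prop
  have hφc : Continuous fun t => ha (f t) (k t) * (s * f' t) + hb (f t) (k t) * (s * k' t) :=
    ((hac.comp (hfc.prodMk hkc)).mul (hfc'.const_mul s)).add
      ((hbc.comp (hfc.prodMk hkc)).mul (hkc'.const_mul s))
  have hint := intervalIntegral.integral_eq_sub_of_hasDerivAt (a := 0) (b := Real.pi / 2)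
    (fun t _ => hφ t) (hφc.intervalIntegrable _ _)
  have hend : h (f (Real.pi / 2)) (k (Real.pi / 2)) - h (f 0) (k 0) =
      h (s * (s * y.re + ω.2.re)) (s * (s * y.im + ω.2.im)) -
        h (s * (s * x.re + ω.1.re)) (s * (s * x.im + ω.1.im)) := by
    simp only [hf, hk, Real.cos_pi_div_two, Real.sin_pi_div_two, Real.cos_zero, Real.sin_zero]
    rw [div_self hT.ne']
    simp
  rw [← hend, ← hint]
  refine (sq_intervalIntegral_le hφc hT).trans (mul_le_mul_of_nonneg_left ?_ hT.le)
  refine intervalIntegral.integral_mono_on hT.le ((hφc.pow 2).intervalIntegrable _ _)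
    (Continuous.intervalIntegrable ((continuous_pathEnergy_rotation
      (g := fun a b => ha a b ^ 2 + hb a b ^ 2) hgc s x y).comp
      (by fun_prop : Continuous fun t : ℝ => (t, ω))) _ _) fun t _ => ?_
  rw [pathEnergy_rotation]
  change (ha (f t) (k t) * (s * f' t) + hb (f t) (k t) * (s * k' t)) ^ 2 ≤
    s * s * ((ha (f t) (k t) ^ 2 + hb (f t) (k t) ^ 2) * (f' t ^ 2 + k' t ^ 2))
  nlinarith [mul_nonneg (mul_self_nonneg s)
    (sq_nonneg (ha (f t) (k t) * k' t - hb (f t) (k t) * f' t))]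

/-- In the rotated frame ω.1 drives the position and ω.2 the velocity; they are independent, so the
expectation factors. The speed factor is at most 1 + 4γR because |y - x|² ≤ 4R and (π/2)² ≥ 1. -/
lemma integral_pathEnergy_le {g : ℝ → ℝ → ℝ} (tg : Tame fun a b _ => g a b)
    (hg : ∀ a b, 0 ≤ g a b) {γ R : ℝ} (hγ : 0 ≤ γ) {x y : ℂ} (hx : x.re ^ 2 + x.im ^ 2 ≤ R)
    (hy : y.re ^ 2 + y.im ^ 2 ≤ R) {t : ℝ} (ht : t ∈ Icc 0 (Real.pi / 2)) :
    ∫ ω, pathEnergy g (Real.sqrt γ) x y t ω ∂(complexGaussian.prod complexGaussian) ≤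
      γ * (1 + 4 * γ * R) * Real.exp (γ * R) *
        (∫ z : ℂ, g (Real.sqrt γ * (Real.sqrt γ * x.re + z.re))
          (Real.sqrt γ * (Real.sqrt γ * x.im + z.im)) ∂complexGaussian +
        ∫ z : ℂ, g (Real.sqrt γ * (Real.sqrt γ * y.re + z.re))
          (Real.sqrt γ * (Real.sqrt γ * y.im + z.im)) ∂complexGaussian) := by
  have hT : 0 < Real.pi / 2 := by positivity
  have hτ : t / (Real.pi / 2) ∈ Icc (0 : ℝ) 1 :=
    ⟨div_nonneg ht.1 hT.le, (div_le_one hT).2 ht.2⟩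
  have hseg := integral_segment_le tg hg hγ hx hy (w := ⟨x.re + t / (Real.pi / 2) * (y.re - x.re),
    x.im + t / (Real.pi / 2) * (y.im - x.im)⟩) hτ rfl rfl
  have hvel := integral_norm_sq_add (⟨Real.sqrt γ / (Real.pi / 2) * (y.re - x.re),
    Real.sqrt γ / (Real.pi / 2) * (y.im - x.im)⟩ : ℂ)
  have hnorm : (Real.sqrt γ / (Real.pi / 2) * (y.re - x.re)) ^ 2 +
      (Real.sqrt γ / (Real.pi / 2) * (y.im - x.im)) ^ 2 + 1 ≤ 1 + 4 * γ * R := by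
    have h1 : (Real.sqrt γ / (Real.pi / 2)) ^ 2 ≤ γ := by
      rw [div_pow, Real.sq_sqrt hγ]
      refine div_le_self hγ ?_
      nlinarith [Real.pi_gt_three]
    have h2 : (y.re - x.re) ^ 2 + (y.im - x.im) ^ 2 ≤ 4 * R := by
      nlinarith [sq_nonneg (y.re + x.re), sq_nonneg (y.im + x.im)]
    have h3 := mul_le_mul h1 h2 (by positivity) hγ
    linarith
  dsimp only at hseg hvel
  have hsplit : ∫ ω, pathEnergy g (Real.sqrt γ) x y t ω ∂(complexGaussian.prod complexGaussian) =
      γ * ((∫ z : ℂ, g (Real.sqrt γ * (Real.sqrt γ * (x.re + t / (Real.pi / 2) * (y.re - x.re)) +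
          z.re)) (Real.sqrt γ * (Real.sqrt γ * (x.im + t / (Real.pi / 2) * (y.im - x.im)) +
          z.im)) ∂complexGaussian) *
        ∫ v : ℂ, ((Real.sqrt γ / (Real.pi / 2) * (y.re - x.re) + v.re) ^ 2 +
          (Real.sqrt γ / (Real.pi / 2) * (y.im - x.im) + v.im) ^ 2) ∂complexGaussian) := by
    rw [← integral_prod_mul, ← integral_const_mul]
    simp only [pathEnergy, Real.mul_self_sqrt hγ]
  rw [hsplit, hvel]
  calc _ ≤ γ * (_ * (1 + 4 * γ * R)) :=
        mul_le_mul_of_nonneg_left (mul_le_mul hseg hnorm (by positivity)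
          ((integral_nonneg fun z => hg _ _).trans hseg)) hγ
    _ = _ := by ring

/-- Needed to exchange the integral over the path with the one over the noise: the gradient is
bounded and the velocity is affine in the noise. -/
lemma integrable_pathEnergy_rotation {g : ℝ → ℝ → ℝ}
    (hgc : Continuous fun q : ℝ × ℝ => g q.1 q.2) (hg : ∀ a b, 0 ≤ g a b) {K : ℝ}
    (hK : ∀ a b, g a b ≤ K) (s : ℝ) (x y : ℂ) (T : ℝ) :
    Integrable (fun r : ℝ × ℂ × ℂ => pathEnergy g s x y r.1 (ContinuousLinearMap.rotation r.1 r.2))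
      ((volume.restrict (Ioc 0 T)).prod (complexGaussian.prod complexGaussian)) := by
  have hK0 : 0 ≤ K := (hg 0 0).trans (hK 0 0)
  set u := s / (Real.pi / 2) * (y.re - x.re)
  set v := s / (Real.pi / 2) * (y.im - x.im)
  have hbound : Integrable (fun ω : ℂ × ℂ => s * s * (K * (2 * (u ^ 2 + v ^ 2) +
      4 * (ω.1.re ^ 2 + ω.1.im ^ 2) + 4 * (ω.2.re ^ 2 + ω.2.im ^ 2))))
      (complexGaussian.prod complexGaussian) := by
    have i0 := integrable_norm_sq_add 0
    simp only [Complex.zero_re, Complex.zero_im, zero_add] at i0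
    exact ((((integrable_const _).add ((i0.comp_fst complexGaussian).const_mul 4)).add
      ((i0.comp_snd complexGaussian).const_mul 4)).const_mul K).const_mul (s * s)
  refine (hbound.comp_snd (volume.restrict (Ioc 0 T))).mono'
    (continuous_pathEnergy_rotation hgc s x y).aestronglyMeasurable (Eventually.of_forall fun r =>
        ?_)
  obtain ⟨t, ω⟩ := r
  rw [Real.norm_of_nonneg (pathEnergy_nonneg hg _ _ _ _ _)]
  simp only [pathEnergy_rotation]
  refine mul_le_mul_of_nonneg_left (mul_le_mul (hK _ _) ?_ (by positivity) hK0) (mul_self_nonneg s)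
  have hsc := Real.sin_sq_add_cos_sq t
  have haux : ∀ e m n : ℝ, (e + (-Real.sin t * m + Real.cos t * n)) ^ 2 ≤
      2 * e ^ 2 + 4 * m ^ 2 + 4 * n ^ 2 := by
    intro e m n
    have h1 : (-Real.sin t * m + Real.cos t * n) ^ 2 =
        (Real.sin t ^ 2 + Real.cos t ^ 2) * (m ^ 2 + n ^ 2) -
          (Real.cos t * m + Real.sin t * n) ^ 2 := by ring
    rw [hsc] at h1
    nlinarith [sq_nonneg (e - (-Real.sin t * m + Real.cos t * n)), sq_nonneg m, sq_nonneg n,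
      sq_nonneg (Real.cos t * m + Real.sin t * n)]
  have e1 := haux u ω.1.re ω.2.re
  have e2 := haux v ω.1.im ω.2.im
  simp only [u, v] at e1 e2 ⊢
  linarith

/-- The interpolation argument behind the Gaussian Poincaré inequality, between two shifted Gaussian
vectors. -/
lemma integral_sub_sq_le {h ha hb : ℝ → ℝ → ℝ}
    (hcurve : ∀ {f g : ℝ → ℝ} {f' g' t : ℝ}, HasDerivAt f f' t → HasDerivAt g g' t →
      HasDerivAt (fun t => h (f t) (g t)) (ha (f t) (g t) * f' + hb (f t) (g t) * g') t)
    (hac : Continuous fun q : ℝ × ℝ => ha q.1 q.2) (hbc : Continuous fun q : ℝ × ℝ => hb q.1 q.2)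
    {K : ℝ} (hK : ∀ a b, ha a b ^ 2 + hb a b ^ 2 ≤ K) {γ R : ℝ} (hγ : 0 ≤ γ) {x y : ℂ}
    (hx : x.re ^ 2 + x.im ^ 2 ≤ R) (hy : y.re ^ 2 + y.im ^ 2 ≤ R) :
    ∫ ω : ℂ × ℂ, (h (Real.sqrt γ * (Real.sqrt γ * y.re + ω.2.re))
          (Real.sqrt γ * (Real.sqrt γ * y.im + ω.2.im)) -
        h (Real.sqrt γ * (Real.sqrt γ * x.re + ω.1.re))
          (Real.sqrt γ * (Real.sqrt γ * x.im + ω.1.im))) ^ 2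
        ∂(complexGaussian.prod complexGaussian) ≤
      (Real.pi / 2) ^ 2 * γ * (1 + 4 * γ * R) * Real.exp (γ * R) *
        (∫ z : ℂ, (ha (Real.sqrt γ * (Real.sqrt γ * x.re + z.re))
            (Real.sqrt γ * (Real.sqrt γ * x.im + z.im)) ^ 2 +
            hb (Real.sqrt γ * (Real.sqrt γ * x.re + z.re))
            (Real.sqrt γ * (Real.sqrt γ * x.im + z.im)) ^ 2) ∂complexGaussian +
        ∫ z : ℂ, (ha (Real.sqrt γ * (Real.sqrt γ * y.re + z.re))
            (Real.sqrt γ * (Real.sqrt γ * y.im + z.im)) ^ 2 +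
            hb (Real.sqrt γ * (Real.sqrt γ * y.re + z.re))
            (Real.sqrt γ * (Real.sqrt γ * y.im + z.im)) ^ 2) ∂complexGaussian) := by
  have hT : 0 < Real.pi / 2 := by positivity
  have hgc : Continuous fun q : ℝ × ℝ => ha q.1 q.2 ^ 2 + hb q.1 q.2 ^ 2 :=
    (hac.pow 2).add (hbc.pow 2)
  have hg0 : ∀ a b, 0 ≤ ha a b ^ 2 + hb a b ^ 2 := fun a b => by positivity
  have tg : Tame fun a b _ => ha a b ^ 2 + hb a b ^ 2 := Tame.of_bounded
    (hgc.comp (by fun_prop : Continuous fun q : ℝ × ℝ × ℝ => (q.1, q.2.1))) (K := K)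
    fun a b _ => by rw [abs_of_nonneg (hg0 a b)]; exact hK a b
  have hQint := integrable_pathEnergy_rotation (g := fun a b => ha a b ^ 2 + hb a b ^ 2) hgc
    hg0 hK (Real.sqrt γ) x y (Real.pi / 2)
  have hpt := sub_sq_le_integral_pathEnergy hcurve hac hbc (Real.sqrt γ) x y
  have hEq := fun t (ht : t ∈ Icc 0 (Real.pi / 2)) => integral_pathEnergy_le tg hg0 hγ hx hy ht
  -- At a fixed time the rotation preserves the law of the noise pair, so it can be dropped once
  -- time is the outer integral.
  have hrot : ∀ t, ∫ ω, pathEnergy (fun a b => ha a b ^ 2 + hb a b ^ 2) (Real.sqrt γ) x y t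
      (ContinuousLinearMap.rotation t ω) ∂(complexGaussian.prod complexGaussian) =
      ∫ ω, pathEnergy (fun a b => ha a b ^ 2 + hb a b ^ 2) (Real.sqrt γ) x y t ω
        ∂(complexGaussian.prod complexGaussian) := by
    intro t
    conv_rhs => rw [← complexGaussian_prod_map_rotation t]
    rw [integral_map (by fun_prop)]
    exact ((continuous_pathEnergy (g := fun a b => ha a b ^ 2 + hb a b ^ 2) hgc _ x y).comp
      (by fun_prop : Continuous fun ω : ℂ × ℂ => (t, ω))).aestronglyMeasurable
  generalize pathEnergy (fun a b => ha a b ^ 2 + hb a b ^ 2) (Real.sqrt γ) x y = Q at *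
  have hswap : ∫ ω, (∫ t in (0 : ℝ)..Real.pi / 2, Q t (ContinuousLinearMap.rotation t ω))
      ∂(complexGaussian.prod complexGaussian) = ∫ t in (0 : ℝ)..Real.pi / 2,
        ∫ ω, Q t (ContinuousLinearMap.rotation t ω) ∂(complexGaussian.prod complexGaussian) := by
    simp only [intervalIntegral.integral_of_le hT.le]
    exact (integral_integral_swap (f := fun t ω => Q t (ContinuousLinearMap.rotation t ω))
        hQint).symm
  have hQi : Integrable (fun ω => ∫ t in (0 : ℝ)..Real.pi / 2,
      Q t (ContinuousLinearMap.rotation t ω)) (complexGaussian.prod complexGaussian) := by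
    simp only [intervalIntegral.integral_of_le hT.le]
    exact hQint.integral_prod_right
  have hQt : IntervalIntegrable (fun t => ∫ ω, Q t (ContinuousLinearMap.rotation t ω)
      ∂(complexGaussian.prod complexGaussian)) volume 0 (Real.pi / 2) := by
    rw [intervalIntegrable_iff_integrableOn_Ioc_of_le hT.le]
    exact hQint.integral_prod_left
  refine (integral_mono_of_nonneg (Eventually.of_forall fun ω => sq_nonneg _)
    (hQi.const_mul (Real.pi / 2)) (Eventually.of_forall hpt)).trans ?_
  rw [integral_const_mul, hswap]
  -- The time interval has length π/2, the second of the two factors π/2 in the constant.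
  refine (mul_le_mul_of_nonneg_left (intervalIntegral.integral_mono_on hT.le hQt
    intervalIntegrable_const fun t ht => (hrot t).trans_le (hEq t ht)) hT.le).trans_eq ?_
  rw [intervalIntegral.integral_const, smul_eq_mul, sub_zero]
  ring

end

namespace UnitInput

variable {S : Finset ℂ} {p : ℂ → ℝ}

/-- Averaging the two-point estimate over independent symbols gives twice the variance on the left
and twice the gradient energy on the right. The point is that the constant tends to 0 with γ. -/
lemma gaussAvg_sq_le (hp : UnitInput S p) {h ha hb : ℝ → ℝ → ℝ}
    (hcurve : ∀ {f g : ℝ → ℝ} {f' g' t : ℝ}, HasDerivAt f f' t → HasDerivAt g g' t →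
      HasDerivAt (fun t => h (f t) (g t)) (ha (f t) (g t) * f' + hb (f t) (g t) * g') t)
    (hac : Continuous fun q : ℝ × ℝ => ha q.1 q.2) (hbc : Continuous fun q : ℝ × ℝ => hb q.1 q.2)
    {K : ℝ} (hK : ∀ a b, ha a b ^ 2 + hb a b ^ 2 ≤ K) {γ R : ℝ} (hγ : 0 ≤ γ)
    (hR : ∀ x ∈ S, x.re ^ 2 + x.im ^ 2 ≤ R) (th : Tame fun a b _ => h a b)
    (hmean : gaussAvg (fun a b γ => lik S p a b γ * h a b) γ = 0) :
    gaussAvg (fun a b γ => lik S p a b γ * h a b ^ 2) γ ≤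
      (Real.pi / 2) ^ 2 * γ * (1 + 4 * γ * R) * Real.exp (γ * R) *
        gaussAvg (fun a b γ => lik S p a b γ * (ha a b ^ 2 + hb a b ^ 2)) γ := by
  have hg0 : ∀ a b, 0 ≤ ha a b ^ 2 + hb a b ^ 2 := fun a b => by positivity
  have tg : Tame fun a b _ => ha a b ^ 2 + hb a b ^ 2 := Tame.of_bounded
    (((hac.pow 2).add (hbc.pow 2)).comp
      (by fun_prop : Continuous fun q : ℝ × ℝ × ℝ => (q.1, q.2.1))) (K := K)
    fun a b _ => by rw [abs_of_nonneg (hg0 a b)]; exact hK a b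
  have h1 := hp.sum_sum_integral_sub_sq hγ th hmean
  have h2 := gaussAvg_lik_mul S p tg hγ
  have h3 : ∀ x ∈ S, ∀ y ∈ S, _ := fun x hx y hy =>
    integral_sub_sq_le hcurve hac hbc hK hγ (hR x hx) (hR y hy)
  set C := (Real.pi / 2) ^ 2 * γ * (1 + 4 * γ * R) * Real.exp (γ * R)
  set B : ℂ → ℝ := fun x => ∫ z : ℂ, (ha (Real.sqrt γ * (Real.sqrt γ * x.re + z.re))
            (Real.sqrt γ * (Real.sqrt γ * x.im + z.im)) ^ 2 +
            hb (Real.sqrt γ * (Real.sqrt γ * x.re + z.re))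
            (Real.sqrt γ * (Real.sqrt γ * x.im + z.im)) ^ 2) ∂complexGaussian with hB
  have h4 : ∑ x ∈ S, p x * ∑ y ∈ S, p y * (C * (B x + B y)) =
      2 * (C * gaussAvg (fun a b γ => lik S p a b γ * (ha a b ^ 2 + hb a b ^ 2)) γ) := by
    have h2' : gaussAvg (fun a b γ => lik S p a b γ * (ha a b ^ 2 + hb a b ^ 2)) γ =
      ∑ x ∈ S, p x * B x := h2
    rw [h2']
    have hinner : ∀ x, ∑ y ∈ S, p y * (C * (B x + B y)) = C * B x + C * ∑ y ∈ S, p y * B y := by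
      intro x
      calc _ = C * B x * ∑ y ∈ S, p y + C * ∑ y ∈ S, p y * B y := by
            rw [Finset.mul_sum, Finset.mul_sum, ← Finset.sum_add_distrib]
            exact Finset.sum_congr rfl fun y _ => by ring
        _ = _ := by rw [hp.sum_eq_one, mul_one]
    simp_rw [hinner, mul_add]
    rw [Finset.sum_add_distrib, ← Finset.sum_mul, hp.sum_eq_one]
    have : ∑ x ∈ S, p x * (C * B x) = C * ∑ x ∈ S, p x * B x := by
      rw [Finset.mul_sum]
      exact Finset.sum_congr rfl fun x _ => by ring
    rw [this]
    ring
  have h5 := Finset.sum_le_sum fun x hx => mul_le_mul_of_nonneg_left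
    (Finset.sum_le_sum fun y hy => mul_le_mul_of_nonneg_left (h3 x hx y hy) (hp.pos y hy).le)
    (hp.pos x hx).le
  rw [h1] at h5
  have h6 := h5.trans_eq h4
  linarith

lemma abs_postCov_le (hp : UnitInput S p) (c d : ℂ → ℝ) : ∃ K, ∀ a b γ, |postCov S p c d a b γ| ≤
    K := by
  have h : ∀ e : ℂ → ℝ, ∀ a b γ, |post S p e a b γ| ≤ ∑ x ∈ S, |e x| := fun e a b γ =>
    hp.abs_post_le (fun _ hx => Finset.single_le_sum (f := fun x => |e x|)
      (fun _ _ => abs_nonneg _) hx) a b γ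
  refine ⟨(∑ x ∈ S, |c x * d x|) + (∑ x ∈ S, |c x|) * ∑ x ∈ S, |d x|, fun a b γ => ?_⟩
  refine (abs_sub _ _).trans (add_le_add (h _ _ _ _) ?_)
  rw [abs_mul]
  exact mul_le_mul (h _ _ _ _) (h _ _ _ _) (abs_nonneg _)
    (Finset.sum_nonneg fun _ _ => abs_nonneg _)

lemma continuous_postCov (hp : UnitInput S p) (c d : ℂ → ℝ) (γ : ℝ) :
    Continuous fun q : ℝ × ℝ => postCov S p c d q.1 q.2 γ := by
  have h : Continuous fun q : ℝ × ℝ => (q.1, q.2, γ) := by fun_prop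
  have hc : ∀ e, Continuous fun q : ℝ × ℝ => post S p e q.1 q.2 γ := fun e => by
    have := (hp.continuous_post e).comp h
    exact this
  exact (hc _).sub ((hc c).mul (hc d))

/-- The Poincaré inequality for the error of the posterior mean of a coordinate `c` against a linear
estimate. -/
lemma gaussAvg_post_sub_linear_sq_le (hp : UnitInput S p) (c : ℂ → ℝ) (u v : ℝ) {γ R : ℝ}
    (hγ : 0 ≤ γ) (hR : ∀ x ∈ S, x.re ^ 2 + x.im ^ 2 ≤ R) (hc : ∑ x ∈ S, c x * p x = 0) :
    gaussAvg (fun a b γ => lik S p a b γ * (post S p c a b γ - (u * a + v * b)) ^ 2) γ ≤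
      (Real.pi / 2) ^ 2 * γ * (1 + 4 * γ * R) * Real.exp (γ * R) *
        gaussAvg (fun a b γ => lik S p a b γ *
          ((2 * postCov S p (fun x => x.re) c a b γ - u) ^ 2 +
            (2 * postCov S p (fun x => x.im) c a b γ - v) ^ 2)) γ := by
  obtain ⟨K₁, hK₁⟩ := hp.abs_postCov_le (fun x => x.re) c
  obtain ⟨K₂, hK₂⟩ := hp.abs_postCov_le (fun x => x.im) c
  have hb : ∀ {s t K : ℝ}, |s| ≤ K → (2 * s - t) ^ 2 ≤ (2 * K + |t|) ^ 2 := by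
    intro s t K hs
    refine sq_le_sq' ?_ ?_ <;> linarith [abs_le.1 hs, le_abs_self t, neg_abs_le t]
  -- The Poincaré inequality concerns functions of (a, b) only, so γ is frozen inside the posterior
  -- mean; the averages at this γ are unchanged.
  have tp : Tame fun a b _ => post S p c a b γ := Tame.of_bounded
    ((hp.tame_post c).cont.comp (by fun_prop : Continuous fun q : ℝ × ℝ × ℝ => (q.1, q.2.1, γ)))
    (K := ∑ x ∈ S, |c x|) fun a b _ => hp.abs_post_le (fun _ hx =>
      Finset.single_le_sum (f := fun x => |c x|) (fun _ _ => abs_nonneg _) hx) a b γ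
  have tl : Tame fun a b _ => u * a + v * b :=
    ((Tame.const u).mul tame_fst).add ((Tame.const v).mul tame_snd)
  have h := hp.gaussAvg_sq_le (h := fun a b => post S p c a b γ - (u * a + v * b))
    (ha := fun a b => 2 * postCov S p (fun x => x.re) c a b γ - u)
    (hb := fun a b => 2 * postCov S p (fun x => x.im) c a b γ - v)
    (fun {f g f' g' t} hf hg => by
      refine ((hp.hasDerivAt_post c hf hg (hasDerivAt_const t γ)).fun_sub
        ((hf.const_mul u).fun_add (hg.const_mul v))).congr_deriv ?_
      simp only [postCov]
      ring)
    (((hp.continuous_postCov _ c γ).const_mul 2).sub continuous_const)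
    (((hp.continuous_postCov _ c γ).const_mul 2).sub continuous_const)
    (fun a b => add_le_add (hb (hK₁ a b γ)) (hb (hK₂ a b γ))) hγ hR (tp.sub tl) (by
      have e1 : gaussAvg (fun a b γ' => lik S p a b γ' * (post S p c a b γ - (u * a + v * b))) γ =
          gaussAvg (fun a b γ' => lik S (fun x => c x * p x) a b γ' -
            (u * (lik S p a b γ' * a) + v * (lik S p a b γ' * b))) γ :=
        gaussAvg_congr fun a b => by rw [hp.lik_mul_eq]; ring
      have ta := (Tame.const u).mul ((tame_lik S p).mul tame_fst)
      have tb := (Tame.const v).mul ((tame_lik S p).mul tame_snd)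
      rw [e1, gaussAvg_sub (tame_lik _ _) (ta.add tb) hγ, gaussAvg_add ta tb hγ,
        gaussAvg_const_mul, gaussAvg_const_mul, gaussAvg_lik_mul_fst _ _ hγ,
        gaussAvg_lik_mul_snd _ _ hγ, gaussAvg_lik _ _ hγ, hp.mean_re, hp.mean_im, hc]
      ring)
  have e2 := gaussAvg_congr (γ := γ)
    (G := fun a b γ => lik S p a b γ * (post S p c a b γ - (u * a + v * b)) ^ 2)
    (H := fun a b γ' => lik S p a b γ' * (post S p c a b γ - (u * a + v * b)) ^ 2)
    fun _ _ => rfl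
  rw [e2]
  exact h

lemma postCov_symm (c d : ℂ → ℝ) (a b γ : ℝ) :
    postCov S p c d a b γ = postCov S p d c a b γ := by
  simp only [postCov, mul_comm]

/-- Put κ = 1/(1 + γ), and let V be the mean squared distance of the posterior covariance from (κ/2)
times the identity. Then (1 + γ) `covEnergy` - mmse = 2(1 + γ)V - (κ - mmse). The Poincaré
inequality for both coordinates gives κ - mmse ≤ 4CV, which is at most 2V under `hC`. -/
lemma mmse_le_mul_covEnergy_of_le (hp : UnitInput S p) {γ R : ℝ} (hγ : 0 ≤ γ)
    (hR : ∀ x ∈ S, x.re ^ 2 + x.im ^ 2 ≤ R)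
    (hC : 2 * ((Real.pi / 2) ^ 2 * γ * (1 + 4 * γ * R) * Real.exp (γ * R)) ≤ 1) :
    mmse S p γ ≤ (1 + γ) * covEnergy S p γ := by
  set κ := 1 / (1 + γ) with hκ
  have hκ1 : (1 + γ) * κ = 1 := by rw [hκ]; field_simp
  have h1 := hp.gaussAvg_post_sub_linear_sq_le (fun x => x.re) κ 0 hγ hR hp.mean_re
  have h2 := hp.gaussAvg_post_sub_linear_sq_le (fun x => x.im) 0 κ hγ hR hp.mean_im
  set C := (Real.pi / 2) ^ 2 * γ * (1 + 4 * γ * R) * Real.exp (γ * R)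
  have herr := hp.gaussAvg_linear_error hγ
  rw [← hκ] at herr
  have hcov := hp.covEnergy_eq hγ κ
  set V := gaussAvg (fun a b γ => lik S p a b γ *
      ((postCov S p (fun x => x.re) (fun x => x.re) a b γ - κ / 2) ^ 2 +
        2 * postCov S p (fun x => x.re) (fun x => x.im) a b γ ^ 2 +
        (postCov S p (fun x => x.im) (fun x => x.im) a b γ - κ / 2) ^ 2)) γ with hV
  have hV0 : 0 ≤ V := integral_nonneg fun z =>
    mul_nonneg (hp.lik_pos _ _ _).le (by positivity)
  have tE : ∀ c u v, Tame fun a b γ => lik S p a b γ *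
      (post S p c a b γ - (u * a + v * b)) ^ 2 := fun c u v =>
    (tame_lik S p).mul (((hp.tame_post c).sub
      (((Tame.const u).mul tame_fst).add ((Tame.const v).mul tame_snd))).pow 2)
  have tC : ∀ c u v, Tame fun a b γ => lik S p a b γ *
      ((2 * postCov S p (fun x => x.re) c a b γ - u) ^ 2 +
        (2 * postCov S p (fun x => x.im) c a b γ - v) ^ 2) := fun c u v =>
    (tame_lik S p).mul
      (((((Tame.const 2).mul (hp.tame_postCov _ c)).sub (Tame.const u)).pow 2).add
      ((((Tame.const 2).mul (hp.tame_postCov _ c)).sub (Tame.const v)).pow 2))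
  have h3 : κ - mmse S p γ ≤ C * (4 * V) := by
    have e1 : κ - mmse S p γ = gaussAvg (fun a b γ => lik S p a b γ *
        (post S p (fun x => x.re) a b γ - (κ * a + 0 * b)) ^ 2) γ +
        gaussAvg (fun a b γ => lik S p a b γ *
        (post S p (fun x => x.im) a b γ - (0 * a + κ * b)) ^ 2) γ := by
      rw [← herr, ← gaussAvg_add (tE _ _ _) (tE _ _ _) hγ]
      exact gaussAvg_congr fun a b => by ring
    have e2 : 4 * V = gaussAvg (fun a b γ => lik S p a b γ *
          ((2 * postCov S p (fun x => x.re) (fun x => x.re) a b γ - κ) ^ 2 +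
            (2 * postCov S p (fun x => x.im) (fun x => x.re) a b γ - 0) ^ 2)) γ +
        gaussAvg (fun a b γ => lik S p a b γ *
          ((2 * postCov S p (fun x => x.re) (fun x => x.im) a b γ - 0) ^ 2 +
            (2 * postCov S p (fun x => x.im) (fun x => x.im) a b γ - κ) ^ 2)) γ := by
      rw [hV, ← gaussAvg_add (tC _ _ _) (tC _ _ _) hγ, ← gaussAvg_const_mul]
      refine gaussAvg_congr fun a b => ?_
      rw [postCov_symm (fun x => x.im) (fun x => x.re)]
      ring
    rw [e1, e2, mul_add]
    exact add_le_add h1 h2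
  have h4 : (1 + γ) * covEnergy S p γ = 2 * (1 + γ) * V + 2 * mmse S p γ - κ := by
    rw [hcov]
    linear_combination (2 * mmse S p γ - κ) * hκ1
  rw [h4]
  nlinarith [mul_nonneg hγ hV0, mul_le_mul_of_nonneg_right hC hV0]

/-- At low SNR, information is concave as a function of the log-SNR. -/
lemma exists_low_snr (hp : UnitInput S p) :
    ∃ ε > 0, ∀ γ, 0 < γ → γ < ε → mmse S p γ ≤ (1 + γ) * covEnergy S p γ := by
  set R := ∑ x ∈ S, (x.re ^ 2 + x.im ^ 2)
  have hR : ∀ x ∈ S, x.re ^ 2 + x.im ^ 2 ≤ R := fun x hx =>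
    Finset.single_le_sum (f := fun x : ℂ => x.re ^ 2 + x.im ^ 2) (fun _ _ => by positivity) hx
  -- The Poincaré constant is continuous and vanishes at γ = 0, so it is as small as required near
  -- 0.
  have hcont : Continuous fun γ : ℝ =>
      2 * ((Real.pi / 2) ^ 2 * γ * (1 + 4 * γ * R) * Real.exp (γ * R)) := by fun_prop
  have hlim := hcont.tendsto 0
  simp only [mul_zero, zero_mul] at hlim
  have hev := hlim.eventually (gt_mem_nhds one_pos)
  obtain ⟨ε, hε, h⟩ := Metric.eventually_nhds_iff.1 hev
  refine ⟨ε, hε, fun γ h0 h1 => hp.mmse_le_mul_covEnergy_of_le h0.le hR (h ?_).le⟩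
  rw [Real.dist_eq, sub_zero, abs_of_pos h0]
  exact h1

end UnitInput

/-! ### Concavity at high SNR -/

lemma mul_exp_le_gaussianReal {α β B : ℝ} (hαβ : α ≤ β) (hB : ∀ x ∈ Icc α β, x ^ 2 ≤ B) :
    (β - α) * ((Real.sqrt Real.pi)⁻¹ * Real.exp (-B)) ≤ (gaussianReal 0 (1 / 2)).real (Icc α β) :=
        by
  have hv : (1 / 2 : NNReal) ≠ 0 := by norm_num
  rw [measureReal_def, gaussianReal_apply_eq_integral 0 hv,
    ENNReal.toReal_ofReal (integral_nonneg fun _ => gaussianPDFReal_nonneg _ _ _)]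
  have h1 : ∫ _ in Icc α β, (Real.sqrt Real.pi)⁻¹ * Real.exp (-B) =
      (β - α) * ((Real.sqrt Real.pi)⁻¹ * Real.exp (-B)) := by
    rw [setIntegral_const, Real.volume_real_Icc_of_le hαβ, smul_eq_mul]
  rw [← h1]
  refine setIntegral_mono_on ?_ (integrable_gaussianPDFReal _ _).integrableOn measurableSet_Icc
    fun x hx => ?_
  · rw [integrableOn_const_iff]; right; simp
  · have h2 : gaussianPDFReal 0 (1 / 2) x = (Real.sqrt Real.pi)⁻¹ * Real.exp (-x ^ 2) := by
      have h3 : 2 * Real.pi * ((1 / 2 : NNReal) : ℝ) = Real.pi := by push_cast; ring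
      have h4 : -(x - 0) ^ 2 / (2 * ((1 / 2 : NNReal) : ℝ)) = -x ^ 2 := by push_cast; ring
      rw [gaussianPDFReal, h3, h4]
    rw [h2]
    exact mul_le_mul_of_nonneg_left (Real.exp_le_exp.2 (by linarith [hB x hx])) (by positivity)

lemma complexGaussian_real_reProdIm (s t : Set ℝ) (hs : MeasurableSet s) (ht : MeasurableSet t) :
    complexGaussian.real {z : ℂ | z.re ∈ s ∧ z.im ∈ t} =
      (gaussianReal 0 (1 / 2)).real s * (gaussianReal 0 (1 / 2)).real t := by
  have hm : Measurable fun p : ℝ × ℝ => (⟨p.1, p.2⟩ : ℂ) :=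
      Complex.measurableEquivRealProd.symm.measurable
  have hset : MeasurableSet {z : ℂ | z.re ∈ s ∧ z.im ∈ t} :=
    (Complex.measurable_re hs).inter (Complex.measurable_im ht)
  rw [measureReal_def, complexGaussian, Measure.map_apply hm hset]
  change (((gaussianReal 0 (1 / 2)).prod (gaussianReal 0 (1 / 2))) (s ×ˢ t)).toReal = _
  rw [Measure.prod_prod, ENNReal.toReal_mul]
  rfl

/-- The exponent of the likelihood of the symbol `x`. -/
noncomputable def likExp (x : ℂ) (a b γ : ℝ) : ℝ :=
  2 * (a * x.re + b * x.im) - γ * (x.re ^ 2 + x.im ^ 2)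

lemma gaussAvg_exp_likExp (m : ℂ) {γ : ℝ} (hγ : 0 ≤ γ) :
    gaussAvg (fun a b γ => Real.exp (likExp m a b γ)) γ = 1 := by
  have h := gaussAvg_lik {m} (fun _ => 1) hγ
  rw [Finset.sum_singleton] at h
  rw [← h]
  exact gaussAvg_congr fun a b => by simp [lik, likExp]

namespace UnitInput

variable {S : Finset ℂ} {p : ℂ → ℝ}

lemma le_one (hp : UnitInput S p) {x : ℂ} (hx : x ∈ S) : p x ≤ 1 := by
  rw [← hp.sum_eq_one]
  exact Finset.single_le_sum (fun y hy => (hp.pos y hy).le) hx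

lemma likTerm_le_lik (hp : UnitInput S p) {x : ℂ} (hx : x ∈ S) (a b γ : ℝ) :
    likTerm p x a b γ ≤ lik S p a b γ :=
  Finset.single_le_sum (f := fun x => likTerm p x a b γ) (fun _ hy => (hp.likTerm_pos hy _ _
      _).le) hx

/-- The product is at most L², and also at most e², where e is the geometric mean of the two
exponentials; hence it is at most L e. By the parallelogram identity, e is a likelihood centred at
the midpoint, of noise average one, times exp(-γ|x - y|²/4). -/
lemma likTerm_mul_le (hp : UnitInput S p) {x y : ℂ} (hx : x ∈ S) (hy : y ∈ S) (a b γ : ℝ) :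
    likTerm p x a b γ * likTerm p y a b γ ≤
      lik S p a b γ * (Real.exp (-(γ * ((x.re - y.re) ^ 2 + (x.im - y.im) ^ 2) / 4)) *
        Real.exp (likExp ⟨(x.re + y.re) / 2, (x.im + y.im) / 2⟩ a b γ)) := by
  set e := Real.exp (-(γ * ((x.re - y.re) ^ 2 + (x.im - y.im) ^ 2) / 4)) *
        Real.exp (likExp ⟨(x.re + y.re) / 2, (x.im + y.im) / 2⟩ a b γ) with he
  have hx0 := hp.likTerm_pos hx a b γ
  have hy0 := hp.likTerm_pos hy a b γ
  have hL := hp.lik_pos a b γ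
  have he0 : 0 ≤ e := by positivity
  have hsq : likTerm p x a b γ * likTerm p y a b γ ≤ e ^ 2 := by
    have h1 : e ^ 2 = Real.exp (likExp x a b γ) * Real.exp (likExp y a b γ) := by
      rw [he, ← Real.exp_add, ← Real.exp_add, ← Real.exp_nat_mul]
      congr 1
      simp only [likExp]
      push_cast
      ring
    have h2 : likTerm p x a b γ * likTerm p y a b γ =
        (p x * p y) * (Real.exp (likExp x a b γ) * Real.exp (likExp y a b γ)) := by
      simp only [likTerm, likExp]; ring
    rw [h1, h2]
    have h3 : p x * p y ≤ 1 := mul_le_one₀ (hp.le_one hx) (hp.pos y hy).le (hp.le_one hy)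
    exact mul_le_of_le_one_left (by positivity) h3
  refine abs_le_of_sq_le_sq' ?_ (by positivity) |>.2
  have h4 : likTerm p x a b γ * likTerm p y a b γ ≤ lik S p a b γ ^ 2 := by
    rw [sq]
    exact mul_le_mul (hp.likTerm_le_lik hx _ _ _) (hp.likTerm_le_lik hy _ _ _) hy0.le hL.le
  calc (likTerm p x a b γ * likTerm p y a b γ) ^ 2 =
        (likTerm p x a b γ * likTerm p y a b γ) * (likTerm p x a b γ * likTerm p y a b γ) := sq _
    _ ≤ lik S p a b γ ^ 2 * e ^ 2 := mul_le_mul h4 hsq (by positivity) (by positivity)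
    _ = _ := by ring

/-- Exponential decay of the MMSE at the rate given by the minimum distance. -/
lemma mmse_le_exp (hp : UnitInput S p) {D : ℝ}
    (hD : ∀ x ∈ S, ∀ y ∈ S, x ≠ y → D ≤ (x.re - y.re) ^ 2 + (x.im - y.im) ^ 2) {γ : ℝ} (hγ : 0 ≤
        γ) :
    mmse S p γ ≤ (1 / 2 * ∑ x ∈ S, ∑ y ∈ S, ((x.re - y.re) ^ 2 + (x.im - y.im) ^ 2)) *
      Real.exp (-(γ * D / 4)) := by
  set q : ℂ → ℂ → ℝ := fun x y => (x.re - y.re) ^ 2 + (x.im - y.im) ^ 2 with hq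
  set G : ℂ → ℂ → ℝ → ℝ → ℝ → ℝ := fun x y a b γ' => (1 / 2 * q x y * Real.exp (-(γ * q x y / 4))) *
    Real.exp (likExp ⟨(x.re + y.re) / 2, (x.im + y.im) / 2⟩ a b γ')
  have tG : ∀ x y, Tame (G x y) := fun x y => (Tame.const _).mul (tame_exp _)
  have hsumT : ∀ (T : Finset ℂ) (F : ℂ → ℝ → ℝ → ℝ → ℝ), (∀ x, Tame (F x)) →
      Tame fun a b γ => ∑ x ∈ T, F x a b γ := by
    intro T F hF
    induction T using Finset.induction_on with
    | empty => simpa using Tame.const 0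
    | insert x T hx ih =>
      simp only [Finset.sum_insert hx]
      exact (hF x).add ih
  have h1 : mmse S p γ ≤ gaussAvg (fun a b γ' => ∑ x ∈ S, ∑ y ∈ S, G x y a b γ') γ := by
    rw [hp.mmse_eq hγ]
    refine gaussAvg_mono ((tame_lik S p).mul hp.tame_postVar)
      (hsumT S _ fun x => hsumT S _ fun y => tG x y) hγ fun a b => ?_
    have hL := hp.lik_pos a b γ
    have h2 := hp.lik_sq_mul_postVar a b γ
    have h3 : lik S p a b γ * (lik S p a b γ * postVar S p a b γ) ≤
        lik S p a b γ * ∑ x ∈ S, ∑ y ∈ S, G x y a b γ := by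
      rw [← mul_assoc, ← sq, h2, Finset.mul_sum, Finset.mul_sum]
      refine Finset.sum_le_sum fun x hx => ?_
      rw [Finset.mul_sum, Finset.mul_sum]
      refine Finset.sum_le_sum fun y hy => ?_
      have h4 := mul_le_mul_of_nonneg_right (hp.likTerm_mul_le hx hy a b γ)
        (by simp only [hq]; positivity : 0 ≤ 1 / 2 * q x y)
      simp only [G]
      calc _ = likTerm p x a b γ * likTerm p y a b γ * (1 / 2 * q x y) := by ring
        _ ≤ _ := h4
        _ = _ := by ring
    exact le_of_mul_le_mul_left h3 hL
  refine h1.trans ?_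
  rw [gaussAvg_finsetSum S (fun x _ => hsumT S _ fun y => tG x y) hγ, Finset.mul_sum,
      Finset.sum_mul]
  refine Finset.sum_le_sum fun x hx => ?_
  rw [gaussAvg_finsetSum S (fun y _ => tG x y) hγ, Finset.mul_sum, Finset.sum_mul]
  refine Finset.sum_le_sum fun y hy => ?_
  simp only [G]
  rw [gaussAvg_const_mul, gaussAvg_exp_likExp _ hγ, mul_one]
  by_cases hxy : x = y
  · simp [hq, hxy]
  · refine mul_le_mul_of_nonneg_left (Real.exp_le_exp.2 ?_) (by simp only [hq]; positivity)
    have := mul_le_mul_of_nonneg_left (hD x hx y hy hxy) hγ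
    simp only [hq]
    linarith

/-- If no symbol beats `x` by more than `c` in log-likelihood and `y` trails it by at most `c`, both
carry a fixed share of the posterior, so its variance is bounded below independently of γ. -/
lemma le_mul_postVar (hp : UnitInput S p) {x y : ℂ} (hx : x ∈ S) (hy : y ∈ S) (hxy : x ≠ y)
    {a b γ c : ℝ} (hup : ∀ k ∈ S, likExp k a b γ ≤ likExp x a b γ + c)
    (hlow : likExp x a b γ - c ≤ likExp y a b γ) :
    p x * p y * Real.exp (-c) * ((x.re - y.re) ^ 2 + (x.im - y.im) ^ 2) ≤
      (S.card * Real.exp c) ^ 2 * postVar S p a b γ := by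
  have h1 := hp.mul_likTerm_le_lik_sq_mul_postVar hx hy hxy a b γ
  set q := (x.re - y.re) ^ 2 + (x.im - y.im) ^ 2 with hq
  have hq0 : 0 ≤ q := by positivity
  set e := Real.exp (likExp x a b γ) with he
  have he0 : 0 < e := Real.exp_pos _
  have hL : lik S p a b γ ≤ S.card * Real.exp c * e := by
    have : ∀ k ∈ S, p k * Real.exp (likExp k a b γ) ≤ Real.exp c * e := by
      intro k hk
      rw [he, ← Real.exp_add, add_comm c]
      exact (mul_le_of_le_one_left (Real.exp_pos _).le (hp.le_one hk)).trans
        (Real.exp_le_exp.2 (hup k hk))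
    refine (Finset.sum_le_card_nsmul S _ _ this).trans_eq ?_
    rw [nsmul_eq_mul, mul_assoc]
  have h2 : lik S p a b γ ^ 2 ≤ (S.card * Real.exp c * e) ^ 2 :=
    pow_le_pow_left₀ (hp.lik_pos _ _ _).le hL 2
  have h3 : p x * e * (p y * (Real.exp (-c) * e)) ≤ likTerm p x a b γ * likTerm p y a b γ := by
    refine mul_le_mul_of_nonneg_left (mul_le_mul_of_nonneg_left ?_ (hp.pos y hy).le)
      (hp.likTerm_pos hx _ _ _).le
    rw [he, ← Real.exp_add]
    refine Real.exp_le_exp.2 ?_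
    change -c + likExp x a b γ ≤ likExp y a b γ
    linarith
  have h4 := (mul_le_mul_of_nonneg_right h3 hq0).trans (h1.trans
    (mul_le_mul_of_nonneg_right h2 (hp.postVar_pos a b γ).le))
  have h5 : e ^ 2 * (p x * p y * Real.exp (-c) * q) ≤
      e ^ 2 * ((S.card * Real.exp c) ^ 2 * postVar S p a b γ) := by
    calc _ = p x * e * (p y * (Real.exp (-c) * e)) * q := by ring
      _ ≤ _ := h4
      _ = _ := by ring
  exact le_of_mul_le_mul_left h5 (by positivity)

/-- For a 2 × 2 matrix the squared trace is at most twice the squared Frobenius norm. -/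
lemma gaussAvg_mul_postVar_sq_le_covEnergy (hp : UnitInput S p) {γ : ℝ} (hγ : 0 ≤ γ) :
    gaussAvg (fun a b γ => lik S p a b γ * postVar S p a b γ ^ 2) γ ≤ covEnergy S p γ := by
  have t1 : ∀ c d e f : ℂ → ℝ, Tame fun a b γ => 2 * (lik S p a b γ *
      (postCov S p c d a b γ ^ 2 + postCov S p e f a b γ ^ 2)) := fun c d e f =>
    (Tame.const 2).mul ((tame_lik S p).mul (((hp.tame_postCov _ _).pow 2).add
      ((hp.tame_postCov _ _).pow 2)))
  rw [covEnergy, ← gaussAvg_add (t1 _ _ _ _) (t1 _ _ _ _) hγ]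
  refine gaussAvg_mono ((tame_lik S p).mul (hp.tame_postVar.pow 2))
    ((t1 _ _ _ _).add (t1 _ _ _ _)) hγ fun a b => ?_
  rw [← mul_add, ← mul_add, mul_left_comm]
  refine mul_le_mul_of_nonneg_left ?_ (hp.lik_pos _ _ _).le
  rw [postVar]
  nlinarith [sq_nonneg (postCov S p (fun x => x.re) (fun x => x.re) a b γ -
    postCov S p (fun x => x.im) (fun x => x.im) a b γ),
    sq_nonneg (postCov S p (fun x => x.im) (fun x => x.re) a b γ),
    sq_nonneg (postCov S p (fun x => x.re) (fun x => x.im) a b γ)]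

end UnitInput

namespace UnitInput

variable {S : Finset ℂ} {p : ℂ → ℝ}

/-- Near the midpoint of a closest pair of symbols the posterior is spread over both symbols. -/
lemma likExp_near_midpoint {x y u : ℂ} {d M γ : ℝ} (hd : 0 < d) (hγ : 1 ≤ γ)
    (hM : ∀ k ∈ S, (k.re - x.re) ^ 2 + (k.im - x.im) ^ 2 ≤ M)
    (hmin : ∀ k ∈ S, k ≠ x → k ≠ y → d ^ 2 ≤ (k.re - x.re) ^ 2 + (k.im - x.im) ^ 2 ∧
      d ^ 2 ≤ (k.re - y.re) ^ 2 + (k.im - y.im) ^ 2)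
    (hre : y.re = x.re + d * u.re) (him : y.im = x.im + d * u.im) (hu : u.re ^ 2 + u.im ^ 2 = 1)
    (hbig : 2 * (2 + M) ≤ Real.sqrt γ * d ^ 2) {r₁ r₂ : ℝ} (h1 : |r₁| ≤ 1 / Real.sqrt γ)
    (h2 : |r₂| ≤ 1) {a b : ℝ}
    (ha : a = Real.sqrt γ * (Real.sqrt γ * x.re +
      (u.re * (Real.sqrt γ * d / 2 + r₁) - u.im * r₂)))
    (hb : b = Real.sqrt γ * (Real.sqrt γ * x.im +
      (u.im * (Real.sqrt γ * d / 2 + r₁) + u.re * r₂))) :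
    (∀ k ∈ S, likExp k a b γ ≤ likExp x a b γ + 2 * d) ∧
      likExp x a b γ - 2 * d ≤ likExp y a b γ := by
  set s := Real.sqrt γ with hs
  have hss : s * s = γ := Real.mul_self_sqrt (by linarith)
  have hs1 : 1 ≤ s := Real.one_le_sqrt.2 hγ
  have hsr : |s * r₁| ≤ 1 := by
    rw [abs_mul, abs_of_pos (by linarith)]
    calc s * |r₁| ≤ s * (1 / s) := mul_le_mul_of_nonneg_left h1 (by linarith)
      _ = 1 := by field_simp
  -- Split into the value at the exact midpoint, quadratic in `s`, and the effect of the
  -- displacement, whose coordinates along and across `u` are `r₁` and `r₂`, linear in `s`.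
  have hdiff : ∀ k : ℂ, likExp k a b γ - likExp x a b γ =
      s ^ 2 * (((x.re - y.re) ^ 2 + (x.im - y.im) ^ 2) / 2 -
        ((k.re - x.re) ^ 2 + (k.im - x.im) ^ 2) / 2 - ((k.re - y.re) ^ 2 + (k.im - y.im) ^ 2) / 2) +
      2 * s * ((u.re * r₁ - u.im * r₂) * (k.re - x.re) + (u.im * r₁ + u.re * r₂) * (k.im - x.im))
          := by
    intro k
    have e1 : d * u.re = y.re - x.re := by linarith
    have e2 : d * u.im = y.im - x.im := by linarith
    have ha' : a = s ^ 2 * (x.re + y.re) / 2 + s * (u.re * r₁ - u.im * r₂) := by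
      rw [ha]; linear_combination s ^ 2 / 2 * e1
    have hb' : b = s ^ 2 * (x.im + y.im) / 2 + s * (u.im * r₁ + u.re * r₂) := by
      rw [hb]; linear_combination s ^ 2 / 2 * e2
    simp only [likExp]
    rw [ha', hb', ← hss]
    ring
  -- The displacement across `u` does not favour either of the two symbols, so only `r₁` enters;
  -- this is why it must be of order 1/√γ.
  have hy : likExp y a b γ - likExp x a b γ = 2 * d * (s * r₁) := by
    rw [hdiff]
    have e1 : y.re - x.re = d * u.re := by linarith
    have e2 : y.im - x.im = d * u.im := by linarith
    have e3 : x.re - y.re = -(d * u.re) := by linarith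
    have e4 : x.im - y.im = -(d * u.im) := by linarith
    rw [e1, e2, e3, e4]
    linear_combination 2 * s * d * r₁ * hu
  obtain ⟨h3, h4⟩ := abs_le.1 hsr
  have h3' := mul_le_mul_of_nonneg_left h3 (by linarith : 0 ≤ 2 * d)
  have h4' := mul_le_mul_of_nonneg_left h4 (by linarith : 0 ≤ 2 * d)
  refine ⟨fun k hk => ?_, by linarith⟩
  by_cases hkx : k = x
  · rw [hkx]; linarith
  by_cases hky : k = y
  · rw [hky]; linarith
  obtain ⟨m1, m2⟩ := hmin k hk hkx hky
  have hxy : (x.re - y.re) ^ 2 + (x.im - y.im) ^ 2 = d ^ 2 := by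
    rw [hre, him]; linear_combination d ^ 2 * hu
  have hq : (u.re * r₁ - u.im * r₂) ^ 2 + (u.im * r₁ + u.re * r₂) ^ 2 ≤ 2 := by
    have e : (u.re * r₁ - u.im * r₂) ^ 2 + (u.im * r₁ + u.re * r₂) ^ 2 = r₁ ^ 2 + r₂ ^ 2 := by
      linear_combination (r₁ ^ 2 + r₂ ^ 2) * hu
    have e1 : |r₁| ≤ 1 := h1.trans ((div_le_one (by linarith)).2 hs1)
    have e2 := (sq_le_one_iff_abs_le_one r₁).2 e1
    have e3 := (sq_le_one_iff_abs_le_one r₂).2 h2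
    linarith
  have hMk := hM k hk
  have hin : 2 * ((u.re * r₁ - u.im * r₂) * (k.re - x.re) + (u.im * r₁ + u.re * r₂) * (k.im -
      x.im)) ≤
      2 + M := by
    linarith [two_mul_le_add_sq (u.re * r₁ - u.im * r₂) (k.re - x.re),
      two_mul_le_add_sq (u.im * r₁ + u.re * r₂) (k.im - x.im)]
  have h5 := hdiff k
  rw [hxy] at h5
  -- Any other symbol is at distance at least `d` from both `x` and `y`, so it loses at least
  -- s²d²/2, which by `hbig` outweighs the displacement term of at most s(2 + M).
  have h6 : s ^ 2 * (d ^ 2 / 2 - ((k.re - x.re) ^ 2 + (k.im - x.im) ^ 2) / 2 -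
      ((k.re - y.re) ^ 2 + (k.im - y.im) ^ 2) / 2) ≤ s ^ 2 * (-(d ^ 2 / 2)) :=
    mul_le_mul_of_nonneg_left (by linarith) (sq_nonneg s)
  have h7 := mul_le_mul_of_nonneg_left hin (by linarith : 0 ≤ s)
  have h8 := mul_le_mul_of_nonneg_left hbig (by linarith : 0 ≤ s)
  linarith

lemma exists_closest_pair (hp : UnitInput S p) : ∃ x ∈ S, ∃ y ∈ S, ∃ d > 0,
    (x.re - y.re) ^ 2 + (x.im - y.im) ^ 2 = d ^ 2 ∧
    ∀ k ∈ S, ∀ l ∈ S, k ≠ l → d ^ 2 ≤ (k.re - l.re) ^ 2 + (k.im - l.im) ^ 2 := by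
  obtain ⟨x₀, hx₀, y₀, hy₀, hne⟩ := hp.exists_ne
  obtain ⟨q, hq, hmin⟩ := S.offDiag.exists_min_image
    (fun q => (q.1.re - q.2.re) ^ 2 + (q.1.im - q.2.im) ^ 2)
    ⟨(x₀, y₀), Finset.mem_offDiag.2 ⟨hx₀, hy₀, hne⟩⟩
  obtain ⟨h1, h2, h3⟩ := Finset.mem_offDiag.1 hq
  have hpos : 0 < (q.1.re - q.2.re) ^ 2 + (q.1.im - q.2.im) ^ 2 := by
    have h4 : 0 < ‖q.1 - q.2‖ ^ 2 := by
      have := norm_pos_iff.2 (sub_ne_zero.2 h3)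
      positivity
    rw [← Complex.normSq_eq_norm_sq, Complex.normSq_apply] at h4
    simp only [Complex.sub_re, Complex.sub_im] at h4
    nlinarith
  refine ⟨q.1, h1, q.2, h2, Real.sqrt _, Real.sqrt_pos.2 hpos, (Real.sq_sqrt hpos.le).symm,
    fun k hk l hl hkl => ?_⟩
  rw [Real.sq_sqrt hpos.le]
  exact hmin (k, l) (Finset.mem_offDiag.2 ⟨hk, hl, hkl⟩)

/-- Lower bound for the probability that the noise brings `x` near the midpoint of `x` and `y`. -/
lemma le_complexGaussian_rectangle {d γ : ℝ} (hd : 0 < d) (hγ : 1 ≤ γ) {u : ℂ} (hu : ‖u‖ = 1) :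
    2 / Real.sqrt γ * ((Real.sqrt Real.pi)⁻¹ * Real.exp (-(γ * d ^ 2 / 4 + d + 1))) *
      (2 * ((Real.sqrt Real.pi)⁻¹ * Real.exp (-1))) ≤
    complexGaussian.real {z : ℂ |
      ((starRingEnd ℂ) u * z).re ∈ Icc (Real.sqrt γ * d / 2 - 1 / Real.sqrt γ)
        (Real.sqrt γ * d / 2 + 1 / Real.sqrt γ) ∧
      ((starRingEnd ℂ) u * z).im ∈ Icc (-1 : ℝ) 1} := by
  set s := Real.sqrt γ with hs
  have hss : s * s = γ := Real.mul_self_sqrt (by linarith)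
  have hs1 : 1 ≤ s := Real.one_le_sqrt.2 hγ
  have hs0 : 0 < s := by linarith
  have hset : MeasurableSet {z : ℂ | z.re ∈ Icc (s * d / 2 - 1 / s) (s * d / 2 + 1 / s) ∧
      z.im ∈ Icc (-1 : ℝ) 1} :=
    (Complex.measurable_re measurableSet_Icc).inter (Complex.measurable_im measurableSet_Icc)
  have h1 := complexGaussian_map_mul_of_norm_eq_one (u := (starRingEnd ℂ) u) (by simpa using hu)
  have h2 := congrArg (fun μ : Measure ℂ => μ.real {z : ℂ | z.re ∈ Icc (s * d / 2 - 1 / s)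
    (s * d / 2 + 1 / s) ∧ z.im ∈ Icc (-1 : ℝ) 1}) h1
  simp only [measureReal_def] at h2
  rw [Measure.map_apply (by fun_prop) hset] at h2
  have h3 := complexGaussian_real_reProdIm (Icc (s * d / 2 - 1 / s) (s * d / 2 + 1 / s))
    (Icc (-1 : ℝ) 1) measurableSet_Icc measurableSet_Icc
  rw [measureReal_def, ← h2] at h3
  have hinv : 0 < 1 / s := by positivity
  have hinv1 : 1 / s ≤ 1 := (div_le_one hs0).2 hs1
  have hsi : s * (1 / s) = 1 := by field_simp
  refine le_trans ?_ (le_of_eq h3.symm)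
  refine mul_le_mul ?_ ?_ (by positivity) measureReal_nonneg
  -- On the strip, the square of the coordinate is at most (√γ d/2 + 1/√γ)² = γd²/4 + d + 1/γ, and
  -- 1/γ ≤ 1.
  · refine le_trans (le_of_eq ?_) (mul_exp_le_gaussianReal (B := γ * d ^ 2 / 4 + d + 1)
      (by linarith) fun x hx => ?_)
    · ring
    · have hx0 : x ^ 2 ≤ (s * d / 2 + 1 / s) ^ 2 := by
        refine sq_le_sq' ?_ hx.2
        have : 0 < s * d := by positivity
        linarith [hx.1]
      have : (s * d / 2 + 1 / s) ^ 2 = (s * s) * d ^ 2 / 4 + d * (s * (1 / s)) + (1 / s) ^ 2 := by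
        ring
      rw [hss, hsi] at this
      nlinarith
  · refine le_trans (le_of_eq ?_) (mul_exp_le_gaussianReal (B := 1) (by norm_num) fun x hx => ?_)
    · norm_num
    · nlinarith [hx.1, hx.2]

/-- At high SNR, information is concave as a function of the log-SNR. -/
lemma exists_high_snr (hp : UnitInput S p) :
    ∃ Γ > 0, ∀ γ, Γ < γ → mmse S p γ ≤ (1 + γ) * covEnergy S p γ := by
  obtain ⟨x, hx, y, hy, d, hd, hxy, hmin⟩ := hp.exists_closest_pair
  have hne : x ≠ y := by
    rintro rfl
    have : d ^ 2 = 0 := by rw [← hxy]; ring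
    exact hd.ne' (pow_eq_zero_iff two_ne_zero |>.1 this)
  set M := ∑ k ∈ S, ((k.re - x.re) ^ 2 + (k.im - x.im) ^ 2)
  have hM : ∀ k ∈ S, (k.re - x.re) ^ 2 + (k.im - x.im) ^ 2 ≤ M := fun k hk =>
    Finset.single_le_sum (f := fun k : ℂ => (k.re - x.re) ^ 2 + (k.im - x.im) ^ 2)
      (fun _ _ => by positivity) hk
  obtain ⟨u, hu⟩ : ∃ u : ℂ, u = ⟨(y.re - x.re) / d, (y.im - x.im) / d⟩ := ⟨_, rfl⟩
  have hre : y.re = x.re + d * u.re := by simp only [hu]; field_simp; ring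
  have him : y.im = x.im + d * u.im := by simp only [hu]; field_simp; ring
  have hu1 : u.re ^ 2 + u.im ^ 2 = 1 := by
    simp only [hu]
    rw [div_pow, div_pow, ← add_div, div_eq_one_iff_eq (by positivity), ← hxy]
    ring
  have hnu : ‖u‖ = 1 := by
    have h1 : ‖u‖ ^ 2 = 1 := by
      rw [← Complex.normSq_eq_norm_sq, Complex.normSq_apply, ← hu1]; ring
    nlinarith [norm_nonneg u]
  obtain ⟨n, hn⟩ : ∃ n : ℝ, n = S.card := ⟨_, rfl⟩
  have hn0 : 0 < n := by rw [hn]; exact_mod_cast Finset.card_pos.2 ⟨x, hx⟩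
  -- Lower bound for the posterior variance near the midpoint, from `le_mul_postVar` with c = 2d.
  obtain ⟨v, hv⟩ : ∃ v, v = p x * p y * Real.exp (-(2 * d)) * d ^ 2 /
    (n * Real.exp (2 * d)) ^ 2 := ⟨_, rfl⟩
  have hpx := hp.pos x hx
  have hpy := hp.pos y hy
  have hv0 : 0 < v := by rw [hv]; positivity
  obtain ⟨K, hKdef⟩ : ∃ K, K = 1 / 2 * ∑ x ∈ S, ∑ y ∈ S, ((x.re - y.re) ^ 2 + (x.im - y.im) ^ 2) :=
    ⟨_, rfl⟩
  obtain ⟨c, hc⟩ : ∃ c, c = p x * v ^ 2 * (2 * ((Real.sqrt Real.pi)⁻¹ * Real.exp (-(d + 1))) *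
      (2 * ((Real.sqrt Real.pi)⁻¹ * Real.exp (-1)))) := ⟨_, rfl⟩
  have hpi := Real.sqrt_pos.2 Real.pi_pos
  have hc0 : 0 < c := by rw [hc]; positivity
  -- √γ must exceed K/c, for the final comparison of prefactors, and 2(2 + M)/d², for the estimate
  -- near the midpoint.
  obtain ⟨Γ, hΓ⟩ := (Real.tendsto_sqrt_atTop.eventually
    (eventually_ge_atTop (max (K / c) (2 * (2 + M) / d ^ 2)))).exists_forall_of_atTop
  refine ⟨max 1 Γ, by positivity, fun γ hγ => ?_⟩
  have hγ1 : 1 ≤ γ := (le_max_left _ _).trans hγ.le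
  have hγ0 : 0 ≤ γ := by linarith
  have hsq := hΓ γ ((le_max_right _ _).trans hγ.le)
  have hK : K ≤ c * Real.sqrt γ := by
    have := (le_max_left _ _).trans hsq
    rw [div_le_iff₀ hc0] at this
    linarith
  have hbig : 2 * (2 + M) ≤ Real.sqrt γ * d ^ 2 :=
    (div_le_iff₀ (by positivity)).1 ((le_max_right _ _).trans hsq)
  set s := Real.sqrt γ with hs
  have hss : s * s = γ := Real.mul_self_sqrt hγ0
  have hs0 : 0 < s := Real.sqrt_pos.2 (by linarith)
  set A : Set ℂ := {z : ℂ | ((starRingEnd ℂ) u * z).re ∈ Icc (s * d / 2 - 1 / s) (s * d / 2 + 1 /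
      s) ∧
      ((starRingEnd ℂ) u * z).im ∈ Icc (-1 : ℝ) 1} with hA
  have hAm : MeasurableSet A := by
    have hf : Measurable fun z : ℂ => (starRingEnd ℂ) u * z := by fun_prop
    exact ((Complex.measurable_re.comp hf) measurableSet_Icc).inter
      ((Complex.measurable_im.comp hf) measurableSet_Icc)
  have hpost : ∀ z ∈ A, v ≤ postVar S p (s * (s * x.re + z.re)) (s * (s * x.im + z.im)) γ := by
    intro z hz
    obtain ⟨⟨z1, z2⟩, z3, z4⟩ := hz
    set w := (starRingEnd ℂ) u * z with hw
    have hwre : w.re = u.re * z.re + u.im * z.im := by simp [hw]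
    have hwim : w.im = u.re * z.im - u.im * z.re := by simp [hw]; ring
    obtain ⟨h1, h2⟩ := likExp_near_midpoint (S := S) (x := x) (y := y) (u := u) hd hγ1 hM
      (fun k hk h1 h2 => ⟨hmin k hk x hx h1, hmin k hk y hy h2⟩) hre him hu1 hbig
      (r₁ := w.re - s * d / 2) (r₂ := w.im) (by rw [abs_le]; constructor <;> linarith)
      (abs_le.2 ⟨z3, z4⟩) (a := s * (s * x.re + z.re)) (b := s * (s * x.im + z.im))
      (by rw [hwre, hwim]; linear_combination (-s * z.re) * hu1)
      (by rw [hwre, hwim]; linear_combination (-s * z.im) * hu1)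
    have h3 := hp.le_mul_postVar hx hy hne h1 h2
    rw [hxy, ← hn] at h3
    rw [hv, div_le_iff₀ (by positivity)]
    linarith
  have hlow : p x * (v ^ 2 * complexGaussian.real A) ≤ covEnergy S p γ := by
    refine le_trans ?_ (hp.gaussAvg_mul_postVar_sq_le_covEnergy hγ0)
    have tv := hp.tame_postVar.pow 2
    rw [gaussAvg_lik_mul S p tv hγ0]
    have h1 : v ^ 2 * complexGaussian.real A ≤ ∫ z : ℂ,
        postVar S p (s * (s * x.re + z.re)) (s * (s * x.im + z.im)) γ ^ 2 ∂complexGaussian := by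
      have h2 : ∫ z, A.indicator (fun _ => v ^ 2) z ∂complexGaussian =
          v ^ 2 * complexGaussian.real A := by
        rw [integral_indicator_const _ hAm, smul_eq_mul, mul_comm]
      rw [← h2]
      refine integral_mono ((integrable_const _).indicator hAm) (tv.integrable_shift hγ0 x)
        fun z => ?_
      by_cases hz : z ∈ A
      · rw [indicator_of_mem hz]
        exact pow_le_pow_left₀ hv0.le (hpost z hz) 2
      · rw [indicator_of_notMem hz]
        exact sq_nonneg _
    refine (mul_le_mul_of_nonneg_left h1 hpx.le).trans ?_
    exact Finset.single_le_sum (f := fun x : ℂ => p x * ∫ z : ℂ,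
        postVar S p (s * (s * x.re + z.re)) (s * (s * x.im + z.im)) γ ^ 2 ∂complexGaussian)
      (fun k hk => mul_nonneg (hp.pos k hk).le (integral_nonneg fun z => sq_nonneg _)) hx
  have hrect := le_complexGaussian_rectangle hd hγ1 hnu
  have hmm := hp.mmse_le_exp hmin hγ0
  rw [← hKdef] at hmm
  obtain ⟨e, he⟩ : ∃ e, e = Real.exp (-(γ * d ^ 2 / 4)) := ⟨_, rfl⟩
  rw [← he] at hmm
  have he0 : 0 < e := he ▸ Real.exp_pos _
  have h1 : c * e / s ≤ covEnergy S p γ := by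
    refine le_trans ?_ hlow
    have h2 : Real.exp (-(γ * d ^ 2 / 4 + d + 1)) = e * Real.exp (-(d + 1)) := by
      rw [he, ← Real.exp_add]; congr 1; ring
    rw [h2] at hrect
    have h3 := mul_le_mul_of_nonneg_left hrect (by positivity : 0 ≤ p x * v ^ 2)
    rw [← mul_assoc]
    refine le_trans (le_of_eq ?_) h3
    rw [hc]
    ring
  -- The strip of width of order 1/√γ costs a factor 1/√γ, and multiplication by γ gains √γ, which
  -- finally beats the constant `K` in the bound on the MMSE.
  have h4 : c * s * e ≤ γ * covEnergy S p γ := by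
    have := mul_le_mul_of_nonneg_left h1 hγ0
    refine le_trans (le_of_eq ?_) this
    rw [← hss]
    field_simp
  have h5 : 0 ≤ covEnergy S p γ := le_trans (by positivity) h1
  have h6 := mul_le_mul_of_nonneg_right hK he0.le
  linarith

end UnitInput

/-! ### Concave envelopes -/

section Envelope

variable {f : ℝ → ℝ} {B : ℝ}

/-- The constant `B` is a concave majorant, so the infimum is over a nonempty set and is not a
default value. -/
lemma le_concaveEnvelope (hB : ∀ s ∈ Ici (0 : ℝ), f s ≤ B) {ζ : ℝ} (hζ : 0 ≤ ζ) :
    f ζ ≤ concaveEnvelope f ζ := by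
  refine le_csInf ⟨B, fun _ => B, concaveOn_const _ (convex_Ici 0), hB, rfl⟩ ?_
  rintro v ⟨g, _, hg, rfl⟩
  exact hg ζ hζ

lemma concaveEnvelope_le {g : ℝ → ℝ} (hg : ConcaveOn ℝ (Ici 0) g)
    (hfg : ∀ s ∈ Ici (0 : ℝ), f s ≤ g s) {ζ : ℝ} (hζ : 0 ≤ ζ) : concaveEnvelope f ζ ≤ g ζ := by
  refine csInf_le ⟨f ζ, ?_⟩ ⟨g, hg, hfg, rfl⟩
  rintro v ⟨g, _, hg, rfl⟩
  exact hg ζ hζ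

lemma concaveOn_concaveEnvelope (hB : ∀ s ∈ Ici (0 : ℝ), f s ≤ B) :
    ConcaveOn ℝ (Ici 0) (concaveEnvelope f) := by
  refine ⟨convex_Ici 0, fun x hx y hy a b ha hb hab => ?_⟩
  refine le_csInf ⟨B, fun _ => B, concaveOn_const _ (convex_Ici 0), hB, rfl⟩ ?_
  rintro v ⟨g, hg, hfg, rfl⟩
  refine le_trans ?_ (hg.2 hx hy ha hb hab)
  exact add_le_add (mul_le_mul_of_nonneg_left (concaveEnvelope_le hg hfg hx) ha)
    (mul_le_mul_of_nonneg_left (concaveEnvelope_le hg hfg hy) hb)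

lemma concaveOn_affine (c m ζ : ℝ) : ConcaveOn ℝ (Ici 0) fun s : ℝ => c + m * (s - ζ) :=
  ⟨convex_Ici 0, fun x _ y _ a b _ _ hab => by
    simp only [smul_eq_mul]
    have hb : b = 1 - a := by linarith
    rw [hb]
    apply le_of_eq
    ring⟩

lemma concaveEnvelope_le_of_affine {c m ζ : ℝ} (hζ : 0 ≤ ζ)
    (h : ∀ s ∈ Ici (0 : ℝ), f s ≤ c + m * (s - ζ)) : concaveEnvelope f ζ ≤ c := by
  simpa using concaveEnvelope_le (concaveOn_affine c m ζ) h hζ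

lemma concaveEnvelope_eq_of_concaveOn (hf : ConcaveOn ℝ (Ici 0) f) (hB : ∀ s ∈ Ici (0 : ℝ), f s ≤ B)
    {ζ : ℝ} (hζ : 0 ≤ ζ) : concaveEnvelope f ζ = f ζ :=
  le_antisymm (concaveEnvelope_le hf (fun _ _ => le_rfl) hζ) (le_concaveEnvelope hB hζ)

/-- If no chord of `f` passes above `(ζ, c)`, then neither does the concave envelope. -/
lemma concaveEnvelope_le_of_chords {ζ c : ℝ} (hζ : 0 < ζ) (hc : f ζ ≤ c)
    (hchord : ∀ s t, 0 ≤ s → s < ζ → ζ < t →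
      (ζ - s) * (f t - c) ≤ (t - ζ) * (c - f s)) : concaveEnvelope f ζ ≤ c := by
  -- Slopes from (ζ, c) to points of the graph on the right. Each is at most every slope from the
  -- left, so their supremum is the slope of a line through (ζ, c) above `f`; positivity of ζ
  -- provides a left point that bounds them.
  set M : Set ℝ := (fun t => (f t - c) / (t - ζ)) '' Ioi ζ with hM
  have hub : ∀ s, 0 ≤ s → s < ζ → ∀ v ∈ M, v ≤ (c - f s) / (ζ - s) := by
    rintro s hs0 hs v ⟨t, ht, rfl⟩
    simp only [mem_Ioi] at ht
    rw [div_le_div_iff₀ (by linarith) (by linarith)]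
    linarith [hchord s t hs0 hs ht]
  have hne : M.Nonempty := ⟨_, ζ + 1, by simp, rfl⟩
  have hbdd : BddAbove M := ⟨_, fun v hv => hub 0 le_rfl hζ v hv⟩
  refine concaveEnvelope_le_of_affine (m := sSup M) hζ.le fun s hs => ?_
  rcases lt_trichotomy s ζ with h | rfl | h
  · have h1 : sSup M ≤ (c - f s) / (ζ - s) := csSup_le hne (hub s hs h)
    rw [le_div_iff₀ (by linarith)] at h1
    linarith
  · simpa using hc
  · have h1 : (f s - c) / (s - ζ) ≤ sSup M := le_csSup hbdd ⟨s, h, rfl⟩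
    rw [div_le_iff₀ (by linarith)] at h1
    linarith

end Envelope

/-! ### Log-SNR curves: continuity of the envelope, the maximal gap, and contact near 0 and
infinity. -/

/-- The analytic properties of the information as a function `f` of the log-SNR, with derivative
`f'`. -/
structure LogCurve (f f' : ℝ → ℝ) : Prop where
  cont : ContinuousOn f (Ici 0)
  zero : f 0 = 0
  hasDerivAt : ∀ s, 0 < s → HasDerivAt f (f' s) s
  deriv_pos : ∀ s, 0 < s → 0 < f' s
  deriv_lt_one : ∀ s, 0 < s → f' s < 1
  deriv_tendsto : Tendsto f' (𝓝[>] 0) (𝓝 1)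
  bounded : ∃ B, ∀ s ∈ Ici (0 : ℝ), f s ≤ B
  low : ∃ ε > 0, AntitoneOn f' (Ioo 0 ε)
  high : ∃ Z ≥ 0, AntitoneOn f' (Ioi Z)

namespace LogCurve

variable {f f' : ℝ → ℝ}

lemma deriv_eq (hf : LogCurve f f') {s : ℝ} (hs : 0 < s) : deriv f s = f' s :=
  (hf.hasDerivAt s hs).deriv

lemma strictMonoOn (hf : LogCurve f f') : StrictMonoOn f (Ici 0) := by
  refine strictMonoOn_of_deriv_pos (convex_Ici 0) hf.cont fun s hs => ?_
  rw [interior_Ici] at hs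
  rw [hf.deriv_eq hs]
  exact hf.deriv_pos s hs

lemma strictMonoOn_sub (hf : LogCurve f f') : StrictMonoOn (fun s => s - f s) (Ici 0) := by
  refine strictMonoOn_of_deriv_pos (convex_Ici 0) (continuousOn_id.sub hf.cont) fun s hs => ?_
  rw [interior_Ici] at hs
  have h : HasDerivAt (fun s => s - f s) (1 - f' s) s := (hasDerivAt_id s).sub (hf.hasDerivAt s hs)
  rw [h.deriv]
  linarith [hf.deriv_lt_one s hs]

lemma nonneg (hf : LogCurve f f') {s : ℝ} (hs : 0 ≤ s) : 0 ≤ f s := by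
  rw [← hf.zero]
  exact hf.strictMonoOn.monotoneOn self_mem_Ici hs hs

lemma le_self (hf : LogCurve f f') {s : ℝ} (hs : 0 ≤ s) : f s ≤ s := by
  have h := hf.strictMonoOn_sub.monotoneOn (a := 0) self_mem_Ici hs hs
  simp only [hf.zero] at h
  linarith

lemma concaveOn_of_antitoneOn (hf : LogCurve f f') {D : Set ℝ} (hD : Convex ℝ D) (h0 : D ⊆ Ici 0)
    (h : AntitoneOn f' (interior D)) : ConcaveOn ℝ D f := by
  have hpos : ∀ s ∈ interior D, 0 < s := fun s hs => by
    have := interior_mono h0 hs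
    rwa [interior_Ici] at this
  refine AntitoneOn.concaveOn_of_deriv hD (hf.cont.mono h0)
    (fun s hs => (hf.hasDerivAt s (hpos s hs)).differentiableAt.differentiableWithinAt)
    fun s hs t ht hst => ?_
  rw [hf.deriv_eq (hpos s hs), hf.deriv_eq (hpos t ht)]
  exact h hs ht hst

lemma antitoneOn_of_concaveOn (hf : LogCurve f f') {D : Set ℝ} (hD : ∀ s ∈ D, 0 < s)
    (h : ConcaveOn ℝ D f) : AntitoneOn f' D := by
  have h1 := h.antitoneOn_deriv fun s hs => (hf.hasDerivAt s (hD s hs)).differentiableAt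
  intro s hs t ht hst
  rw [← hf.deriv_eq (hD s hs), ← hf.deriv_eq (hD t ht)]
  exact h1 hs ht hst

lemma concaveOn_Icc_iff (hf : LogCurve f f') {b : ℝ} :
    ConcaveOn ℝ (Icc 0 b) f ↔ AntitoneOn f' (Ioo 0 b) := by
  constructor
  · intro h
    exact hf.antitoneOn_of_concaveOn (fun s hs => hs.1) (h.subset Ioo_subset_Icc_self (convex_Ioo
        0 b))
  · intro h
    refine hf.concaveOn_of_antitoneOn (convex_Icc 0 b) (fun s hs => hs.1) ?_
    rwa [interior_Icc]

lemma concaveOn_Ici_iff (hf : LogCurve f f') {a : ℝ} (ha : 0 ≤ a) :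
    ConcaveOn ℝ (Ici a) f ↔ AntitoneOn f' (Ioi a) := by
  constructor
  · intro h
    exact hf.antitoneOn_of_concaveOn (fun s hs => ha.trans_lt hs) (h.subset Ioi_subset_Ici_self
        (convex_Ioi a))
  · intro h
    refine hf.concaveOn_of_antitoneOn (convex_Ici a) (fun s hs => ha.trans hs) ?_
    rwa [interior_Ici]

lemma le_tangent (hf : LogCurve f f') {D : Set ℝ} (h : ConcaveOn ℝ D f) {s t : ℝ} (hs : s ∈ D)
    (ht : t ∈ D) (hs0 : 0 < s) : f t ≤ f s + f' s * (t - s) := by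
  rcases lt_trichotomy t s with hlt | rfl | hlt
  · have h1 := h.le_slope_of_hasDerivAt ht hs hlt (hf.hasDerivAt s hs0)
    rw [slope_def_field, le_div_iff₀ (by linarith)] at h1
    linarith
  · simp
  · have h1 := h.slope_le_of_hasDerivAt hs ht hlt (hf.hasDerivAt s hs0)
    rw [slope_def_field, div_le_iff₀ (by linarith)] at h1
    linarith

lemma le_envelope (hf : LogCurve f f') {s : ℝ} (hs : 0 ≤ s) : f s ≤ concaveEnvelope f s := by
  obtain ⟨B, hB⟩ := hf.bounded
  exact le_concaveEnvelope hB hs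

lemma concaveOn_envelope (hf : LogCurve f f') : ConcaveOn ℝ (Ici 0) (concaveEnvelope f) := by
  obtain ⟨B, hB⟩ := hf.bounded
  exact concaveOn_concaveEnvelope hB

lemma envelope_zero (hf : LogCurve f f') : concaveEnvelope f 0 = 0 := by
  refine le_antisymm (concaveEnvelope_le_of_affine (m := 1) le_rfl fun s hs => ?_) ?_
  · linarith [hf.le_self hs]
  · have := hf.le_envelope le_rfl
    rwa [hf.zero] at this

lemma envelope_le_self (hf : LogCurve f f') {s : ℝ} (hs : 0 ≤ s) : concaveEnvelope f s ≤ s :=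
  concaveEnvelope_le (concaveOn_id (convex_Ici 0)) (fun _ ht => hf.le_self ht) hs

/-- Concavity gives continuity in the interior only; at 0 the envelope is squeezed between 0 and
`s`. -/
lemma continuousOn_envelope (hf : LogCurve f f') : ContinuousOn (concaveEnvelope f) (Ici 0) := by
  intro s hs
  rcases eq_or_lt_of_le (mem_Ici.1 hs) with rfl | hs
  · have h0 : Tendsto (fun s : ℝ => s) (𝓝[Ici 0] 0) (𝓝 0) := tendsto_id.mono_left inf_le_left
    rw [ContinuousWithinAt, hf.envelope_zero]
    refine tendsto_of_tendsto_of_tendsto_of_le_of_le' tendsto_const_nhds h0 ?_ ?_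
    · filter_upwards [self_mem_nhdsWithin] with s hs
      exact (hf.nonneg hs).trans (hf.le_envelope hs)
    · filter_upwards [self_mem_nhdsWithin] with s hs
      exact hf.envelope_le_self hs
  · have h := hf.concaveOn_envelope.continuousOn_interior
    rw [interior_Ici] at h
    exact ((h s hs).continuousAt (Ioi_mem_nhds hs)).continuousWithinAt

/-- The supremum of `f` is a strict upper bound, the limit at infinity, and an upper bound for the
envelope. -/
lemma exists_limit (hf : LogCurve f f') : ∃ M, (∀ s, 0 ≤ s → f s < M) ∧
    (∀ s, 0 ≤ s → concaveEnvelope f s ≤ M) ∧ ∀ c < M, ∃ T ≥ 0, ∀ s, T ≤ s → c < f s := by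
  obtain ⟨B, hB⟩ := hf.bounded
  set M := sSup (f '' Ici 0)
  have hbdd : BddAbove (f '' Ici 0) := ⟨B, by rintro _ ⟨s, hs, rfl⟩; exact hB s hs⟩
  have hle : ∀ s ∈ Ici (0 : ℝ), f s ≤ M := fun s hs => le_csSup hbdd ⟨s, hs, rfl⟩
  refine ⟨M, fun s hs => ?_, fun s hs => ?_, fun c hc => ?_⟩
  · exact (hf.strictMonoOn (a := s) (b := s + 1) hs (by simp; linarith) (by linarith)).trans_le
      (hle _ (by simp; linarith))
  · exact concaveEnvelope_le (concaveOn_const _ (convex_Ici 0)) hle hs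
  · obtain ⟨_, ⟨T, hT, rfl⟩, hcT⟩ := exists_lt_of_lt_csSup
      (nonempty_Ici.image f) hc
    exact ⟨T, hT, fun s hs => hcT.trans_le (hf.strictMonoOn.monotoneOn hT (le_trans hT hs) hs)⟩

/-- The gap between the envelope and the curve has a maximum. -/
lemma exists_max_gap (hf : LogCurve f f') : ∃ s, 0 ≤ s ∧ ∀ t, 0 ≤ t →
    concaveEnvelope f t - f t ≤ concaveEnvelope f s - f s := by
  by_cases hpos : ∃ s, 0 ≤ s ∧ 0 < concaveEnvelope f s - f s
  · obtain ⟨s₀, hs₀, hg⟩ := hpos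
    obtain ⟨M, -, h2, h3⟩ := hf.exists_limit
    -- Beyond `T` the curve is so close to its supremum, which bounds the envelope, that the gap is
    -- below its value at `s₀`; a maximum over a compact interval is then global.
    obtain ⟨T, hT, hT'⟩ := h3 (M - (concaveEnvelope f s₀ - f s₀)) (by linarith)
    obtain ⟨s, hs, hmax⟩ := (isCompact_Icc (a := (0 : ℝ)) (b := max T s₀)).exists_isMaxOn
      ⟨s₀, hs₀, le_max_right _ _⟩ ((hf.continuousOn_envelope.sub hf.cont).mono fun s hs => hs.1)
    refine ⟨s, hs.1, fun t ht => ?_⟩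
    by_cases htT : t ≤ max T s₀
    · exact hmax ⟨ht, htT⟩
    · have h4 := hmax (⟨hs₀, le_max_right _ _⟩ : s₀ ∈ Icc 0 (max T s₀))
      simp only [mem_ofPred_eq, Pi.sub_apply] at h4
      have h5 := hT' t ((le_max_left _ _).trans (not_le.1 htT).le)
      have h6 := h2 t ht
      linarith
  · push Not at hpos
    exact ⟨0, le_rfl, fun t ht => by rw [hf.envelope_zero, hf.zero]; linarith [hpos t ht]⟩

/-- The gap at a point is the supremum of the excesses of the chords there. -/
lemma chord_le (hf : LogCurve f f') {s ζ t : ℝ} (hs : 0 ≤ s) (hsζ : s ≤ ζ) (hζt : ζ ≤ t)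
    (hst : s < t) :
    ((ζ - s) * (f t - f ζ) - (t - ζ) * (f ζ - f s)) / (t - s) ≤ concaveEnvelope f ζ - f ζ := by
  have hts : 0 < t - s := by linarith
  have hconc := hf.concaveOn_envelope.2 (show s ∈ Ici 0 from hs) (show t ∈ Ici 0 from hs.trans
      hst.le)
    (div_nonneg (by linarith) hts.le : 0 ≤ (t - ζ) / (t - s))
    (div_nonneg (by linarith) hts.le : 0 ≤ (ζ - s) / (t - s)) (by field_simp; ring)
  have hpt : (t - ζ) / (t - s) * s + (ζ - s) / (t - s) * t = ζ := by field_simp; ring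
  simp only [smul_eq_mul] at hconc
  rw [hpt] at hconc
  have h1 := mul_le_mul_of_nonneg_left (hf.le_envelope hs)
    (div_nonneg (by linarith : 0 ≤ t - ζ) hts.le)
  have h2 := mul_le_mul_of_nonneg_left (hf.le_envelope (by linarith : 0 ≤ t))
    (div_nonneg (by linarith : 0 ≤ ζ - s) hts.le)
  have h3 : ((ζ - s) * (f t - f ζ) - (t - ζ) * (f ζ - f s)) / (t - s) =
      (t - ζ) / (t - s) * f s + (ζ - s) / (t - s) * f t - f ζ := by field_simp; ring
  rw [h3]
  linarith

lemma gap_le_of_chords (hf : LogCurve f f') {ζ U : ℝ} (hζ : 0 ≤ ζ) (hU : 0 ≤ U)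
    (h : ∀ s t, 0 ≤ s → s ≤ ζ → ζ ≤ t → s < t →
      ((ζ - s) * (f t - f ζ) - (t - ζ) * (f ζ - f s)) / (t - s) ≤ U) :
    concaveEnvelope f ζ - f ζ ≤ U := by
  -- At ζ = 0 there is no point on the left to bound the slopes, but there the envelope and the
  -- curve both vanish.
  rcases eq_or_lt_of_le hζ with rfl | hζ
  · rwa [hf.envelope_zero, hf.zero, sub_zero]
  · have := concaveEnvelope_le_of_chords (f := f) (c := f ζ + U) hζ (by linarith)
      fun s t hs hsζ hζt => by
        have h1 := h s t hs hsζ.le hζt.le (hsζ.trans hζt)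
        rw [div_le_iff₀ (by linarith)] at h1
        nlinarith
    linarith

/-- The envelope touches the curve near zero. -/
lemma exists_touch_low (hf : LogCurve f f') :
    ∃ ε > 0, ∀ s, 0 ≤ s → s ≤ ε → concaveEnvelope f s = f s := by
  obtain ⟨ε, hε, hanti⟩ := hf.low
  obtain ⟨B, hB⟩ := hf.bounded
  have hconc := hf.concaveOn_Icc_iff.2 hanti
  set δ := ε / 2 with hδ
  have hδ0 : 0 < δ := by positivity
  set c := δ - f δ with hc
  have hc0 : 0 < c := by
    have := hf.strictMonoOn_sub (a := 0) (b := δ) self_mem_Ici hδ0.le hδ0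
    simp only [hf.zero] at this
    linarith
  have hB0 : 0 ≤ B := by have := hB 0 self_mem_Ici; rwa [hf.zero] at this
  -- The crossover between the two upper bounds t - c and B for f(t). The tangent at a small `s` is
  -- at least f'(s) t - s, and it exceeds both bounds once T(1 - f'(s)) + s < c.
  set T := B + c with hT
  have hlim : Tendsto (fun s => T * (1 - f' s) + s) (𝓝[>] 0) (𝓝 0) := by
    have h1 : Tendsto (fun s : ℝ => s) (𝓝[>] 0) (𝓝 0) := tendsto_id.mono_left inf_le_left
    have h2 := ((tendsto_const_nhds (x := (1 : ℝ))).sub hf.deriv_tendsto).const_mul T |>.add h1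
    simpa using h2
  have hev := hlim.eventually (gt_mem_nhds hc0)
  rw [eventually_nhdsWithin_iff] at hev
  obtain ⟨η, hη, hη'⟩ := Metric.eventually_nhds_iff.1 hev
  refine ⟨min δ (η / 2), by positivity, fun s hs0 hs => ?_⟩
  refine le_antisymm ?_ (hf.le_envelope hs0)
  rcases eq_or_lt_of_le hs0 with rfl | hs0
  · rw [hf.envelope_zero, hf.zero]
  have hsδ : s ≤ δ := hs.trans (min_le_left _ _)
  have hsη : s < η := by have := hs.trans (min_le_right _ _); linarith
  have hkey : T * (1 - f' s) + s < c :=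
    hη' (by rw [Real.dist_eq, sub_zero, abs_of_pos hs0]; exact hsη) hs0
  have hd0 := hf.deriv_pos s hs0
  have hd1 := hf.deriv_lt_one s hs0
  refine concaveEnvelope_le_of_affine (m := f' s) hs0.le fun t ht => ?_
  have ht0 : 0 ≤ t := ht
  have hfs := hf.nonneg hs0.le
  rcases le_or_gt t ε with hle | hlt
  · exact hf.le_tangent hconc ⟨hs0.le, by linarith⟩ ⟨ht, hle⟩ hs0
  · have h1 : f t ≤ t - c := by
      have := hf.strictMonoOn_sub.monotoneOn (a := δ) (b := t) hδ0.le ht (by linarith)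
      linarith
    have h2 := hB t ht
    have hsf : f' s * s ≤ s := by nlinarith
    rcases le_total t T with htT | htT
    · have : t * (1 - f' s) ≤ T * (1 - f' s) := mul_le_mul_of_nonneg_right htT (by linarith)
      nlinarith
    · have : f' s * T ≤ f' s * t := mul_le_mul_of_nonneg_left htT hd0.le
      nlinarith

/-- The envelope touches the curve near infinity. -/
lemma exists_touch_high (hf : LogCurve f f') :
    ∃ Z ≥ 0, ∀ s, Z ≤ s → concaveEnvelope f s = f s := by
  obtain ⟨Z, hZ, hanti⟩ := hf.high
  obtain ⟨M, h1, -, h3⟩ := hf.exists_limit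
  have hconc := (hf.concaveOn_Ici_iff hZ).2 hanti
  -- This level is chosen so that 2 f(s/2) - f(s) > (M + f(Z)) - M = f(Z) for the points `s`
  -- considered.
  obtain ⟨T, hT, hT'⟩ := h3 ((M + f Z) / 2) (by linarith [h1 Z hZ])
  refine ⟨2 * max (Z + 1) T, by positivity, fun s hs => ?_⟩
  have hsZ : Z < s / 2 := by linarith [le_max_left (Z + 1) T]
  have hs0 : 0 < s := by linarith
  refine le_antisymm ?_ (hf.le_envelope hs0.le)
  refine concaveEnvelope_le_of_affine (m := f' s) hs0.le fun t ht => ?_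
  rcases le_or_gt Z t with hle | hlt
  · exact hf.le_tangent hconc (show Z ≤ s by linarith) hle hs0
  -- Comparing f(s/2) with the tangent at `s` gives s f'(s) ≤ 2(f(s) - f(s/2)). The tangent at t ≥ 0
  -- is therefore at least 2 f(s/2) - f(s), above f(Z) ≥ f(t).
  · have h4 := hf.le_tangent hconc (s := s) (t := s / 2) (show Z ≤ s by linarith) hsZ.le hs0
    have h5 := hT' (s / 2) (by linarith [le_max_right (Z + 1) T])
    have h6 := h1 s hs0.le
    have h7 : f t ≤ f Z := hf.strictMonoOn.monotoneOn ht hZ hlt.le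
    have h8 : 0 ≤ f' s * t := mul_nonneg (hf.deriv_pos s hs0).le ht
    nlinarith

/-- Concavity near zero and near infinity on overlapping intervals gives global concavity. -/
lemma concaveOn_of_overlap (hf : LogCurve f f') {a b : ℝ} (ha : 0 ≤ a) (hab : a < b)
    (h1 : AntitoneOn f' (Ioo 0 b)) (h2 : AntitoneOn f' (Ioi a)) : ConcaveOn ℝ (Ici 0) f := by
  rw [hf.concaveOn_Ici_iff le_rfl]
  intro s hs t ht hst
  by_cases htb : t < b
  · exact h1 ⟨hs, hst.trans_lt htb⟩ ⟨ht, htb⟩ hst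
  by_cases hsa : a < s
  · exact h2 hsa (hsa.trans_le hst) hst
  · obtain ⟨m, hm1, hm2⟩ := exists_between hab
    have hm0 : 0 < m := ha.trans_lt hm1
    have e1 : f' m ≤ f' s := h1 ⟨hs, (not_lt.1 hsa).trans_lt hab⟩ ⟨hm0, hm2⟩
      ((not_lt.1 hsa).trans hm1.le)
    have e2 : f' t ≤ f' m := h2 hm1 (hab.trans_le (not_lt.1 htb)) (hm2.le.trans (not_lt.1 htb))
    exact e2.trans e1

end LogCurve

/-! ### Thresholds -/

/-- The supremum belongs to the set: every smaller point satisfies `Q` by heredity, and `hclosed`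
passes to the limit. -/
lemma exists_isGreatest_of_closed {Q : ℝ → Prop} (h0 : ∃ b > 0, Q b)
    (hmono : ∀ a b, 0 ≤ a → a ≤ b → Q b → Q a)
    (hclosed : ∀ b, 0 < b → (∀ a, 0 ≤ a → a < b → Q a) → Q b)
    (hbdd : ∃ c, ∀ a, 0 ≤ a → Q a → a ≤ c) : ∃ z > 0, IsGreatest {ζ | 0 ≤ ζ ∧ Q ζ} z := by
  obtain ⟨b, hb, hQb⟩ := h0
  obtain ⟨c, hc⟩ := hbdd
  have hbd : BddAbove {ζ | 0 ≤ ζ ∧ Q ζ} := ⟨c, fun a ha => hc a ha.1 ha.2⟩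
  have hz : b ≤ sSup {ζ | 0 ≤ ζ ∧ Q ζ} := le_csSup hbd ⟨hb.le, hQb⟩
  refine ⟨sSup {ζ | 0 ≤ ζ ∧ Q ζ}, hb.trans_le hz, ⟨(hb.trans_le hz).le, ?_⟩,
    fun a ha => le_csSup hbd ha⟩
  refine hclosed _ (hb.trans_le hz) fun a ha hlt => ?_
  obtain ⟨d, hd, had⟩ := exists_lt_of_lt_csSup (show {ζ | 0 ≤ ζ ∧ Q ζ}.Nonempty from
    ⟨b, hb.le, hQb⟩) hlt
  exact hmono a d ha had.le hd.2

lemma exists_isLeast_of_closed {Q : ℝ → Prop} (h0 : ∃ b ≥ 0, Q b)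
    (hmono : ∀ a b, 0 ≤ a → a ≤ b → Q a → Q b)
    (hclosed : ∀ a, 0 ≤ a → (∀ b, a < b → Q b) → Q a) :
    ∃ z ≥ 0, IsLeast {ζ | 0 ≤ ζ ∧ Q ζ} z := by
  obtain ⟨b, hb, hQb⟩ := h0
  have hbd : BddBelow {ζ | 0 ≤ ζ ∧ Q ζ} := ⟨0, fun a ha => ha.1⟩
  have hz : 0 ≤ sInf {ζ | 0 ≤ ζ ∧ Q ζ} := le_csInf ⟨b, hb, hQb⟩ fun a ha => ha.1
  refine ⟨sInf {ζ | 0 ≤ ζ ∧ Q ζ}, hz, ⟨hz, ?_⟩, fun a ha => csInf_le hbd ha⟩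
  refine hclosed _ hz fun a hlt => ?_
  obtain ⟨d, hd, had⟩ := exists_lt_of_csInf_lt (show {ζ | 0 ≤ ζ ∧ Q ζ}.Nonempty from
    ⟨b, hb, hQb⟩) hlt
  exact hmono d a hd.1 had.le hd.2

namespace LogCurve

variable {f f' : ℝ → ℝ}

lemma exists_thresholds (hf : LogCurve f f') (hgap : ∃ s, 0 ≤ s ∧ concaveEnvelope f s ≠ f s) :
    ∃ z₁ z₀ z₀' z₂ : ℝ, 0 < z₁ ∧ z₁ ≤ z₀ ∧ z₀ ≤ z₀' ∧ z₀' ≤ z₂ ∧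
      IsGreatest {z | 0 ≤ z ∧ ∀ ζ ∈ Icc 0 z, concaveEnvelope f ζ = f ζ} z₁ ∧
      IsGreatest {z | 0 ≤ z ∧ ConcaveOn ℝ (Icc 0 z) f} z₀ ∧
      IsLeast {z | 0 ≤ z ∧ ConcaveOn ℝ (Ici z) f} z₀' ∧
      IsLeast {z | 0 ≤ z ∧ ∀ ζ ∈ Ici z, concaveEnvelope f ζ = f ζ} z₂ := by
  obtain ⟨s₀, hs₀, hne⟩ := hgap
  obtain ⟨B, hB⟩ := hf.bounded
  have hnc : ¬ ConcaveOn ℝ (Ici 0) f := fun h =>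
    hne (concaveEnvelope_eq_of_concaveOn h hB hs₀)
  have hcont : ∀ ζ, 0 < ζ → ContinuousAt (fun s => concaveEnvelope f s - f s) ζ := fun ζ hζ =>
    (hf.continuousOn_envelope.sub hf.cont).continuousAt (Ici_mem_nhds hζ)
  obtain ⟨z₀', hz₀', hl0⟩ := exists_isLeast_of_closed (Q := fun z => ConcaveOn ℝ (Ici z) f)
    (by
      obtain ⟨Z, hZ, h⟩ := hf.high
      exact ⟨Z, hZ, (hf.concaveOn_Ici_iff hZ).2 h⟩)
    (fun a b _ hab h => h.subset (Ici_subset_Ici.2 hab) (convex_Ici b))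
    (fun a ha h => by
      rw [hf.concaveOn_Ici_iff ha]
      intro s hs t ht hst
      obtain ⟨b, hab, hbs⟩ := exists_between (mem_Ioi.1 hs)
      exact (hf.concaveOn_Ici_iff (ha.trans hab.le)).1 (h b hab) hbs (hbs.trans_le hst) hst)
  obtain ⟨z₂, hz₂, hl2⟩ := exists_isLeast_of_closed
    (Q := fun z => ∀ ζ ∈ Ici z, concaveEnvelope f ζ = f ζ) hf.exists_touch_high
    (fun a b _ hab h ζ hζ => h ζ (hab.trans hζ))
    (fun a ha h ζ hζ => by
      rcases eq_or_lt_of_le (mem_Ici.1 hζ) with rfl | hlt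
      · rcases eq_or_lt_of_le ha with rfl | ha
        · rw [hf.envelope_zero, hf.zero]
        · have h1 : Tendsto (fun s => concaveEnvelope f s - f s) (𝓝[>] a)
              (𝓝 (concaveEnvelope f a - f a)) := (hcont a ha).tendsto.mono_left inf_le_left
          have h2 : Tendsto (fun s => concaveEnvelope f s - f s) (𝓝[>] a) (𝓝 0) := by
            refine tendsto_const_nhds.congr' ?_
            filter_upwards [self_mem_nhdsWithin] with s hs
            rw [h s hs s self_mem_Ici, sub_self]
          exact sub_eq_zero.1 (tendsto_nhds_unique h1 h2)
      · exact h ζ hlt ζ self_mem_Ici)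
  -- Overlapping intervals of concavity would make `f` concave on the whole half-line, hence equal
  -- to its envelope, against the positive gap.
  have hbound : ∀ a, 0 ≤ a → ConcaveOn ℝ (Icc 0 a) f → a ≤ z₀' := by
    intro a _ h
    by_contra! hlt
    exact hnc (hf.concaveOn_of_overlap hz₀' hlt (hf.concaveOn_Icc_iff.1 h)
      ((hf.concaveOn_Ici_iff hz₀').1 hl0.1.2))
  obtain ⟨z₀, hz₀, hg0⟩ := exists_isGreatest_of_closed (Q := fun z => ConcaveOn ℝ (Icc 0 z) f)
    (by
      obtain ⟨ε, hε, h⟩ := hf.low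
      exact ⟨ε, hε, hf.concaveOn_Icc_iff.2 h⟩)
    (fun a b _ hab h => h.subset (Icc_subset_Icc_right hab) (convex_Icc 0 a))
    (fun b hb h => by
      rw [hf.concaveOn_Icc_iff]
      intro s hs t ht hst
      obtain ⟨a, hta, hab⟩ := exists_between ht.2
      exact hf.concaveOn_Icc_iff.1 (h a (ht.1.le.trans hta.le) hab) ⟨hs.1, hst.trans_lt hta⟩
        ⟨ht.1, hta⟩ hst)
    ⟨z₀', hbound⟩
  obtain ⟨z₁, hz₁, hg1⟩ := exists_isGreatest_of_closed
    (Q := fun z => ∀ ζ ∈ Icc 0 z, concaveEnvelope f ζ = f ζ)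
    (by
      obtain ⟨ε, hε, h⟩ := hf.exists_touch_low
      exact ⟨ε, hε, fun ζ hζ => h ζ hζ.1 hζ.2⟩)
    (fun a b _ hab h ζ hζ => h ζ ⟨hζ.1, hζ.2.trans hab⟩)
    (fun b hb h ζ hζ => by
      rcases eq_or_lt_of_le hζ.2 with rfl | hlt
      · have h1 : Tendsto (fun s => concaveEnvelope f s - f s) (𝓝[<] ζ)
            (𝓝 (concaveEnvelope f ζ - f ζ)) := (hcont ζ hb).tendsto.mono_left inf_le_left
        have h2 : Tendsto (fun s => concaveEnvelope f s - f s) (𝓝[<] ζ) (𝓝 0) := by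
          refine tendsto_const_nhds.congr' ?_
          filter_upwards [self_mem_nhdsWithin, mem_nhdsWithin_of_mem_nhds (Ioi_mem_nhds hb)] with
            s hs hs0
          rw [h s (le_of_lt hs0) hs s ⟨le_of_lt hs0, le_rfl⟩, sub_self]
        exact sub_eq_zero.1 (tendsto_nhds_unique h1 h2)
      · exact h ζ hζ.1 hlt ζ ⟨hζ.1, le_rfl⟩)
    ⟨s₀, fun a ha h => by
      by_contra! hlt
      exact hne (h s₀ ⟨hs₀, hlt.le⟩)⟩
  -- The outer inequalities hold because `f` inherits the concavity of its envelope wherever the two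
  -- coincide.
  refine ⟨z₁, z₀, z₀', z₂, hz₁, hg0.2 ⟨hz₁.le, ?_⟩, hbound z₀ hz₀.le hg0.1.2, hl0.2 ⟨hz₂, ?_⟩,
    hg1, hg0, hl0, hl2⟩
  · exact (hf.concaveOn_envelope.subset (fun s hs => hs.1) (convex_Icc 0 z₁)).congr
      fun s hs => hg1.1.2 s hs
  · exact (hf.concaveOn_envelope.subset (fun s hs => hz₂.le.trans hs) (convex_Ici z₂)).congr
      fun s hs => hl2.1.2 s hs

end LogCurve

/-! ### The information as a function of the log-SNR -/

/-- Points of zero mass are discarded: the entropy bound and the minimum-distance estimates use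
strictly positive weights. -/
lemma exists_unitInput (P : Measure ℂ) [IsProbabilityMeasure P] {S : Finset ℂ}
    (hS : P ((S : Set ℂ)ᶜ) = 0) (hmean : ∫ x, x ∂P = 0) (hpower : ∫ x, ‖x‖ ^ 2 ∂P = 1) :
    ∃ T : Finset ℂ, P ((T : Set ℂ)ᶜ) = 0 ∧ UnitInput T fun x => P.real {x} := by
  classical
  have hT : P ((S.filter (fun x => P.real {x} ≠ 0) : Set ℂ)ᶜ) = 0 := by
    have hsub : ((S.filter (fun x => P.real {x} ≠ 0) : Set ℂ)ᶜ) ⊆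
        (S : Set ℂ)ᶜ ∪ ⋃ x ∈ S.filter (fun x => P.real {x} = 0), {x} := by
      intro x hx
      by_cases hxS : x ∈ S
      · right
        simp only [mem_compl_iff, Finset.mem_coe, Finset.mem_filter, not_and, not_not] at hx
        simp only [mem_iUnion, mem_singleton_iff, exists_prop, exists_eq_right', Finset.mem_filter]
        exact ⟨hxS, hx hxS⟩
      · left
        simpa using hxS
    refine measure_mono_null hsub (measure_union_null hS ?_)
    refine (measure_biUnion_null_iff (Finset.countable_toSet _)).2 fun x hx => ?_
    have := (Finset.mem_filter.1 (Finset.mem_coe.1 hx)).2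
    rwa [measureReal_eq_zero_iff] at this
  -- An undefined integral would be 0, not 1; integrability of `x` itself, needed to split the mean
  -- into coordinates, follows from ‖x‖ ≤ ‖x‖² + 1.
  have hsq : Integrable (fun x : ℂ => ‖x‖ ^ 2) P :=
    not_imp_comm.1 integral_undef (by rw [hpower]; norm_num)
  have hid : Integrable (fun x : ℂ => x) P := by
    refine (hsq.add (integrable_const (1 : ℝ))).mono' (by fun_prop) (Eventually.of_forall fun x =>
        ?_)
    simp only [Pi.add_apply]
    nlinarith [sq_nonneg (‖x‖ - 1)]
  refine ⟨_, hT, ?_⟩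
  refine ⟨fun x hx => ?_, sum_real_singleton_eq_one hT, ?_, ?_, ?_⟩
  · exact lt_of_le_of_ne measureReal_nonneg (Finset.mem_filter.1 hx).2.symm
  · have h1 := integral_re (𝕜 := ℂ) hid
    simp only [RCLike.re_to_complex] at h1
    rw [hmean, integral_eq_sum_of_compl_null hT, Complex.zero_re] at h1
    exact (Finset.sum_congr rfl fun x _ => mul_comm _ _).trans h1
  · have h1 := integral_im (𝕜 := ℂ) hid
    simp only [RCLike.im_to_complex] at h1
    rw [hmean, integral_eq_sum_of_compl_null hT, Complex.zero_im] at h1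
    exact (Finset.sum_congr rfl fun x _ => mul_comm _ _).trans h1
  · rw [integral_eq_sum_of_compl_null hT] at hpower
    refine (Finset.sum_congr rfl fun x _ => ?_).trans hpower
    rw [← Complex.normSq_eq_norm_sq, Complex.normSq_apply]
    ring

lemma scalarInfo_eq_avgInfo {P : Measure ℂ} [IsProbabilityMeasure P] {S : Finset ℂ}
    (hS : P ((S : Set ℂ)ᶜ) = 0) (hp : UnitInput S fun x => P.real {x}) {γ : ℝ} (hγ : 0 ≤ γ) :
    scalarInfo P γ = avgInfo S (fun x => P.real {x}) γ := by
  rw [gaussAvg_infoDensity hS hp hγ, hp.gaussAvg_infoDensity_eq hγ]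

lemma exp_sub_one_nonneg {s : ℝ} (hs : 0 ≤ s) : 0 ≤ Real.exp s - 1 := by
  linarith [Real.one_le_exp hs]

lemma exp_sub_one_pos {s : ℝ} (hs : 0 < s) : 0 < Real.exp s - 1 := by
  linarith [Real.one_lt_exp_iff.2 hs]

lemma UnitInput.hasDerivAt_exp_mul_mmse {S : Finset ℂ} {p : ℂ → ℝ} (hp : UnitInput S p) {s : ℝ}
    (hs : 0 < s) : HasDerivAt (fun s => Real.exp s * mmse S p (Real.exp s - 1))
      (Real.exp s * (mmse S p (Real.exp s - 1) -
        (1 + (Real.exp s - 1)) * covEnergy S p (Real.exp s - 1))) s := by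
  have h1 : HasDerivAt (fun s => mmse S p (Real.exp s - 1))
      (-covEnergy S p (Real.exp s - 1) * Real.exp s) s :=
    HasDerivAt.comp (h₂ := mmse S p) (h := fun s => Real.exp s - 1) s
      (hp.hasDerivAt_mmse (exp_sub_one_pos hs)) ((Real.hasDerivAt_exp s).sub_const 1)
  refine ((Real.hasDerivAt_exp s).fun_mul h1).congr_deriv ?_
  ring

lemma UnitInput.antitoneOn_exp_mul_mmse {S : Finset ℂ} {p : ℂ → ℝ} (hp : UnitInput S p) {D : Set ℝ}
    (hD : Convex ℝ D) (ho : IsOpen D) (h0 : ∀ s ∈ D, 0 < s)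
    (h : ∀ s ∈ D, mmse S p (Real.exp s - 1) ≤
      (1 + (Real.exp s - 1)) * covEnergy S p (Real.exp s - 1)) :
    AntitoneOn (fun s => Real.exp s * mmse S p (Real.exp s - 1)) D := by
  refine antitoneOn_of_deriv_nonpos hD
    (fun s hs => (hp.hasDerivAt_exp_mul_mmse (h0 s hs)).continuousAt.continuousWithinAt)
    (fun s hs => ?_) fun s hs => ?_
  · rw [ho.interior_eq] at hs
    exact (hp.hasDerivAt_exp_mul_mmse (h0 s hs)).differentiableAt.differentiableWithinAt
  · rw [ho.interior_eq] at hs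
    rw [(hp.hasDerivAt_exp_mul_mmse (h0 s hs)).deriv]
    exact mul_nonpos_of_nonneg_of_nonpos (Real.exp_pos s).le (by linarith [h s hs])

/-- The substitution γ = exp ζ - 1 turns the I-MMSE relation into a derivative exp ζ · mmse = (1 +
γ) mmse, and the low- and high-SNR inequalities into monotonicity of this derivative. -/
lemma logCurve_logInfo {P : Measure ℂ} [IsProbabilityMeasure P] {S : Finset ℂ}
    (hS : P ((S : Set ℂ)ᶜ) = 0) (hp : UnitInput S fun x => P.real {x}) :
    LogCurve (logInfo P) fun s => Real.exp s * mmse S (fun x => P.real {x}) (Real.exp s - 1) := by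
  set p : ℂ → ℝ := fun x => P.real {x}
  have heq : ∀ s ∈ Ici (0 : ℝ), logInfo P s = avgInfo S p (Real.exp s - 1) := fun s hs =>
    scalarInfo_eq_avgInfo hS hp (exp_sub_one_nonneg hs)
  have hmaps : MapsTo (fun s => Real.exp s - 1) (Ici 0) (Ici 0) := fun s hs => exp_sub_one_nonneg hs
  refine ⟨?_, ?_, ?_, ?_, ?_, ?_, ?_, ?_, ?_⟩
  · exact (hp.continuousOn_avgInfo.comp (by fun_prop) hmaps).congr heq
  · rw [heq 0 self_mem_Ici, Real.exp_zero, sub_self, hp.avgInfo_zero]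
  · intro s hs
    have h1 : HasDerivAt (fun s => avgInfo S p (Real.exp s - 1))
        (mmse S p (Real.exp s - 1) * Real.exp s) s :=
      HasDerivAt.comp (h₂ := avgInfo S p) (h := fun s => Real.exp s - 1) s
        (hp.hasDerivAt_avgInfo (exp_sub_one_pos hs)) ((Real.hasDerivAt_exp s).sub_const 1)
    rw [mul_comm] at h1
    refine h1.congr_of_eventuallyEq ?_
    filter_upwards [Ici_mem_nhds hs] with t ht using heq t ht
  · intro s hs
    exact mul_pos (Real.exp_pos s) (hp.mmse_pos (exp_sub_one_nonneg hs.le))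
  · intro s hs
    have := hp.one_add_mul_mmse_lt_one (exp_sub_one_pos hs)
    rwa [add_sub_cancel] at this
  · have h1 : ContinuousOn (fun s => Real.exp s * mmse S p (Real.exp s - 1)) (Ici 0) :=
      Real.continuous_exp.continuousOn.mul (hp.continuousOn_mmse.comp (by fun_prop) hmaps)
    have h2 := (h1 0 self_mem_Ici).tendsto
    rw [Real.exp_zero, sub_self, hp.mmse_zero, mul_one] at h2
    exact h2.mono_left (nhdsWithin_mono _ Ioi_subset_Ici_self)
  · exact ⟨_, fun s hs => (heq s hs).trans_le (hp.avgInfo_le (exp_sub_one_nonneg hs))⟩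
  · obtain ⟨ε, hε, h⟩ := hp.exists_low_snr
    refine ⟨Real.log (1 + ε), Real.log_pos (by linarith),
      hp.antitoneOn_exp_mul_mmse (convex_Ioo _ _) isOpen_Ioo (fun s hs => hs.1) fun s hs => ?_⟩
    refine h _ (exp_sub_one_pos hs.1) ?_
    have := (Real.lt_log_iff_exp_lt (by linarith)).1 hs.2
    linarith
  · obtain ⟨Γ, hΓ, h⟩ := hp.exists_high_snr
    have h0 : 0 ≤ Real.log (1 + Γ) := Real.log_nonneg (by linarith)
    refine ⟨Real.log (1 + Γ), h0, hp.antitoneOn_exp_mul_mmse (convex_Ioi _) isOpen_Ioi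
      (fun s hs => h0.trans_lt hs) fun s hs => ?_⟩
    refine h _ ?_
    have := (Real.log_lt_iff_lt_exp (by linarith)).1 (mem_Ioi.1 hs)
    linarith

/-! ### The gap and the thresholds in terms of the SNR -/

lemma scalarInfo_eq_logInfo (P : Measure ℂ) {γ : ℝ} (hγ : 0 ≤ γ) :
    scalarInfo P γ = logInfo P (Real.log (1 + γ)) := by
  rw [logInfo, Real.exp_log (by linarith), add_sub_cancel_left]

/-- In log-SNR coordinates the objective is the height of a chord of the curve above its graph. -/
lemma mem_gapFormulaSet_iff (P : Measure ℂ) (d : ℝ) :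
    d ∈ gapFormulaSet P ↔ ∃ s t ζ : ℝ, 0 ≤ s ∧ s ≤ ζ ∧ ζ ≤ t ∧ s < t ∧
      d = ((ζ - s) * (logInfo P t - logInfo P ζ) - (t - ζ) * (logInfo P ζ - logInfo P s)) /
        (t - s) := by
  constructor
  · rintro ⟨γ₁, γ₂, γ, h0, h1, h2, h3, rfl⟩
    refine ⟨Real.log (1 + γ₁), Real.log (1 + γ₂), Real.log (1 + γ), Real.log_nonneg (by linarith),
      Real.log_le_log (by linarith) (by linarith), Real.log_le_log (by linarith) (by linarith),
      Real.log_lt_log (by linarith) (by linarith), ?_⟩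
    rw [scalarInfo_eq_logInfo P h0, scalarInfo_eq_logInfo P (h0.trans h1),
      scalarInfo_eq_logInfo P (h0.trans h3.le), Real.log_div (by linarith) (by linarith),
      Real.log_div (by linarith) (by linarith), Real.log_div (by linarith) (by linarith)]
  · rintro ⟨s, t, ζ, h0, h1, h2, h3, rfl⟩
    refine ⟨Real.exp s - 1, Real.exp t - 1, Real.exp ζ - 1, exp_sub_one_nonneg h0, by gcongr,
      by gcongr, by gcongr, ?_⟩
    simp only [add_sub_cancel, ← Real.exp_sub, Real.log_exp]
    rfl

lemma LogCurve.isGreatest_gap {P : Measure ℂ} {f' : ℝ → ℝ} (hf : LogCurve (logInfo P) f') :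
    IsGreatest (gapSet P) (gap P) := by
  obtain ⟨s, hs, hmax⟩ := hf.exists_max_gap
  have h : IsGreatest (gapSet P) (concaveEnvelope (logInfo P) s - logInfo P s) := by
    refine ⟨⟨s, hs, rfl⟩, ?_⟩
    rintro _ ⟨t, ht, rfl⟩
    exact hmax t ht
  rw [gap, h.csSup_eq]
  exact h

lemma LogCurve.isLUB_gapFormulaSet {P : Measure ℂ} {f' : ℝ → ℝ} (hf : LogCurve (logInfo P) f') :
    IsLUB (gapFormulaSet P) (gap P) := by
  have hgap := hf.isGreatest_gap
  constructor
  · intro d hd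
    obtain ⟨s, t, ζ, h0, h1, h2, h3, rfl⟩ := (mem_gapFormulaSet_iff P d).1 hd
    exact (hf.chord_le h0 h1 h2 h3).trans (hgap.2 ⟨ζ, h0.trans h1, rfl⟩)
  · intro U hU
    obtain ⟨ζ, hζ, h⟩ := hgap.1
    rw [h]
    refine hf.gap_le_of_chords hζ ?_ fun s t h0 h1 h2 h3 =>
      hU ((mem_gapFormulaSet_iff P _).2 ⟨s, t, ζ, h0, h1, h2, h3, rfl⟩)
    -- A degenerate chord, with ζ at its left end, has excess 0, so every upper bound is
    -- nonnegative.
    exact hU ((mem_gapFormulaSet_iff P _).2 ⟨0, 1, 0, le_rfl, le_rfl, zero_le_one, one_pos, by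
        simp⟩)

lemma LogCurve.gap_nonneg {P : Measure ℂ} {f' : ℝ → ℝ} (hf : LogCurve (logInfo P) f') :
    0 ≤ gap P :=
  (sub_nonneg.2 (hf.le_envelope le_rfl)).trans (hf.isGreatest_gap.2 ⟨0, le_rfl, rfl⟩)

lemma isGreatest_snr {Q : ℝ → Prop} {z : ℝ} (h : IsGreatest {z | 0 ≤ z ∧ Q z} z) :
    IsGreatest {γ | 0 ≤ γ ∧ Q (Real.log (1 + γ))} (Real.exp z - 1) := by
  refine ⟨⟨exp_sub_one_nonneg h.1.1, ?_⟩, fun γ hγ => ?_⟩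
  · rw [add_sub_cancel, Real.log_exp]; exact h.1.2
  · have h0 : 0 ≤ γ := hγ.1
    have h1 := h.2 ⟨Real.log_nonneg (by linarith), hγ.2⟩
    have := (Real.log_le_iff_le_exp (by linarith)).1 h1
    linarith

lemma isLeast_snr {Q : ℝ → Prop} {z : ℝ} (h : IsLeast {z | 0 ≤ z ∧ Q z} z) :
    IsLeast {γ | 0 ≤ γ ∧ Q (Real.log (1 + γ))} (Real.exp z - 1) := by
  refine ⟨⟨exp_sub_one_nonneg h.1.1, ?_⟩, fun γ hγ => ?_⟩
  · rw [add_sub_cancel, Real.log_exp]; exact h.1.2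
  · have h0 : 0 ≤ γ := hγ.1
    have h1 := h.2 ⟨Real.log_nonneg (by linarith), hγ.2⟩
    have := (Real.le_log_iff_exp_le (by linarith)).1 h1
    linarith

/-! ### Channels -/

/-- Jensen's inequality for the uniform law on (-π, π). The open interval is used because the
constraints on the channel are imposed there only. -/
lemma mean_le_map_mean {g φ : ℝ → ℝ} {s : Set ℝ} (hφ : Continuous φ) (hg : ConcaveOn ℝ s g)
    (hgc : ContinuousOn g s) (hs : IsClosed s) (hφs : ∀ θ ∈ Ioo (-Real.pi) Real.pi, φ θ ∈ s)
    (hgφ : Continuous fun θ => g (φ θ)) :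
    1 / (2 * Real.pi) * ∫ θ in (-Real.pi)..Real.pi, g (φ θ) ≤
      g (1 / (2 * Real.pi) * ∫ θ in (-Real.pi)..Real.pi, φ θ) := by
  have hpi := Real.pi_pos
  have hle : -Real.pi ≤ Real.pi := by linarith
  have hvol : (volume : Measure ℝ).real (Ioo (-Real.pi) Real.pi) = 2 * Real.pi := by
    rw [Real.volume_real_Ioo_of_le hle]; ring
  have hint : ∀ {ψ : ℝ → ℝ}, Continuous ψ → IntegrableOn ψ (Ioo (-Real.pi) Real.pi) := fun hψ =>
    (hψ.integrableOn_Icc).mono_set Ioo_subset_Icc_self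
  have h := hg.le_map_set_average (μ := volume) (t := Ioo (-Real.pi) Real.pi) (f := φ) hgc hs
    (by simp [hpi]) (by simp) ((ae_restrict_iff' measurableSet_Ioo).2 (Eventually.of_forall hφs))
    (hint hφ) (hint hgφ)
  simp only [setAverage_eq, hvol, smul_eq_mul] at h
  simp only [intervalIntegral.integral_of_le hle, integral_Ioc_eq_integral_Ioo, one_div]
  exact h

section Channel

variable {P : Measure ℂ} {L : ℕ} (h : Fin L → ℂ)

/-- The log-SNR `log (1 + |H(θ)|²)` of the channel at frequency `θ`. -/
noncomputable def logGain (θ : ℝ) : ℝ := Real.log (1 + ‖transfer h θ‖ ^ 2)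

/-- The mean log-SNR of the channel. -/
noncomputable def meanLogGain : ℝ :=
  1 / (2 * Real.pi) * ∫ θ in (-Real.pi)..Real.pi, logGain h θ

lemma logGain_nonneg (θ : ℝ) : 0 ≤ logGain h θ :=
  Real.log_nonneg (by linarith [sq_nonneg ‖transfer h θ‖])

lemma continuous_logGain : Continuous (logGain h) := by
  have := continuous_transfer h
  exact Continuous.log (by fun_prop) fun θ => by positivity

lemma meanLogGain_nonneg : 0 ≤ meanLogGain h := by
  have hpi := Real.pi_pos
  exact mul_nonneg (by positivity)
    (intervalIntegral.integral_nonneg (by linarith) fun θ _ => logGain_nonneg h θ)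

lemma meanLogGain_eq : meanLogGain h = Real.log (1 + snrDFE h) := by
  rw [snrDFE, add_sub_cancel, Real.log_exp]
  rfl

lemma infoSL_eq : infoSL P h = logInfo P (meanLogGain h) := rfl

lemma infoOFDM_eq :
    infoOFDM P h = 1 / (2 * Real.pi) * ∫ θ in (-Real.pi)..Real.pi, logInfo P (logGain h θ) := by
  simp only [infoOFDM, logGain, ← scalarInfo_eq_logInfo P (sq_nonneg _)]

variable {f' : ℝ → ℝ}

lemma LogCurve.continuous_logInfo_logGain (hf : LogCurve (logInfo P) f') :
    Continuous fun θ => logInfo P (logGain h θ) :=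
  hf.cont.comp_continuous (continuous_logGain h) (logGain_nonneg h)

/-- Replace the curve by its envelope, then apply Jensen's inequality to the envelope; the mean
log-gain is exactly log(1 + SNR_DFE). -/
lemma LogCurve.infoOFDM_le_envelope (hf : LogCurve (logInfo P) f') :
    infoOFDM P h ≤ concaveEnvelope (logInfo P) (meanLogGain h) := by
  have hE : Continuous fun θ => concaveEnvelope (logInfo P) (logGain h θ) :=
    hf.continuousOn_envelope.comp_continuous (continuous_logGain h) (logGain_nonneg h)
  refine le_trans ?_ (mean_le_map_mean (continuous_logGain h) hf.concaveOn_envelope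
    hf.continuousOn_envelope isClosed_Ici (fun θ _ => logGain_nonneg h θ) hE)
  rw [infoOFDM_eq]
  have hpi := Real.pi_pos
  refine mul_le_mul_of_nonneg_left ?_ (by positivity)
  exact intervalIntegral.integral_mono_on (by linarith)
    ((hf.continuous_logInfo_logGain h).intervalIntegrable _ _) (hE.intervalIntegrable _ _)
    fun θ _ => hf.le_envelope (logGain_nonneg h θ)

lemma LogCurve.infoOFDM_le_of_concaveOn (hf : LogCurve (logInfo P) f') {s : Set ℝ}
    (hs : IsClosed s) (hs0 : s ⊆ Ici 0) (hconc : ConcaveOn ℝ s (logInfo P))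
    (hmem : ∀ θ ∈ Ioo (-Real.pi) Real.pi, logGain h θ ∈ s) : infoOFDM P h ≤ infoSL P h := by
  rw [infoOFDM_eq]
  exact mean_le_map_mean (continuous_logGain h) hconc (hf.cont.mono hs0) hs hmem
    (hf.continuous_logInfo_logGain h)

lemma LogCurve.infoOFDM_le_add_gap (hf : LogCurve (logInfo P) f') :
    infoOFDM P h ≤ infoSL P h + gap P := by
  have h1 := hf.infoOFDM_le_envelope h
  have h2 := hf.isGreatest_gap.2 ⟨meanLogGain h, meanLogGain_nonneg h, rfl⟩
  rw [infoSL_eq]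
  linarith

end Channel

/-- In the first case the envelope touches the curve at the mean log-gain, so the envelope bound is
already I_SL. In the other two the log-gains stay in an interval on which the curve is concave, and
Jensen's inequality applies to the curve itself. -/
lemma LogCurve.exists_snr_thresholds {P : Measure ℂ} {f' : ℝ → ℝ} (hf : LogCurve (logInfo P) f')
    (hgap : 0 < gap P) :
    ∃ γ₁ γ₀ γ₀' γ₂ : ℝ,
      0 < γ₁ ∧ γ₁ ≤ γ₀ ∧ γ₀ ≤ γ₀' ∧ γ₀' ≤ γ₂ ∧
      IsGreatest {γ : ℝ | 0 ≤ γ ∧ ∀ ζ ∈ Icc 0 (Real.log (1 + γ)),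
        concaveEnvelope (logInfo P) ζ = logInfo P ζ} γ₁ ∧
      IsGreatest {γ : ℝ | 0 ≤ γ ∧ ConcaveOn ℝ (Icc 0 (Real.log (1 + γ))) (logInfo P)} γ₀ ∧
      IsLeast {γ : ℝ | 0 ≤ γ ∧ ConcaveOn ℝ (Ici (Real.log (1 + γ))) (logInfo P)} γ₀' ∧
      IsLeast {γ : ℝ | 0 ≤ γ ∧ ∀ ζ ∈ Ici (Real.log (1 + γ)),
        concaveEnvelope (logInfo P) ζ = logInfo P ζ} γ₂ ∧
      ∀ (L : ℕ) (h : Fin L → ℂ),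
        (snrDFE h ∈ Icc 0 γ₁ ∪ Ici γ₂ ∨
          (∀ θ ∈ Ioo (-Real.pi) Real.pi, ‖transfer h θ‖ ^ 2 ≤ γ₀) ∨
          (∀ θ ∈ Ioo (-Real.pi) Real.pi, γ₀' ≤ ‖transfer h θ‖ ^ 2)) →
        infoOFDM P h ≤ infoSL P h := by
  obtain ⟨s, hs, hgs⟩ := hf.isGreatest_gap.1
  obtain ⟨z₁, z₀, z₀', z₂, h1, h10, h00, h02, g1, g0, l0, l2⟩ :=
    hf.exists_thresholds ⟨s, hs, fun he => by rw [he, sub_self] at hgs; exact hgap.ne' hgs⟩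
  have G1 := isGreatest_snr (Q := fun z => ∀ ζ ∈ Icc 0 z,
    concaveEnvelope (logInfo P) ζ = logInfo P ζ) g1
  have G0 := isGreatest_snr (Q := fun z => ConcaveOn ℝ (Icc 0 z) (logInfo P)) g0
  have L0 := isLeast_snr (Q := fun z => ConcaveOn ℝ (Ici z) (logInfo P)) l0
  have L2 := isLeast_snr (Q := fun z => ∀ ζ ∈ Ici z,
    concaveEnvelope (logInfo P) ζ = logInfo P ζ) l2
  refine ⟨_, _, _, _, exp_sub_one_pos h1, by gcongr, by gcongr, by gcongr, G1, G0, L0, L2, ?_⟩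
  rintro L h ((hsnr | hsnr) | hle | hge)
  · have hm : meanLogGain h ∈ Icc 0 (Real.log (1 + (Real.exp z₁ - 1))) :=
      ⟨meanLogGain_nonneg h, by
        rw [meanLogGain_eq]
        exact Real.log_le_log (by linarith [hsnr.1]) (by linarith [hsnr.2])⟩
    rw [infoSL_eq, ← G1.1.2 _ hm]
    exact hf.infoOFDM_le_envelope h
  · have hm : meanLogGain h ∈ Ici (Real.log (1 + (Real.exp z₂ - 1))) := by
      rw [meanLogGain_eq]
      exact Real.log_le_log (by linarith [Real.exp_pos z₂]) (by linarith [mem_Ici.1 hsnr])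
    rw [infoSL_eq, ← L2.1.2 _ hm]
    exact hf.infoOFDM_le_envelope h
  · refine hf.infoOFDM_le_of_concaveOn h isClosed_Icc (fun s hs => hs.1) G0.1.2 fun θ hθ => ?_
    exact ⟨logGain_nonneg h θ, Real.log_le_log (by positivity) (by linarith [hle θ hθ])⟩
  · refine hf.infoOFDM_le_of_concaveOn h isClosed_Ici (Ici_subset_Ici.2
      (Real.log_nonneg (by linarith [L0.1.1]))) L0.1.2 fun θ hθ => ?_
    exact Real.log_le_log (by linarith [Real.exp_pos z₀']) (by linarith [hge θ hθ])

end ISIChannel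

theorem theorem1
    (P : Measure ℂ) [IsProbabilityMeasure P]
    (S : Finset ℂ) (hS : P ((S : Set ℂ)ᶜ) = 0)
    (hmean : ∫ x, x ∂P = 0) (hpower : ∫ x, ‖x‖ ^ 2 ∂P = 1) :
    -- `Δ_x` is the largest gap, is nonnegative, and is given by the explicit supremum
    IsGreatest (ISIChannel.gapSet P) (ISIChannel.gap P) ∧
    IsLUB (ISIChannel.gapFormulaSet P) (ISIChannel.gap P) ∧
    0 ≤ ISIChannel.gap P ∧
    -- `I_OFDM` is the limit of the OFDM rates, and `I_OFDM ≤ I_SL + Δ_x`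
    (∀ (L : ℕ) (h : Fin L → ℂ),
      (∀ Ncp : ℕ → ℕ, Tendsto Ncp atTop atTop →
        (fun N : ℕ => (Ncp N : ℝ)) =o[atTop] (fun N : ℕ => (N : ℝ)) →
        Tendsto (fun N : ℕ => ISIChannel.ofdmRate P h N (Ncp N)) atTop
          (𝓝 (ISIChannel.infoOFDM P h))) ∧
      ISIChannel.infoOFDM P h ≤ ISIChannel.infoSL P h + ISIChannel.gap P) ∧
    -- the thresholds, which depend on `P` only
    (0 < ISIChannel.gap P →
      ∃ γ₁ γ₀ γ₀' γ₂ : ℝ,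
        0 < γ₁ ∧ γ₁ ≤ γ₀ ∧ γ₀ ≤ γ₀' ∧ γ₀' ≤ γ₂ ∧
        IsGreatest {γ : ℝ | 0 ≤ γ ∧ ∀ ζ ∈ Icc 0 (Real.log (1 + γ)),
          ISIChannel.concaveEnvelope (ISIChannel.logInfo P) ζ = ISIChannel.logInfo P ζ} γ₁ ∧
        IsGreatest {γ : ℝ | 0 ≤ γ ∧
          ConcaveOn ℝ (Icc 0 (Real.log (1 + γ))) (ISIChannel.logInfo P)} γ₀ ∧
        IsLeast {γ : ℝ | 0 ≤ γ ∧
          ConcaveOn ℝ (Ici (Real.log (1 + γ))) (ISIChannel.logInfo P)} γ₀' ∧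
        IsLeast {γ : ℝ | 0 ≤ γ ∧ ∀ ζ ∈ Ici (Real.log (1 + γ)),
          ISIChannel.concaveEnvelope (ISIChannel.logInfo P) ζ = ISIChannel.logInfo P ζ} γ₂ ∧
        ∀ (L : ℕ) (h : Fin L → ℂ),
          (ISIChannel.snrDFE h ∈ Icc 0 γ₁ ∪ Ici γ₂ ∨
            (∀ θ ∈ Ioo (-Real.pi) Real.pi, ‖ISIChannel.transfer h θ‖ ^ 2 ≤ γ₀) ∨
            (∀ θ ∈ Ioo (-Real.pi) Real.pi, γ₀' ≤ ‖ISIChannel.transfer h θ‖ ^ 2)) →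
          ISIChannel.infoOFDM P h ≤ ISIChannel.infoSL P h) := by
  obtain ⟨T, hT, hp⟩ := ISIChannel.exists_unitInput P hS hmean hpower
  have hf := ISIChannel.logCurve_logInfo hT hp
  have hcont : ContinuousOn (ISIChannel.scalarInfo P) (Ici 0) :=
    hp.continuousOn_avgInfo.congr fun γ hγ => ISIChannel.scalarInfo_eq_avgInfo hT hp hγ
  exact ⟨hf.isGreatest_gap, hf.isLUB_gapFormulaSet, hf.gap_nonneg,
    fun L h => ⟨fun Ncp _ hNcp => ISIChannel.tendsto_ofdmRate hS hcont h Ncp hNcp,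
      hf.infoOFDM_le_add_gap h⟩, fun hgap => hf.exists_snr_thresholds hgap⟩
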